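/- Let $H$ be a complex Hilbert space and let $A:D(A)\subset H\to H$ be a densely defined operator that generates a strongly continuous semigroup, has compact resolvent and is either self-adjoint or skew-adjoint. Let $m\in\mathbb N$ and suppose that $H=\bigoplus_{i=1}^m H_i$ is an orthogonal direct sum and that $H_i$ has an orthonormal basis $(\varphi_{i,n})_{n\ge1}$ of eigenvectors, $A\varphi_{i,n}=\lambda_{i,n}\varphi_{i,n}$, with $\lambda_{i,n}\ne\lambda_{i,k}$ for $n\neq k$. Assume that there are $\alpha>1$ and $c,C>0$ with $$c\,n^{\alpha-1}\le|\lambda_{i,n+1}-\lambda_{i,n}|\le C\,n^{\alpha-1},\qquad c\,k^{\alpha-1}|k-n|\le|\lambda_{i,k}-\lambda_{i,n}|\qquad(i\le m,\ k,n\ge1).$$ Let $B\in\mathcal L(\mathbb C^m;D(A^*)')$ act block-wise, i.e. with $b_{i,n}:=\langle Be_i,\varphi_{i,n}\rangle$ one has $c\le|b_{i,n}|\le C$ and $\langle Be_j,\varphi_{i,n}\rangle=0$ for $j\ne i$. For $s\ge0$ let $D(A^s)=\{f\in H:\sum_{i,n}|\lambda_{i,n}|^{2s}|\langle f,\varphi_{i,n}\rangle|^2<\infty\}$,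 with norm $\|f\|_{D(A^s)}^2=\|f\|^2+\sum_{i,n}|\lambda_{i,n}|^{2s}|\langle f,\varphi_{i,n}\rangle|^2$. Let $\mathcal N=\{\lambda_{i,p}-\lambda_{i,q}: i\le m,\ p,q\ge1\}$. For $\lambda>0$, $\lambda\notin\mathcal N$, let $K_\lambda:D(K_\lambda)\subset H\to\mathbb C^m$ be the feedback $(K_\lambda f)_i=\sum_{n}k_{i,n}\langle f,\varphi_{i,n}\rangle$, with domain the set of $f$ for which these series converge absolutely, where $$k_{i,n}\,b_{i,n}=\sum_{j\ge1}\frac{\lambda^2}{\lambda_{i,j}-\lambda_{i,n}-\lambda}\prod_{p\ne n}\Big(1+\frac{\lambda}{\lambda_{i,n}-\lambda_{i,p}}\Big)\prod_{q\ne j}\Big(1-\frac{\lambda}{\lambda_{i,j}-\lambda_{i,q}}\Big).$$ The operator $A+BK_\lambda$ has domain $\{f\in D(K_\lambda): Af+BK_\lambda f\in H\}$, the sum being taken in $D(A^*)'$. **Theorem.** Let $\gamma>\frac{\alpha}{\alpha-1}$. There are a constant $C'$ and numbers $\lambda(N)\in[N^\gamma,N^\gamma+C']\setminus\mathcal N$,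 $N\ge1$, such that for every $\sigma\in(\frac{\alpha}{\alpha-1},\gamma)$ and every $T>0$ the following holds. The sum $L=\sum_{N\ge1}\lambda(N)^{-1/\sigma}$ is finite; put $t_0=0$, $t_N=\frac TL\sum_{p=1}^N\lambda(p)^{-1/\sigma}$, so that $t_N\to T$, and $$K(t)=K_{\lambda(N)}\quad\text{for } t\in[t_{N-1},t_N),\ N\ge1.$$ Then for every $s\in[0,1-\frac1{2\alpha})$ the closed-loop system $$y'(t)=(A+BK(t))y(t)\quad (0<t<T),\qquad y(0)=y_0,$$ is well-posed in $D(A^s)$: for each $y_0\in D(A^s)$ it has exactly one mild solution $y\in C([0,T);D(A^s))$ (that is, $y(0)=y_0$ and, on each $[a,b]\subset[0,T)$ such that $K$ is constant on $[a,b)$, $\int_a^b y\in D(A+BK(a))$ and $y(b)-y(a)=(A+BK(a))\int_a^b y$), and $\|y(t)\|_{D(A^s)}\le M\|y_0\|_{D(A^s)}$ for $0\le t<T$ with $M$ independent of $y_0$ and $t$. This solution extends continuously to $[0,T]$ in $D(A^s)$ with $y(T)=0$. If moreover $s>\frac1{2\alpha}$, then $y(t)\in D(K(t))$ for all $t\in[0,T)$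 and $K(t)y(t)\to0$ as $t\to T^-$. -/

import Mathlib

open Set Filter Topology
open scoped InnerProductSpace

noncomputable section

namespace Backstepping

section Operators

variable {H : Type*} [NormedAddCommGroup H] [InnerProductSpace ℂ H] [CompleteSpace H]

/-- `S` (restricted to `t ≥ 0`) is a strongly continuous semigroup of bounded operators on `H`. -/
structure IsC0Semigroup (S : ℝ → H →L[ℂ] H) : Prop where
  zero : S 0 = ContinuousLinearMap.id ℂ H
  add : ∀ s t : ℝ, 0 ≤ s → 0 ≤ t → S (s + t) = (S s).comp (S t)
  strong : ∀ x : H, Tendsto (fun t : ℝ => S t x) (𝓝[>] 0) (𝓝 x)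

/-- `A` is the infinitesimal generator of `S`: the graph of `A` is the set of all `(x, y)` with
`y = lim_{t → 0⁺} (S t x - x) / t`. -/
def IsGenerator (S : ℝ → H →L[ℂ] H) (A : H →ₗ.[ℂ] H) : Prop :=
  ∀ x y : H, (∃ hx : x ∈ A.domain, A ⟨x, hx⟩ = y) ↔
    Tendsto (fun t : ℝ => ((t : ℂ)⁻¹) • (S t x - x)) (𝓝[>] 0) (𝓝 y)

/-- For some `μ` the operator `A - μ` is a bijection from `D(A)` onto `H` with compact inverse. -/
def HasCompactResolvent (A : H →ₗ.[ℂ] H) : Prop :=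
  ∃ μ : ℂ, ∃ R : H →L[ℂ] H, IsCompactOperator R ∧
    (∀ x : H, ∃ hx : R x ∈ A.domain, A ⟨R x, hx⟩ - μ • R x = x) ∧
    ∀ x : A.domain, R (A x - μ • (x : H)) = x

/-- `D(A*)'`: the continuous conjugate-linear functionals on `D(A*)`, where `D(A*)` carries its
graph norm (it is identified with the graph of `A*`). The space `H` embeds into it by
`f ↦ (x ↦ ⟨f, x⟩)`, the inner product being conjugate-linear in `x`. -/
abbrev DualAdj (A : H →ₗ.[ℂ] H) : Type _ := A.adjoint.graph →SL[starRingEnd ℂ] ℂ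

/-- The duality bracket `⟨ℓ, x⟩` of `ℓ ∈ D(A*)'` and `x ∈ D(A*)`. -/
def bracket {A : H →ₗ.[ℂ] H} (ℓ : DualAdj A) (x : A.adjoint.domain) : ℂ :=
  ℓ ⟨((x : H), A.adjoint x), A.adjoint.mem_graph x⟩

variable {m : ℕ}

open Classical in
/-- The coefficient `⟨B e_j, x⟩` of the control operator, `e_j` being the `j`-th basis vector
of `ℂ^m` (and `0` if `x ∉ D(A*)`). -/
def controlCoeff {A : H →ₗ.[ℂ] H} (B : EuclideanSpace ℂ (Fin m) →L[ℂ] DualAdj A)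
    (j : Fin m) (x : H) : ℂ :=
  if hx : x ∈ A.adjoint.domain then bracket (B (EuclideanSpace.single j 1)) ⟨x, hx⟩ else 0

/-- The standing assumptions on `(A, B)`. The closed span of `φ (i, n)`, `n ∈ ℕ`, is the
`i`-th invariant subspace, on which the `i`-th scalar control acts. Indices `n` start at `0`, so that the
`n`-th eigenvalue of the mathematical text is `ev i (n - 1)`. -/
structure Framework (A : H →ₗ.[ℂ] H) (B : EuclideanSpace ℂ (Fin m) →L[ℂ] DualAdj A)
    (φ : HilbertBasis (Fin m × ℕ) ℂ H) (ev : Fin m → ℕ → ℂ) (α : ℝ) : Prop where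
  dense : Dense (A.domain : Set H)
  generates : ∃ S : ℝ → H →L[ℂ] H, IsC0Semigroup S ∧ IsGenerator S A
  compact_resolvent : HasCompactResolvent A
  self_or_skew : A.adjoint = A ∨ A.adjoint = -A
  eigen : ∀ i n, ∃ h : φ (i, n) ∈ A.domain, A ⟨φ (i, n), h⟩ = ev i n • φ (i, n)
  simple : ∀ i, Function.Injective (ev i)
  control_diag : ∃ c C : ℝ, 0 < c ∧
    ∀ i (n : ℕ), c ≤ ‖controlCoeff B i (φ (i, n))‖ ∧ ‖controlCoeff B i (φ (i, n))‖ ≤ C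
  control_off : ∀ i j n, i ≠ j → controlCoeff B j (φ (i, n)) = 0
  one_lt : 1 < α
  gap : ∃ c C : ℝ, 0 < c ∧ ∀ i (n : ℕ),
    c * ((n : ℝ) + 1) ^ (α - 1) ≤ ‖ev i (n + 1) - ev i n‖ ∧
    ‖ev i (n + 1) - ev i n‖ ≤ C * ((n : ℝ) + 1) ^ (α - 1)
  gap_all : ∃ c : ℝ, 0 < c ∧ ∀ i (k n : ℕ),
    c * ((k : ℝ) + 1) ^ (α - 1) * |(k : ℝ) - n| ≤ ‖ev i k - ev i n‖

/-- `D(A^s)`, defined spectrally. -/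
def powDomain (φ : HilbertBasis (Fin m × ℕ) ℂ H) (ev : Fin m → ℕ → ℂ) (s : ℝ) : Set H :=
  {f | Summable fun p : Fin m × ℕ => ‖ev p.1 p.2‖ ^ (2 * s) * ‖⟪φ p, f⟫_ℂ‖ ^ 2}

/-- The (graph) norm of `D(A^s)`; the term `‖f‖ ^ 2` is there because `0` may be an eigenvalue. -/
def powNorm (φ : HilbertBasis (Fin m × ℕ) ℂ H) (ev : Fin m → ℕ → ℂ) (s : ℝ) (f : H) : ℝ :=
  √(‖f‖ ^ 2 + ∑' p : Fin m × ℕ, ‖ev p.1 p.2‖ ^ (2 * s) * ‖⟪φ p, f⟫_ℂ‖ ^ 2)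

/-- `y` takes values in `D(A^s)` on `I` and is continuous on `I` for the norm of `D(A^s)`. -/
def ContinuousOnPow (φ : HilbertBasis (Fin m × ℕ) ℂ H) (ev : Fin m → ℕ → ℂ) (s : ℝ)
    (y : ℝ → H) (I : Set ℝ) : Prop :=
  ∀ t ∈ I, y t ∈ powDomain φ ev s ∧
    Tendsto (fun τ => powNorm φ ev s (y τ - y t)) (𝓝[I] t) (𝓝 0)

/-- `f ∈ D(A + BK)` and `(A + BK) f = g`: `f` lies in `D(K)`, and `A f + B K f`, computed in
`D(A*)'`, is the element `g` of `H`. -/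
def ClosedLoopApply (A : H →ₗ.[ℂ] H) (B : EuclideanSpace ℂ (Fin m) →L[ℂ] DualAdj A)
    (K : H →ₗ.[ℂ] EuclideanSpace ℂ (Fin m)) (f g : H) : Prop :=
  ∃ hf : f ∈ K.domain, ∀ x : A.adjoint.domain,
    ⟪(x : H), g⟫_ℂ = ⟪A.adjoint x, f⟫_ℂ + bracket (B (K ⟨f, hf⟩)) x

/-- `y ∈ C([0,T); D(A^s))` is the (mild) solution of `y' = (A + B K(t)) y` on `[0,T)`,
`y(0) = y₀`, for a piecewise constant `K`: on every `[a,b] ⊆ [0,T)` such that `K` is constant on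
`[a,b)`, one has `∫_a^b y ∈ D(A + B K(a))` and `y b - y a = (A + B K(a)) ∫_a^b y`. -/
structure IsSolution (A : H →ₗ.[ℂ] H) (B : EuclideanSpace ℂ (Fin m) →L[ℂ] DualAdj A)
    (φ : HilbertBasis (Fin m × ℕ) ℂ H) (ev : Fin m → ℕ → ℂ) (s T : ℝ)
    (K : ℝ → H →ₗ.[ℂ] EuclideanSpace ℂ (Fin m)) (y₀ : H) (y : ℝ → H) : Prop where
  initial : y 0 = y₀
  continuous : ContinuousOnPow φ ev s y (Ico 0 T)
  equation : ∀ a b : ℝ, 0 ≤ a → a ≤ b → b < T → (∀ t ∈ Ico a b, K t = K a) →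
    ClosedLoopApply A B (K a) (∫ τ in a..b, y τ) (y b - y a)

end Operators

section Feedback

/-- The resonant set: all differences of two eigenvalues on a common invariant subspace. -/
def resonantSet {m : ℕ} (ev : Fin m → ℕ → ℂ) : Set ℂ :=
  {z | ∃ i p q, z = ev i p - ev i q}

/-- The entry `(i, j)` of the inverse of the infinite Cauchy matrix `1 / (μ_i - μ_j - lam)`. -/
def invCauchy (μ : ℕ → ℂ) (lam : ℝ) (i j : ℕ) : ℂ :=
  (lam : ℂ) ^ 2 / (μ j - μ i - lam) *
    (∏' p : {p : ℕ // p ≠ i}, (1 + (lam : ℂ) / (μ i - μ p))) *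
    ∏' q : {q : ℕ // q ≠ j}, (1 - (lam : ℂ) / (μ j - μ q))

/-- The feedback coefficient `k_n`, defined by `k_n b_n = ∑_j invCauchy μ lam n j`. -/
def gain (μ b : ℕ → ℂ) (lam : ℝ) (n : ℕ) : ℂ :=
  (b n)⁻¹ * ∑' j, invCauchy μ lam n j

variable {H : Type*} [NormedAddCommGroup H] [InnerProductSpace ℂ H] [CompleteSpace H] {m : ℕ}

/-- The unbounded functional tuple `f ↦ (∑_n k i n ⟨f, φ (i, n)⟩)_i`, with domain the set of all `f`
for which these series converge absolutely. -/
def diagFunctional (φ : HilbertBasis (Fin m × ℕ) ℂ H) (k : Fin m → ℕ → ℂ) :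
    H →ₗ.[ℂ] EuclideanSpace ℂ (Fin m) where
  domain :=
    { carrier := {f | ∀ i, Summable fun n => k i n * ⟪φ (i, n), f⟫_ℂ}
      zero_mem' := fun i => by simp
      add_mem' := fun {f g} hf hg i => by
        simpa only [inner_add_right, mul_add] using (hf i).add (hg i)
      smul_mem' := fun c f hf i => by
        simpa only [inner_smul_right, mul_left_comm] using (hf i).mul_left c }
  toFun :=
    { toFun := fun f => WithLp.toLp 2 fun i => ∑' n, k i n * ⟪φ (i, n), (f : H)⟫_ℂ
      map_add' := fun f g => by
        ext i
        simpa only [Submodule.coe_add, inner_add_right, mul_add, PiLp.add_apply]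
          using (f.2 i).tsum_add (g.2 i)
      map_smul' := fun c f => by
        ext i
        simpa only [Submodule.coe_smul, inner_smul_right, mul_left_comm, PiLp.smul_apply,
          smul_eq_mul, RingHom.id_apply] using (f.2 i).tsum_mul_left c }

/-- The backstepping feedback `K_lam`. -/
def feedback {A : H →ₗ.[ℂ] H} (B : EuclideanSpace ℂ (Fin m) →L[ℂ] DualAdj A)
    (φ : HilbertBasis (Fin m × ℕ) ℂ H) (ev : Fin m → ℕ → ℂ) (lam : ℝ) :
    H →ₗ.[ℂ] EuclideanSpace ℂ (Fin m) :=
  diagFunctional φ fun i => gain (ev i) (fun n => controlCoeff B i (φ (i, n))) lam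

/-- `t_N = ∑_{p=1}^N δ_p` with `δ_p = (T / L) lam(p)^(-1/σ)` and `L = ∑_{p ≥ 1} lam(p)^(-1/σ)`. -/
def switchTime (lam : ℕ → ℝ) (σ T : ℝ) (N : ℕ) : ℝ :=
  ∑ p ∈ Finset.Icc 1 N, T / (∑' q : ℕ, lam (q + 1) ^ (-(1 / σ))) * lam p ^ (-(1 / σ))

/-- The piecewise constant feedback `K(t) = K_{lam(N)}` for `t ∈ [t_{N-1}, t_N)`, `N ≥ 1`
(`N` is the least index with `t < t_N`). -/
def piecewiseFeedback {A : H →ₗ.[ℂ] H} (B : EuclideanSpace ℂ (Fin m) →L[ℂ] DualAdj A)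
    (φ : HilbertBasis (Fin m × ℕ) ℂ H) (ev : Fin m → ℕ → ℂ) (lam : ℕ → ℝ) (σ T : ℝ) (t : ℝ) :
    H →ₗ.[ℂ] EuclideanSpace ℂ (Fin m) :=
  feedback B φ ev (lam (sInf {N : ℕ | t < switchTime lam σ T N}))

end Feedback

end Backstepping

end

/-!
On one block the closed loop `A + B K_lam` is the diagonal operator `(μ n)` perturbed by the rank-one
operator `b ⊗ k`. The vectors `(b n / (μ j - lam - μ n))_n` are eigenvectors of it, with eigenvalues
`μ j - lam`, exactly when `∑ n, k n * b n / (μ j - lam - μ n) = 1` for all `j`. The gains of the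
statement solve this infinite Cauchy system: `k n * b n = -lam * ∏_{p ≠ n} (1 + lam / (μ n - μ p))`
(`gain_eq`, `hasSum_cauchyTProd_characteristic`). The identities needed are partial fraction
expansions, proved for finitely many nodes by Lagrange interpolation and passed to the limit. The
same argument gives an explicit inverse of the matrix of eigenvectors
(`hasSum_cauchyTProd_mul_inv_mul_inv`), so that `A + B K_lam = Ψ (A - lam) R` with `Ψ R = 1`
(`exists_isDiagonalization`). The semigroup generated is `Ψ exp(t (A - lam)) R`: its orbits are mild
solutions, and the rows of `R`, being left eigenvectors, turn any mild solution into decoupled scalar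
equations, which gives uniqueness.

By the gap condition `Ψ` and `R` are dominated by the Toeplitz kernel `(1 + |n - j|)^(-α)`. In
coordinates `D(A^s)` is `ℓ²` with the weight `(n + 1)^(2 α s)`, on which this kernel is bounded by
Schur's test as long as `α s < α - 1 / 2` (`exists_blockToep_schur`); this is the restriction
`s < 1 - 1 / (2 α)`. The products grow at most like `exp (K lam^β)` for any `β > 1 / α`
(`exists_norm_cauchyProd_le`). By pigeonhole, `lam` can be chosen in each interval `[x, x + 1]` at a
distance from the resonant set that is polynomially small at worst (`exists_farFromResonance`), and
then the closed-loop semigroup has norm at most `exp (K lam^β) exp ((w - lam) t)` on `D(A^s)`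
(`Framework.exists_closedLoopFlow`).

Over a switching interval, of length proportional to `lam^(-1/σ)`, the decay rate `lam` yields a
factor `exp (-κ lam^(1 - 1/σ))`. As `σ > α / (α - 1)` means `1 - 1/σ > 1/α`, one can take `β`
strictly between these two numbers; the accumulated decay then beats the growth of the current step
(`tendsto_exp_mul_switchGrowth`). Hence the switched trajectory is bounded and tends to zero at `T`
(`exists_switched_solution`). For `s > 1 / (2 α)` the functional `K_lam` is bounded on `D(A^s)` by
its largest gain, up to a constant, by the Cauchy–Schwarz inequality; the gain is again at most
`exp (K lam^β)`, so the control tends to zero as well.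
-/

namespace Backstepping

open scoped ComplexConjugate

/-! ### Schur's test -/

section Schur
open scoped ENNReal

/-- The Cauchy–Schwarz inequality for the measure with weights `u`. -/
lemma ennreal_tsum_mul_sq_le {ι : Type*} (u x : ι → ℝ≥0∞) :
    (∑' i, u i * x i) ^ 2 ≤ (∑' i, u i) * ∑' i, u i * x i ^ 2 := by
  have key : ∑' i, u i * x i ≤ (∑' i, u i) ^ (1 / 2 : ℝ) * (∑' i, u i * x i ^ 2) ^ (1 / 2 : ℝ) := by
    rw [ENNReal.tsum_eq_iSup_sum]
    refine iSup_le fun s => ?_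
    have h := ENNReal.inner_le_Lp_mul_Lq s (fun i => u i ^ (1 / 2 : ℝ))
      (fun i => u i ^ (1 / 2 : ℝ) * x i) Real.HolderConjugate.two_two
    have e1 : ∀ i, u i ^ (1 / 2 : ℝ) * (u i ^ (1 / 2 : ℝ) * x i) = u i * x i := fun i => by
      rw [← mul_assoc, ← ENNReal.rpow_add_of_nonneg _ _ (by norm_num) (by norm_num)]
      norm_num
    have e2 : ∀ i, (u i ^ (1 / 2 : ℝ)) ^ (2 : ℝ) = u i := fun i => by
      rw [← ENNReal.rpow_mul]; norm_num
    simp only [e1, ENNReal.mul_rpow_of_nonneg _ _ (zero_le_two : (0 : ℝ) ≤ 2), e2,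
      ENNReal.rpow_two] at h
    refine h.trans ?_
    gcongr
    · exact ENNReal.sum_le_tsum s
    · exact ENNReal.sum_le_tsum s
  calc (∑' i, u i * x i) ^ 2
      ≤ ((∑' i, u i) ^ (1 / 2 : ℝ) * (∑' i, u i * x i ^ 2) ^ (1 / 2 : ℝ)) ^ 2 := by gcongr
    _ = _ := by
      rw [mul_pow, ← ENNReal.rpow_two, ← ENNReal.rpow_two, ← ENNReal.rpow_mul, ← ENNReal.rpow_mul]
      norm_num

/-- Schur's test: `h` is the test vector of the rows, `h'` that of the columns, and `v`, `w` are the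
weights of the two `ℓ²` spaces. -/
lemma ennreal_schur_test {ι κ : Type*} (k : ι → κ → ℝ≥0∞) (h v' : ι → ℝ≥0∞) (g : κ → ℝ≥0∞)
    (v : ι → ℝ≥0∞) (w : κ → ℝ≥0∞) (hg0 : ∀ q, g q ≠ 0) (hg : ∀ q, g q ≠ ⊤) (C D : ℝ≥0∞)
    (hrow : ∀ p, ∑' q, k p q * g q ≤ C * h p)
    (hv : ∀ p, v p * h p = v' p)
    (hcol : ∀ q, ∑' p, v' p * k p q ≤ D * (w q * g q)) (f : κ → ℝ≥0∞) :
    ∑' p, v p * (∑' q, k p q * f q) ^ 2 ≤ C * D * ∑' q, w q * f q ^ 2 := by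
  have h1 : ∀ p, v p * (∑' q, k p q * f q) ^ 2 ≤
      C * ∑' q, v' p * k p q * ((g q)⁻¹ * f q ^ 2) := fun p => by
    have e1 : ∀ q, k p q * g q * (f q / g q) = k p q * f q := fun q => by
      rw [mul_assoc, ENNReal.mul_div_cancel (hg0 q) (hg q)]
    have e2 : ∀ q, k p q * g q * (f q / g q) ^ 2 = k p q * ((g q)⁻¹ * f q ^ 2) := fun q => by
      rw [sq, ← mul_assoc, e1, div_eq_mul_inv]; ring
    have h2 := ennreal_tsum_mul_sq_le (fun q => k p q * g q) (fun q => f q / g q)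
    simp only [e1, e2] at h2
    calc v p * (∑' q, k p q * f q) ^ 2
        ≤ v p * ((C * h p) * ∑' q, k p q * ((g q)⁻¹ * f q ^ 2)) := by
          gcongr; exact h2.trans (by gcongr; exact hrow p)
      _ = C * ((v p * h p) * ∑' q, k p q * ((g q)⁻¹ * f q ^ 2)) := by ring
      _ = _ := by
        rw [hv, ← ENNReal.tsum_mul_left]
        simp only [mul_assoc]
  calc ∑' p, v p * (∑' q, k p q * f q) ^ 2
      ≤ ∑' p, C * ∑' q, v' p * k p q * ((g q)⁻¹ * f q ^ 2) := ENNReal.tsum_le_tsum h1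
    _ = C * ∑' q, (∑' p, v' p * k p q) * ((g q)⁻¹ * f q ^ 2) := by
      rw [ENNReal.tsum_mul_left, ENNReal.tsum_comm]
      simp only [ENNReal.tsum_mul_right]
    _ ≤ C * ∑' q, D * (w q * g q) * ((g q)⁻¹ * f q ^ 2) := by
      gcongr with q; exact hcol q
    _ = C * ∑' q, D * (w q * f q ^ 2) := by
      congr 1; refine tsum_congr fun q => ?_
      calc D * (w q * g q) * ((g q)⁻¹ * f q ^ 2) = D * (w q * f q ^ 2) * (g q * (g q)⁻¹) := by ring
        _ = _ := by rw [ENNReal.mul_inv_cancel (hg0 q) (hg q), mul_one]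
    _ = _ := by rw [ENNReal.tsum_mul_left, mul_assoc]

end Schur

/-! ### Toeplitz kernels on weighted `ℓ²` -/

section Toeplitz
open scoped ENNReal

/-- The Toeplitz kernel `(1 + |n - j|)^(-α)`. -/
noncomputable def toep (α : ℝ) (n j : ℕ) : ℝ := (1 + |(n : ℝ) - j|) ^ (-α)

lemma toep_pos (α : ℝ) (n j : ℕ) : 0 < toep α n j := by
  unfold toep; positivity

lemma toep_comm (α : ℝ) (n j : ℕ) : toep α n j = toep α j n := by
  unfold toep; rw [abs_sub_comm]

lemma summable_one_add_rpow {r : ℝ} (hr : 1 < r) : Summable fun n : ℕ => ((n : ℝ) + 1) ^ (-r) := by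
  have := (summable_nat_add_iff 1).2 (Real.summable_nat_rpow.2 (show -r < -1 by linarith))
  simpa using this

lemma summable_int_toep {α : ℝ} (hα : 1 < α) : Summable fun k : ℤ => (1 + |(k : ℝ)|) ^ (-α) := by
  have h : Summable fun n : ℕ => (1 + |((n : ℤ) : ℝ)|) ^ (-α) := by
    refine (summable_one_add_rpow hα).congr fun n => ?_
    simp [add_comm]
  refine Summable.of_nat_of_neg h ?_
  simpa using h

lemma summable_toep {α : ℝ} (hα : 1 < α) (n : ℕ) : Summable fun j => toep α n j := by
  have hinj : Function.Injective fun j : ℕ => (n : ℤ) - j := fun a b h => by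
    simpa using h
  refine ((summable_int_toep hα).comp_injective hinj).congr fun j => ?_
  simp [toep]

/-- The row sums of the Toeplitz kernel are bounded. -/
lemma exists_tsum_toep_le {α : ℝ} (hα : 1 < α) :
    ∃ C : ℝ, 0 ≤ C ∧ ∀ n, ∑' j, toep α n j ≤ C := by
  refine ⟨∑' k : ℤ, (1 + |(k : ℝ)|) ^ (-α), tsum_nonneg fun _ => by positivity, fun n => ?_⟩
  have hinj : Function.Injective fun j : ℕ => (n : ℤ) - j := fun a b h => by
    simpa using h
  refine (summable_toep hα n).tsum_le_tsum_of_inj _ hinj (fun _ _ => by positivity)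
    (fun j => ?_) (summable_int_toep hα)
  simp [toep]

/-- When `n` and `j` are far apart, the Toeplitz kernel gains the full power of the larger index. -/
lemma toep_le_of_two_mul_lt {α : ℝ} (hα : 0 < α) {n j : ℕ} (h : 2 * ((j : ℝ) + 1) < n + 1) :
    toep α n j ≤ 2 ^ α * ((n : ℝ) + 1) ^ (-α) := by
  have h1 : ((n : ℝ) + 1) / 2 ≤ 1 + |(n : ℝ) - j| := by
    have := le_abs_self ((n : ℝ) - j); linarith
  calc toep α n j ≤ (((n : ℝ) + 1) / 2) ^ (-α) :=
        Real.rpow_le_rpow_of_nonpos (by positivity) h1 (by linarith)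
    _ = _ := by
      rw [Real.div_rpow (by positivity) (by norm_num), Real.rpow_neg (by norm_num : (0:ℝ) ≤ 2)]
      field_simp

/-- The two regimes of the weighted kernel: for comparable indices the weight is moved from `j` to
`n` at the cost of a constant; otherwise the decay of the kernel leaves a summable power of `j`. -/
lemma toep_weight_le {α e : ℝ} (hα : 1 < α) (he : 1 - α < e) (he' : e < α) :
    ∀ n j : ℕ, toep α n j * ((j : ℝ) + 1) ^ (-e) ≤
      (2 ^ |e| * toep α n j + 2 ^ α * ((j : ℝ) + 1) ^ (-(min α (α + e)))) *
        ((n : ℝ) + 1) ^ (-e) := by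
  intro n j
  have hn : (0 : ℝ) < n + 1 := by positivity
  have hj : (0 : ℝ) < j + 1 := by positivity
  have ht := toep_pos α n j
  have hj1 : (1 : ℝ) ≤ j + 1 := by linarith [(Nat.cast_nonneg j : (0 : ℝ) ≤ j)]
  have hn1 : (1 : ℝ) ≤ n + 1 := by linarith [(Nat.cast_nonneg n : (0 : ℝ) ≤ n)]
  rcases le_or_gt 0 e with h0 | h0
  · rw [min_eq_left (by linarith), abs_of_nonneg h0]
    by_cases hx : 2 * ((j : ℝ) + 1) < n + 1
    · have h1 := toep_le_of_two_mul_lt (by linarith : 0 < α) hx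
      have h2 : ((n : ℝ) + 1) ^ (-α) ≤ ((j : ℝ) + 1) ^ (-α + e) * ((n : ℝ) + 1) ^ (-e) := by
        have : ((n : ℝ) + 1) ^ (-α) = ((n : ℝ) + 1) ^ (-α + e) * ((n : ℝ) + 1) ^ (-e) := by
          rw [← Real.rpow_add hn]; ring_nf
        rw [this]
        gcongr ?_ * _
        exact Real.rpow_le_rpow_of_nonpos hj (by linarith) (by linarith)
      calc toep α n j * ((j : ℝ) + 1) ^ (-e)
          ≤ 2 ^ α * (((j : ℝ) + 1) ^ (-α + e) * ((n : ℝ) + 1) ^ (-e)) * ((j : ℝ) + 1) ^ (-e) := by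
            gcongr; exact h1.trans (by gcongr)
        _ = 2 ^ α * (((j : ℝ) + 1) ^ (-α + e) * ((j : ℝ) + 1) ^ (-e)) * ((n : ℝ) + 1) ^ (-e) := by
            ring
        _ = 2 ^ α * ((j : ℝ) + 1) ^ (-α) * ((n : ℝ) + 1) ^ (-e) := by
            rw [← Real.rpow_add hj]; ring_nf
        _ ≤ _ := by gcongr; exact le_add_of_nonneg_left (by positivity)
    · have h2 : ((j : ℝ) + 1) ^ (-e) ≤ 2 ^ e * ((n : ℝ) + 1) ^ (-e) := by
        calc ((j : ℝ) + 1) ^ (-e) ≤ (((n : ℝ) + 1) / 2) ^ (-e) :=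
              Real.rpow_le_rpow_of_nonpos (by positivity) (by linarith) (by linarith)
          _ = _ := by
            rw [Real.div_rpow (by positivity) (by norm_num),
              Real.rpow_neg (by norm_num : (0:ℝ) ≤ 2)]
            field_simp
      calc toep α n j * ((j : ℝ) + 1) ^ (-e) ≤ toep α n j * (2 ^ e * ((n : ℝ) + 1) ^ (-e)) := by
            gcongr
        _ = (2 ^ e * toep α n j) * ((n : ℝ) + 1) ^ (-e) := by ring
        _ ≤ _ := by gcongr; exact le_add_of_nonneg_right (by positivity)
  · rw [min_eq_right (by linarith), abs_of_neg h0]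
    have hne : (1 : ℝ) ≤ ((n : ℝ) + 1) ^ (-e) := Real.one_le_rpow hn1 (by linarith)
    by_cases hx : 2 * ((n : ℝ) + 1) < j + 1
    · have h1 := toep_le_of_two_mul_lt (by linarith : 0 < α) hx
      rw [toep_comm] at h1
      calc toep α n j * ((j : ℝ) + 1) ^ (-e)
          ≤ 2 ^ α * ((j : ℝ) + 1) ^ (-α) * ((j : ℝ) + 1) ^ (-e) := by gcongr
        _ = 2 ^ α * ((j : ℝ) + 1) ^ (-(α + e)) := by
            rw [mul_assoc, ← Real.rpow_add hj]; ring_nf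
        _ ≤ 2 ^ α * ((j : ℝ) + 1) ^ (-(α + e)) * ((n : ℝ) + 1) ^ (-e) :=
            le_mul_of_one_le_right (by positivity) hne
        _ ≤ _ := by gcongr; exact le_add_of_nonneg_left (by positivity)
    · calc toep α n j * ((j : ℝ) + 1) ^ (-e) ≤ toep α n j * (2 * ((n : ℝ) + 1)) ^ (-e) := by
            gcongr <;> linarith
        _ = (2 ^ (-e) * toep α n j) * ((n : ℝ) + 1) ^ (-e) := by
            rw [Real.mul_rpow (by norm_num) hn.le]; ring
        _ ≤ _ := by gcongr; exact le_add_of_nonneg_right (by positivity)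

/-- The power weights `(n + 1)^(-e)`, `1 - α < e < α`, are test vectors of the Toeplitz kernel. -/
lemma exists_toep_rpow_le {α e : ℝ} (hα : 1 < α) (he : 1 - α < e) (he' : e < α) :
    ∃ C : ℝ, 0 ≤ C ∧ ∀ n : ℕ, ∑' j : ℕ, ENNReal.ofReal (toep α n j) *
      ENNReal.ofReal (((j : ℝ) + 1) ^ (-e)) ≤
        ENNReal.ofReal C * ENNReal.ofReal (((n : ℝ) + 1) ^ (-e)) := by
  obtain ⟨C₀, hC₀, hC⟩ := exists_tsum_toep_le hα
  have hτ : 1 < min α (α + e) := lt_min hα (by linarith)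
  have hs := summable_one_add_rpow hτ
  refine ⟨2 ^ |e| * C₀ + 2 ^ α * ∑' j : ℕ, ((j : ℝ) + 1) ^ (-(min α (α + e))),
    by
      have : 0 ≤ ∑' j : ℕ, ((j : ℝ) + 1) ^ (-(min α (α + e))) :=
        tsum_nonneg fun j => by positivity
      positivity, fun n => ?_⟩
  have hsum : Summable fun j : ℕ =>
      2 ^ |e| * toep α n j + 2 ^ α * ((j : ℝ) + 1) ^ (-(min α (α + e))) :=
    ((summable_toep hα n).mul_left _).add (hs.mul_left _)
  have hnn : ∀ j : ℕ, 0 ≤ 2 ^ |e| * toep α n j + 2 ^ α * ((j : ℝ) + 1) ^ (-(min α (α + e))) :=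
    fun j => by have := toep_pos α n j; positivity
  calc _ ≤ ∑' j : ℕ, ENNReal.ofReal
        (2 ^ |e| * toep α n j + 2 ^ α * ((j : ℝ) + 1) ^ (-(min α (α + e)))) *
          ENNReal.ofReal (((n : ℝ) + 1) ^ (-e)) := by
        refine ENNReal.tsum_le_tsum fun j => ?_
        rw [← ENNReal.ofReal_mul (toep_pos α n j).le, ← ENNReal.ofReal_mul (hnn j)]
        exact ENNReal.ofReal_le_ofReal (toep_weight_le hα he he' n j)
    _ ≤ _ := by
        rw [ENNReal.tsum_mul_right, ← ENNReal.ofReal_tsum_of_nonneg hnn hsum]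
        gcongr
        rw [((summable_toep hα n).mul_left _).tsum_add (hs.mul_left _), tsum_mul_left, tsum_mul_left]
        gcongr
        exact hC n

/-- The Toeplitz kernel on each of the `m` blocks, and `0` off the blocks. -/
noncomputable def blockToep {m : ℕ} (α : ℝ) (p q : Fin m × ℕ) : ℝ :=
  if p.1 = q.1 then toep α p.2 q.2 else 0

variable {m : ℕ}

lemma blockToep_nonneg (α : ℝ) (p q : Fin m × ℕ) : 0 ≤ blockToep α p q := by
  unfold blockToep; split_ifs
  · exact (toep_pos _ _ _).le
  · exact le_rfl

lemma blockToep_comm (α : ℝ) (p q : Fin m × ℕ) : blockToep α p q = blockToep α q p := by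
  unfold blockToep; rw [toep_comm]; simp only [eq_comm]

lemma exists_blockToep_rpow_le {α e : ℝ} (hα : 1 < α) (he : 1 - α < e) (he' : e < α) :
    ∃ C : ℝ, 0 ≤ C ∧ ∀ p : Fin m × ℕ, ∑' q : Fin m × ℕ, ENNReal.ofReal (blockToep α p q) *
      ENNReal.ofReal (((q.2 : ℝ) + 1) ^ (-e)) ≤
        ENNReal.ofReal C * ENNReal.ofReal (((p.2 : ℝ) + 1) ^ (-e)) := by
  obtain ⟨C, hC, h⟩ := exists_toep_rpow_le hα he he'
  refine ⟨C, hC, fun p => ?_⟩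
  rw [ENNReal.tsum_prod', tsum_eq_single p.1]
  · simpa [blockToep] using h p.2
  · intro i hi
    simp [blockToep, hi.symm]

/-- The block Toeplitz kernel is bounded on `ℓ²` with the weight `(n + 1)^(2a)`,
`0 ≤ a < α - 1/2`. -/
lemma exists_blockToep_schur {α a : ℝ} (hα : 1 < α) (ha0 : 0 ≤ a) (ha : a < α - 1 / 2) :
    ∃ C : ℝ, 0 ≤ C ∧ ∀ f : Fin m × ℕ → ℝ≥0∞,
      ∑' p : Fin m × ℕ, ENNReal.ofReal (((p.2 : ℝ) + 1) ^ (2 * a)) *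
        (∑' q, ENNReal.ofReal (blockToep α p q) * f q) ^ 2 ≤
      ENNReal.ofReal C * ∑' q : Fin m × ℕ, ENNReal.ofReal (((q.2 : ℝ) + 1) ^ (2 * a)) * f q ^ 2 := by
  obtain ⟨C, hC, h1⟩ := exists_blockToep_rpow_le (m := m) (e := a + 1 / 2) hα (by linarith)
    (by linarith)
  obtain ⟨D, hD, h2⟩ := exists_blockToep_rpow_le (m := m) (e := 1 / 2 - a) hα (by linarith)
    (by linarith)
  refine ⟨C * D, by positivity, fun f => ?_⟩
  rw [ENNReal.ofReal_mul hC]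
  refine ennreal_schur_test (fun p q => ENNReal.ofReal (blockToep α p q))
    (fun p => ENNReal.ofReal (((p.2 : ℝ) + 1) ^ (-(a + 1 / 2))))
    (fun p => ENNReal.ofReal (((p.2 : ℝ) + 1) ^ (-(1 / 2 - a))))
    (fun p => ENNReal.ofReal (((p.2 : ℝ) + 1) ^ (-(a + 1 / 2)))) _ _ (fun q => ?_) (fun q => by simp)
    _ _ h1 (fun p => ?_) (fun q => ?_) f
  · simp only [ne_eq, ENNReal.ofReal_eq_zero, not_le]; positivity
  · have hp : (0 : ℝ) < p.2 + 1 := by positivity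
    rw [← ENNReal.ofReal_mul (by positivity), ← Real.rpow_add hp]
    ring_nf
  · have hq : (0 : ℝ) < q.2 + 1 := by positivity
    have e1 : ENNReal.ofReal (((q.2 : ℝ) + 1) ^ (2 * a)) *
        ENNReal.ofReal (((q.2 : ℝ) + 1) ^ (-(a + 1 / 2))) =
        ENNReal.ofReal (((q.2 : ℝ) + 1) ^ (-(1 / 2 - a))) := by
      rw [← ENNReal.ofReal_mul (by positivity), ← Real.rpow_add hq]
      ring_nf
    rw [e1]
    refine le_trans (le_of_eq (tsum_congr fun p => ?_)) (h2 q)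
    rw [mul_comm, blockToep_comm]

/-- The real form of the boundedness of the block Toeplitz kernel on weighted `ℓ²`, including the
absolute convergence of its rows. -/
lemma exists_blockToep_summable {α a : ℝ} (hα : 1 < α) (ha0 : 0 ≤ a) (ha : a < α - 1 / 2) :
    ∃ C : ℝ, 0 ≤ C ∧ ∀ c : Fin m × ℕ → ℂ,
      (Summable fun p : Fin m × ℕ => ((p.2 : ℝ) + 1) ^ (2 * a) * ‖c p‖ ^ 2) →
      (∀ p, Summable fun q => blockToep α p q * ‖c q‖) ∧
      (Summable fun p : Fin m × ℕ =>
        ((p.2 : ℝ) + 1) ^ (2 * a) * (∑' q, blockToep α p q * ‖c q‖) ^ 2) ∧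
      ∑' p : Fin m × ℕ, ((p.2 : ℝ) + 1) ^ (2 * a) * (∑' q, blockToep α p q * ‖c q‖) ^ 2 ≤
        C * ∑' p : Fin m × ℕ, ((p.2 : ℝ) + 1) ^ (2 * a) * ‖c p‖ ^ 2 := by
  obtain ⟨C, hC, h⟩ := exists_blockToep_schur (m := m) hα ha0 ha
  refine ⟨C, hC, fun c hc => ?_⟩
  have hR0 : ∀ p : Fin m × ℕ, 0 ≤ ((p.2 : ℝ) + 1) ^ (2 * a) * ‖c p‖ ^ 2 := fun p => by positivity
  have hk : ∀ p q, 0 ≤ blockToep α p q * ‖c q‖ := fun p q =>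
    mul_nonneg (blockToep_nonneg _ _ _) (norm_nonneg _)
  have h1 := h fun q => ENNReal.ofReal ‖c q‖
  have e1 : ∀ q : Fin m × ℕ, ENNReal.ofReal (((q.2 : ℝ) + 1) ^ (2 * a)) *
      ENNReal.ofReal ‖c q‖ ^ 2 = ENNReal.ofReal (((q.2 : ℝ) + 1) ^ (2 * a) * ‖c q‖ ^ 2) :=
    fun q => by
    rw [← ENNReal.ofReal_pow (norm_nonneg _), ← ENNReal.ofReal_mul (by positivity)]
  simp only [e1, ← ENNReal.ofReal_mul (blockToep_nonneg α _ _)] at h1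
  rw [← ENNReal.ofReal_tsum_of_nonneg hR0 hc, ← ENNReal.ofReal_mul hC] at h1
  have hrow : ∀ p, Summable fun q => blockToep α p q * ‖c q‖ := fun p => by
    have h2 := ENNReal.ne_top_of_tsum_ne_top (ne_top_of_le_ne_top ENNReal.ofReal_ne_top h1) p
    have h3 : ∑' q, ENNReal.ofReal (blockToep α p q * ‖c q‖) ≠ ⊤ := fun h4 => by
      rw [h4] at h2
      refine h2 (ENNReal.mul_eq_top.2 (Or.inl ⟨?_, by simp⟩))
      simp only [ne_eq, ENNReal.ofReal_eq_zero, not_le]; positivity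
    refine (ENNReal.summable_toReal h3).congr fun q => ENNReal.toReal_ofReal (hk p q)
  have hL0 : ∀ p : Fin m × ℕ,
      0 ≤ ((p.2 : ℝ) + 1) ^ (2 * a) * (∑' q, blockToep α p q * ‖c q‖) ^ 2 := fun p => by positivity
  have e2 : ∀ p : Fin m × ℕ, ENNReal.ofReal (((p.2 : ℝ) + 1) ^ (2 * a)) *
      (∑' q, ENNReal.ofReal (blockToep α p q * ‖c q‖)) ^ 2 =
      ENNReal.ofReal (((p.2 : ℝ) + 1) ^ (2 * a) * (∑' q, blockToep α p q * ‖c q‖) ^ 2) := fun p => by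
    rw [← ENNReal.ofReal_tsum_of_nonneg (hk p) (hrow p),
      ← ENNReal.ofReal_pow (tsum_nonneg (hk p)), ← ENNReal.ofReal_mul (by positivity)]
  simp only [e2] at h1
  have hL : Summable fun p : Fin m × ℕ =>
      ((p.2 : ℝ) + 1) ^ (2 * a) * (∑' q, blockToep α p q * ‖c q‖) ^ 2 :=
    (ENNReal.summable_toReal (ne_top_of_le_ne_top ENNReal.ofReal_ne_top h1)).congr
      fun p => ENNReal.toReal_ofReal (hL0 p)
  refine ⟨hrow, hL, ?_⟩
  rw [← ENNReal.ofReal_tsum_of_nonneg hL0 hL] at h1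
  exact (ENNReal.ofReal_le_ofReal_iff (mul_nonneg hC (tsum_nonneg hR0))).1 h1

end Toeplitz

/-! ### Finite Cauchy matrices -/

section FiniteCauchy
open Polynomial

/-- The finite product `∏_{p ∈ s, p ≠ i} (1 + lam / (μ i - μ p))`. -/
noncomputable def cauchyProd (μ : ℕ → ℂ) (lam : ℂ) (s : Finset ℕ) (i : ℕ) : ℂ :=
  ∏ p ∈ s.erase i, (1 + lam / (μ i - μ p))

/-- Partial fractions: a polynomial of degree less than the number of nodes, divided by the nodal
polynomial. -/
lemma lagrange_partial_fractions {μ : ℕ → ℂ} (hμ : Function.Injective μ) {s : Finset ℕ}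
    {f : ℂ[X]} (hf : f.degree < s.card) {x : ℂ} (hx : ∀ i ∈ s, x ≠ μ i) :
    f.eval x = (∏ i ∈ s, (x - μ i)) *
      ∑ j ∈ s, (∏ q ∈ s.erase j, (μ j - μ q)⁻¹) * (x - μ j)⁻¹ * f.eval (μ j) := by
  conv_lhs => rw [Lagrange.eq_interpolate (hμ.injOn (s := (s : Set ℕ))) hf]
  rw [Lagrange.eval_interpolate_not_at_node _ hx, Lagrange.eval_nodal]
  rfl

/-- The weights of the nodes, expressed by the products of the inverse Cauchy matrix. -/
lemma prod_inv_mul_prod_eq {μ : ℕ → ℂ} (hμ : Function.Injective μ) (lam : ℂ) {s : Finset ℕ}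
    (j : ℕ) :
    (∏ q ∈ s.erase j, (μ j - μ q)⁻¹) * ∏ q ∈ s.erase j, (μ j - (μ q + lam)) =
      cauchyProd μ (-lam) s j := by
  rw [cauchyProd, ← Finset.prod_mul_distrib]
  refine Finset.prod_congr rfl fun q hq => ?_
  have : μ j - μ q ≠ 0 := sub_ne_zero.2 fun h => (Finset.ne_of_mem_erase hq) (hμ h).symm
  field_simp
  ring

variable {μ : ℕ → ℂ} {lam : ℂ}

lemma ne_zero_of_nonresonant (hr : ∀ p q, μ p + lam ≠ μ q) : lam ≠ 0 := fun h => by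
  simpa [h] using hr 0 0

/-- The partial fraction expansion of `∏ (x - μ q - lam) - ∏ (x - μ q)`, evaluated at
`x = μ n + lam`. -/
lemma sum_cauchyProd_mul_inv (hμ : Function.Injective μ) (hr : ∀ p q, μ p + lam ≠ μ q)
    {s : Finset ℕ} {n : ℕ} (hn : n ∈ s) :
    ∑ j ∈ s, lam * cauchyProd μ (-lam) s j * (μ n + lam - μ j)⁻¹ = 1 := by
  set f : ℂ[X] := Lagrange.nodal s (fun q => μ q + lam) - Lagrange.nodal s μ with hf
  have hdeg : f.degree < s.card := by
    have h := degree_sub_lt_left (p := Lagrange.nodal s (fun q => μ q + lam))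
      (q := Lagrange.nodal s μ)
      (by rw [Lagrange.degree_nodal, Lagrange.degree_nodal]) (Lagrange.nodal_ne_zero)
      (by rw [Lagrange.nodal_monic.leadingCoeff, Lagrange.nodal_monic.leadingCoeff])
    rwa [Lagrange.degree_nodal] at h
  have hx : ∀ i ∈ s, μ n + lam ≠ μ i := fun i _ => hr n i
  have h := lagrange_partial_fractions hμ hdeg hx
  have hprod : ∏ i ∈ s, (μ n + lam - μ i) ≠ 0 :=
    Finset.prod_ne_zero_iff.2 fun i hi => sub_ne_zero.2 (hx i hi)
  have e1 : f.eval (μ n + lam) = -∏ i ∈ s, (μ n + lam - μ i) := by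
    rw [hf, eval_sub, Lagrange.eval_nodal, Lagrange.eval_nodal, Finset.prod_eq_zero hn (sub_self _),
      zero_sub]
  have e2 : ∀ j ∈ s, (∏ q ∈ s.erase j, (μ j - μ q)⁻¹) * (μ n + lam - μ j)⁻¹ * f.eval (μ j) =
      -(lam * cauchyProd μ (-lam) s j * (μ n + lam - μ j)⁻¹) := fun j hj => by
    rw [hf, eval_sub, Lagrange.eval_nodal_at_node hj, Lagrange.eval_nodal, sub_zero,
      ← Finset.mul_prod_erase s _ hj, ← prod_inv_mul_prod_eq hμ]
    ring
  rw [e1, Finset.sum_congr rfl e2, Finset.sum_neg_distrib, mul_neg, neg_inj] at h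
  exact (mul_left_cancel₀ hprod ((mul_one _).trans h)).symm

/-- The finite Cauchy matrix times its inverse: the partial fraction expansion of
`∏_{q ≠ k} (x - μ q - lam)`, evaluated at `x = μ n + lam`. -/
lemma sum_cauchyProd_mul_inv_mul_inv (hμ : Function.Injective μ) (hr : ∀ p q, μ p + lam ≠ μ q)
    {s : Finset ℕ} {n k : ℕ} (hn : n ∈ s) (hk : k ∈ s) :
    ∑ j ∈ s, lam ^ 2 * cauchyProd μ lam s k * cauchyProd μ (-lam) s j *
      ((μ n + lam - μ j)⁻¹ * (μ k + lam - μ j)⁻¹) = if n = k then 1 else 0 := by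
  set f : ℂ[X] := Lagrange.nodal (s.erase k) (fun q => μ q + lam) with hf
  have hlam := ne_zero_of_nonresonant hr
  have hdeg : f.degree < s.card := by
    rw [hf, Lagrange.degree_nodal]
    exact_mod_cast Finset.card_erase_lt_of_mem hk
  have hx : ∀ i ∈ s, μ n + lam ≠ μ i := fun i _ => hr n i
  have h := lagrange_partial_fractions hμ hdeg hx
  have hprod : ∏ i ∈ s, (μ n + lam - μ i) ≠ 0 :=
    Finset.prod_ne_zero_iff.2 fun i hi => sub_ne_zero.2 (hx i hi)
  have e2 : ∀ j ∈ s, (∏ q ∈ s.erase j, (μ j - μ q)⁻¹) * (μ n + lam - μ j)⁻¹ * f.eval (μ j) =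
      lam * cauchyProd μ (-lam) s j * ((μ n + lam - μ j)⁻¹ * (μ k + lam - μ j)⁻¹) := fun j hj => by
    have h1 : μ k + lam - μ j ≠ 0 := sub_ne_zero.2 (hr k j)
    have h2 : f.eval (μ j) = lam * (∏ q ∈ s.erase j, (μ j - (μ q + lam))) *
        (μ k + lam - μ j)⁻¹ := by
      rw [hf, Lagrange.eval_nodal, eq_mul_inv_iff_mul_eq₀ h1]
      have h3 := Finset.mul_prod_erase s (fun q => μ j - (μ q + lam)) hk
      have h4 := Finset.mul_prod_erase s (fun q => μ j - (μ q + lam)) hj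
      linear_combination -h3 + h4
    rw [h2, ← prod_inv_mul_prod_eq hμ]
    ring
  rw [Finset.sum_congr rfl e2] at h
  have e3 : ∑ j ∈ s, lam ^ 2 * cauchyProd μ lam s k * cauchyProd μ (-lam) s j *
      ((μ n + lam - μ j)⁻¹ * (μ k + lam - μ j)⁻¹) = lam * cauchyProd μ lam s k *
      ∑ j ∈ s, lam * cauchyProd μ (-lam) s j * ((μ n + lam - μ j)⁻¹ * (μ k + lam - μ j)⁻¹) := by
    rw [Finset.mul_sum]; exact Finset.sum_congr rfl fun j _ => by ring
  rw [e3]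
  refine mul_left_cancel₀ hprod ?_
  rw [mul_left_comm, ← h]
  split_ifs with hnk
  · subst hnk
    rw [hf, Lagrange.eval_nodal, ← Finset.mul_prod_erase s _ hn, mul_one, add_sub_cancel_left,
      mul_assoc, cauchyProd, ← Finset.prod_mul_distrib]
    congr 1
    refine Finset.prod_congr rfl fun q hq => ?_
    have : μ n - μ q ≠ 0 := sub_ne_zero.2 fun h => (Finset.ne_of_mem_erase hq) (hμ h).symm
    field_simp
    ring
  · rw [hf, Lagrange.eval_nodal_at_node (v := fun q => μ q + lam) (Finset.mem_erase.2 ⟨hnk, hn⟩)]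
    simp

end FiniteCauchy

/-! ### Infinite Cauchy matrices -/

section InfiniteCauchy

/-- The bound `log (1 + x) ≤ x^β / β`; choosing `β < 1` trades summability in the index for growth in
the shift. -/
lemma one_add_le_exp_rpow {x β : ℝ} (hx : 0 ≤ x) (hβ : 0 < β) (hβ1 : β ≤ 1) :
    1 + x ≤ Real.exp (x ^ β / β) := by
  have h1 : (1 + x) ^ β ≤ 1 + x ^ β := by
    have := Real.rpow_add_le_add_rpow (p := β) zero_le_one hx hβ.le hβ1
    rwa [Real.one_rpow] at this
  have h2 : (1 + x) ^ β ≤ Real.exp (x ^ β) :=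
    h1.trans (by rw [add_comm]; exact Real.add_one_le_exp _)
  calc 1 + x = ((1 + x) ^ β) ^ (1 / β) := by
        rw [← Real.rpow_mul (by positivity), mul_one_div_cancel hβ.ne', Real.rpow_one]
    _ ≤ Real.exp (x ^ β) ^ (1 / β) := by gcongr
    _ = _ := by rw [← Real.exp_mul]; ring_nf

lemma one_add_rpow_le {x r : ℝ} (hx : 0 ≤ x) (hr : 0 ≤ r) : (1 + x) ^ r ≤ 2 ^ r * (1 + x ^ r) := by
  have h0 : 0 ≤ x ^ r := by positivity
  rcases le_total x 1 with h | h
  · calc (1 + x) ^ r ≤ 2 ^ r := by gcongr; linarith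
      _ ≤ _ := le_mul_of_one_le_right (by positivity) (by linarith)
  · calc (1 + x) ^ r ≤ (2 * x) ^ r := by gcongr; linarith
      _ = 2 ^ r * x ^ r := Real.mul_rpow (by norm_num) hx
      _ ≤ _ := by gcongr; linarith

/-- The power-type separation `c |n - j|^α ≤ |μ n - μ j|` of the eigenvalues of one block. -/
def Separated (μ : ℕ → ℂ) (c α : ℝ) : Prop :=
  ∀ n j : ℕ, c * |(n : ℝ) - j| ^ α ≤ ‖μ n - μ j‖

variable {μ : ℕ → ℂ} {c α : ℝ}

lemma Separated.ne (h : Separated μ c α) (hc : 0 < c) {n j : ℕ} (hnj : n ≠ j) :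
    μ n - μ j ≠ 0 := by
  have h1 : (0 : ℝ) < |(n : ℝ) - j| := abs_pos.2 (sub_ne_zero.2 (by exact_mod_cast hnj))
  have h2 : 0 < c * |(n : ℝ) - j| ^ α := by positivity
  exact norm_pos_iff.1 (h2.trans_le (h n j))

lemma Separated.injective (h : Separated μ c α) (hc : 0 < c) : Function.Injective μ :=
  fun a b hab => by
    by_contra hne
    exact h.ne hc hne (sub_eq_zero.2 hab)

lemma one_le_abs_sub {n j : ℕ} (hnj : n ≠ j) : (1 : ℝ) ≤ |(n : ℝ) - j| := by
  have h : (1 : ℤ) ≤ |(n : ℤ) - j| := Int.one_le_abs (sub_ne_zero.2 (by exact_mod_cast hnj))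
  exact_mod_cast h

lemma Separated.norm_inv_sub_le (h : Separated μ c α) (hc : 0 < c) (hα : 0 < α) {n j : ℕ}
    (hnj : n ≠ j) : ‖(μ n - μ j)⁻¹‖ ≤ 2 ^ α / c * toep α n j := by
  have h0 := one_le_abs_sub hnj
  have h1 : (1 + |(n : ℝ) - j|) ^ α ≤ 2 ^ α * |(n : ℝ) - j| ^ α := by
    rw [← Real.mul_rpow (by norm_num) (by positivity)]
    gcongr; linarith
  have h2 : 0 < c * |(n : ℝ) - j| ^ α := by positivity
  rw [norm_inv, toep, Real.rpow_neg (by positivity)]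
  calc ‖μ n - μ j‖⁻¹ ≤ (c * |(n : ℝ) - j| ^ α)⁻¹ := inv_anti₀ h2 (h n j)
    _ = 2 ^ α / c * (2 ^ α * |(n : ℝ) - j| ^ α)⁻¹ := by field_simp
    _ ≤ _ := by gcongr

/-- The resolvent kernel is dominated by the Toeplitz kernel, with a constant that is polynomial in
`|lam|` and in the inverse of the distance `d` from `lam` to the resonant set. -/
lemma Separated.norm_resolvent_le (h : Separated μ c α) (hc : 0 < c) (hα : 0 < α) {lam : ℂ} {d : ℝ}
    (hd : 0 < d) (hr : ∀ p q, d ≤ ‖μ p - μ q - lam‖) (p q : ℕ) :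
    ‖(μ q - lam - μ p)⁻¹‖ ≤ 2 ^ α * (1 + 1 / c) * (1 + (1 + ‖lam‖) / d) * toep α p q := by
  set D := μ q - μ p with hD
  have h1 : (1 + |(p : ℝ) - q|) ^ α ≤ 2 ^ α * ((1 + 1 / c) * (1 + ‖D‖)) := by
    refine (one_add_rpow_le (abs_nonneg _) hα.le).trans ?_
    gcongr
    have h3 := h q p
    rw [abs_sub_comm] at h3
    have h4 : |(p : ℝ) - q| ^ α ≤ 1 / c * ‖D‖ := by
      rw [one_div, ← div_eq_inv_mul, le_div_iff₀ hc]; linarith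
    have h5 : 0 < 1 / c := by positivity
    nlinarith [norm_nonneg D]
  have h2 : d ≤ ‖D - lam‖ := hr q p
  have h3 : 1 + ‖D‖ ≤ (1 + (1 + ‖lam‖) / d) * ‖D - lam‖ := by
    have h4 : ‖D‖ ≤ ‖D - lam‖ + ‖lam‖ := by simpa using norm_add_le (D - lam) lam
    have h5 : 1 + ‖lam‖ ≤ (1 + ‖lam‖) / d * ‖D - lam‖ := by
      rw [div_mul_eq_mul_div, le_div_iff₀ hd]; gcongr
    linarith
  have h6 : 0 < ‖D - lam‖ := hd.trans_le h2
  rw [show μ q - lam - μ p = D - lam by rw [hD]; ring, norm_inv, toep,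
    Real.rpow_neg (by positivity), ← div_eq_mul_inv, le_div_iff₀ (by positivity), inv_mul_eq_div,
    div_le_iff₀ h6]
  calc _ ≤ 2 ^ α * ((1 + 1 / c) * (1 + ‖D‖)) := h1
    _ ≤ 2 ^ α * ((1 + 1 / c) * ((1 + (1 + ‖lam‖) / d) * ‖D - lam‖)) := by gcongr
    _ = _ := by ring

lemma toep_rpow (α β : ℝ) (n j : ℕ) : toep α n j ^ β = toep (α * β) n j := by
  unfold toep; rw [← Real.rpow_mul (by positivity), neg_mul]

/-- The finite products `∏ (1 + lam / (μ i - μ p))` grow at most like `exp (K |lam|^β)`, for each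
`β > 1/α`. -/
lemma exists_norm_cauchyProd_le {c α β : ℝ} (hc : 0 < c) (hα : 1 < α) (hβ : 1 / α < β)
    (hβ1 : β ≤ 1) : ∃ K : ℝ, 0 ≤ K ∧ ∀ μ : ℕ → ℂ, Separated μ c α → ∀ (lam : ℂ) (s : Finset ℕ)
      (i : ℕ), ‖cauchyProd μ lam s i‖ ≤ Real.exp (K * ‖lam‖ ^ β) := by
  have hα0 : 0 < α := by linarith
  have hβ0 : 0 < β := lt_trans (by positivity) hβ
  have hαβ : 1 < α * β := by rwa [div_lt_iff₀' hα0] at hβ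
  obtain ⟨C, hC, hCs⟩ := exists_tsum_toep_le hαβ
  refine ⟨(2 ^ α / c) ^ β / β * C, by positivity, fun μ h lam s i => ?_⟩
  have h1 : ∀ p ∈ s.erase i, ‖1 + lam / (μ i - μ p)‖ ≤
      Real.exp ((2 ^ α / c) ^ β / β * ‖lam‖ ^ β * toep (α * β) i p) := fun p hp => by
    have h2 := h.norm_inv_sub_le hc hα0 (Finset.ne_of_mem_erase hp).symm
    have ht := toep_pos α i p
    calc ‖1 + lam / (μ i - μ p)‖ ≤ 1 + ‖lam‖ * (2 ^ α / c * toep α i p) := by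
          refine (norm_add_le _ _).trans ?_
          rw [norm_one, div_eq_mul_inv, norm_mul]
          gcongr
      _ ≤ Real.exp ((‖lam‖ * (2 ^ α / c * toep α i p)) ^ β / β) :=
          one_add_le_exp_rpow (by positivity) hβ0 hβ1
      _ = _ := by
          rw [Real.mul_rpow (by positivity) (by positivity),
            Real.mul_rpow (by positivity) (by positivity), toep_rpow]
          ring_nf
  calc ‖cauchyProd μ lam s i‖ ≤ ∏ p ∈ s.erase i,
        Real.exp ((2 ^ α / c) ^ β / β * ‖lam‖ ^ β * toep (α * β) i p) := by
        rw [cauchyProd, norm_prod]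
        exact Finset.prod_le_prod (fun _ _ => norm_nonneg _) h1
    _ = Real.exp ((2 ^ α / c) ^ β / β * ‖lam‖ ^ β * ∑ p ∈ s.erase i, toep (α * β) i p) := by
        rw [← Real.exp_sum, Finset.mul_sum]
    _ ≤ Real.exp ((2 ^ α / c) ^ β / β * ‖lam‖ ^ β * C) := by
        gcongr
        exact ((summable_toep hαβ i).sum_le_tsum _ fun p _ => (toep_pos _ _ _).le).trans (hCs i)
    _ = _ := by ring_nf

/-- The infinite product `∏_{p ≠ i} (1 + lam / (μ i - μ p))`. -/
noncomputable def cauchyTProd (μ : ℕ → ℂ) (lam : ℂ) (i : ℕ) : ℂ :=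
  ∏' p : {p : ℕ // p ≠ i}, (1 + lam / (μ i - μ p))

lemma tendsto_cauchyProd (h : Separated μ c α) (hc : 0 < c) (hα : 1 < α) (lam : ℂ) (i : ℕ) :
    Tendsto (fun N => cauchyProd μ lam (Finset.range N) i) atTop (𝓝 (cauchyTProd μ lam i)) := by
  have hα0 : 0 < α := by linarith
  set f : ℕ → ℂ := fun p => if p = i then 0 else lam / (μ i - μ p) with hf
  have hsum : Summable f := by
    refine Summable.of_norm_bounded (g := fun p => ‖lam‖ * (2 ^ α / c * toep α i p))
      (((summable_toep hα i).mul_left _).mul_left _) fun p => ?_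
    rw [hf]
    dsimp only
    split_ifs with hp
    · have := toep_pos α i p
      rw [norm_zero]; positivity
    · rw [div_eq_mul_inv, norm_mul]
      gcongr
      exact h.norm_inv_sub_le hc hα0 (Ne.symm hp)
  have hm := Complex.multipliable_one_add_of_summable hsum
  have e1 : cauchyTProd μ lam i = ∏' p, (1 + f p) := by
    have := tprod_subtype {p : ℕ | p ≠ i} fun p => 1 + lam / (μ i - μ p)
    refine this.trans (tprod_congr fun p => ?_)
    by_cases hp : p = i <;> simp [hf, hp, Set.mulIndicator]
  rw [e1]
  refine hm.tendsto_prod_tprod_nat.congr fun N => ?_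
  rw [cauchyProd]
  by_cases hi : i ∈ Finset.range N
  · rw [← Finset.mul_prod_erase _ _ hi]
    simp only [hf, if_true, add_zero, one_mul]
    exact Finset.prod_congr rfl fun p hp => by rw [if_neg (Finset.ne_of_mem_erase hp)]
  · rw [Finset.erase_eq_of_notMem hi]
    exact Finset.prod_congr rfl fun p hp => by
      rw [hf]; dsimp only; rw [if_neg fun hpi : p = i => hi (hpi ▸ hp)]

lemma norm_cauchyTProd_le (h : Separated μ c α) (hc : 0 < c) (hα : 1 < α) {lam : ℂ} {i : ℕ} {E : ℝ}
    (hE : ∀ s, ‖cauchyProd μ lam s i‖ ≤ E) : ‖cauchyTProd μ lam i‖ ≤ E :=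
  le_of_tendsto (tendsto_cauchyProd h hc hα lam i).norm (Eventually.of_forall fun _ => hE _)

lemma exists_norm_cauchyProd_le' (h : Separated μ c α) (hc : 0 < c) (hα : 1 < α) (lam : ℂ) :
    ∃ E : ℝ, 0 ≤ E ∧ ∀ s i, ‖cauchyProd μ lam s i‖ ≤ E := by
  obtain ⟨K, hK, hK'⟩ := exists_norm_cauchyProd_le (β := 1) hc hα
    (by rw [div_lt_one (by linarith)]; exact hα) le_rfl
  exact ⟨_, (Real.exp_pos _).le, fun s i => hK' μ h lam s i⟩

/-- Passage to the limit in a partial fraction sum over `range N`. -/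
lemma tendsto_sum_range_of_dominated {F : ℕ → ℕ → ℂ} {g : ℕ → ℂ} {bound : ℕ → ℝ}
    (hb : Summable bound) (hlim : ∀ j, Tendsto (fun N => F N j) atTop (𝓝 (g j)))
    (hbd : ∀ N j, ‖F N j‖ ≤ bound j) :
    Summable g ∧ Tendsto (fun N => ∑ j ∈ Finset.range N, F N j) atTop (𝓝 (∑' j, g j)) := by
  refine ⟨Summable.of_norm_bounded hb fun j =>
    le_of_tendsto (hlim j).norm (Eventually.of_forall fun N => hbd N j), ?_⟩
  have h := tendsto_tsum_of_dominated_convergence (𝓕 := atTop)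
    (f := fun N j => if j ∈ Finset.range N then F N j else 0) (g := g) hb
    (fun j => (hlim j).congr' (by
      filter_upwards [eventually_gt_atTop j] with N hN
      rw [if_pos (Finset.mem_range.2 hN)]))
    (Eventually.of_forall fun N j => by
      split_ifs
      · exact hbd N j
      · rw [norm_zero]; exact (norm_nonneg _).trans (hbd N j))
  refine h.congr fun N => ?_
  rw [tsum_eq_sum (s := Finset.range N) fun j hj => if_neg hj]
  exact Finset.sum_congr rfl fun j hj => if_pos hj

variable {lam : ℂ} {d : ℝ}

lemma Separated.norm_inv_add_sub_le (h : Separated μ c α) (hc : 0 < c) (hα : 0 < α)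
    (hd : 0 < d) (hr : ∀ p q, d ≤ ‖μ p - μ q - lam‖) (n j : ℕ) : ‖(μ n + lam - μ j)⁻¹‖ ≤
      2 ^ α * (1 + 1 / c) * (1 + (1 + ‖lam‖) / d) * toep α n j := by
  have h1 := h.norm_resolvent_le hc hα hd hr n j
  rwa [norm_inv, norm_sub_rev, show μ n - (μ j - lam) = μ n + lam - μ j by ring, ← norm_inv] at h1

lemma nonresonant_of_le (hd : 0 < d) (hr : ∀ p q, d ≤ ‖μ p - μ q - lam‖) (p q : ℕ) :
    μ p + lam ≠ μ q := fun h => by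
  have := hr q p
  rw [← h] at this
  simp only [add_sub_cancel_left, sub_self, norm_zero] at this
  linarith

/-- The partial fraction expansion of `∏ (1 - lam / (z - μ q))`, evaluated at its zero
`z = μ n + lam`. -/
lemma hasSum_cauchyTProd_mul_inv (h : Separated μ c α) (hc : 0 < c) (hα : 1 < α)
    (hd : 0 < d) (hr : ∀ p q, d ≤ ‖μ p - μ q - lam‖) (n : ℕ) :
    HasSum (fun j => lam * cauchyTProd μ (-lam) j * (μ n + lam - μ j)⁻¹) 1 := by
  obtain ⟨E, hE, hEb⟩ := exists_norm_cauchyProd_le' h hc hα (-lam)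
  set Q := 2 ^ α * (1 + 1 / c) * (1 + (1 + ‖lam‖) / d) with hQ
  obtain ⟨h1, h2⟩ := tendsto_sum_range_of_dominated
    (F := fun N j => lam * cauchyProd μ (-lam) (Finset.range N) j * (μ n + lam - μ j)⁻¹)
    (g := fun j => lam * cauchyTProd μ (-lam) j * (μ n + lam - μ j)⁻¹)
    (bound := fun j => ‖lam‖ * E * (Q * toep α n j))
    (((summable_toep hα n).mul_left _).mul_left _)
    (fun j => ((tendsto_cauchyProd h hc hα (-lam) j).const_mul _).mul_const _)
    (fun N j => by
      rw [norm_mul, norm_mul]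
      gcongr
      · exact hEb _ _
      · exact h.norm_inv_add_sub_le hc (by linarith) hd hr n j)
  have h3 : ∑' j, lam * cauchyTProd μ (-lam) j * (μ n + lam - μ j)⁻¹ = 1 := by
    refine tendsto_nhds_unique h2 (tendsto_const_nhds.congr' ?_)
    filter_upwards [eventually_gt_atTop n] with N hN
    exact (sum_cauchyProd_mul_inv (h.injective hc) (nonresonant_of_le hd hr)
      (Finset.mem_range.2 hN)).symm
  exact h3 ▸ h1.hasSum

/-- The infinite Cauchy matrix and its explicit inverse multiply to the identity. -/
lemma hasSum_cauchyTProd_mul_inv_mul_inv (h : Separated μ c α) (hc : 0 < c) (hα : 1 < α)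
    (hd : 0 < d) (hr : ∀ p q, d ≤ ‖μ p - μ q - lam‖) (n k : ℕ) :
    HasSum (fun j => lam ^ 2 * cauchyTProd μ lam k * cauchyTProd μ (-lam) j *
      ((μ n + lam - μ j)⁻¹ * (μ k + lam - μ j)⁻¹)) (if n = k then 1 else 0) := by
  obtain ⟨E, hE, hEb⟩ := exists_norm_cauchyProd_le' h hc hα (-lam)
  obtain ⟨E', hE', hEb'⟩ := exists_norm_cauchyProd_le' h hc hα lam
  set Q := 2 ^ α * (1 + 1 / c) * (1 + (1 + ‖lam‖) / d) with hQ
  have hres : ∀ k j, ‖(μ k + lam - μ j)⁻¹‖ ≤ d⁻¹ := fun k j => by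
    rw [norm_inv]
    refine inv_anti₀ hd ?_
    have := hr j k
    rwa [norm_sub_rev, show lam - (μ j - μ k) = μ k + lam - μ j by ring] at this
  obtain ⟨h1, h2⟩ := tendsto_sum_range_of_dominated
    (F := fun N j => lam ^ 2 * cauchyProd μ lam (Finset.range N) k *
      cauchyProd μ (-lam) (Finset.range N) j * ((μ n + lam - μ j)⁻¹ * (μ k + lam - μ j)⁻¹))
    (g := fun j => lam ^ 2 * cauchyTProd μ lam k * cauchyTProd μ (-lam) j *
      ((μ n + lam - μ j)⁻¹ * (μ k + lam - μ j)⁻¹))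
    (bound := fun j => ‖lam‖ ^ 2 * E' * E * (Q * toep α n j * d⁻¹))
    ((((summable_toep hα n).mul_left _).mul_right _).mul_left _)
    (fun j => (((tendsto_cauchyProd h hc hα lam k).const_mul _).mul
      (tendsto_cauchyProd h hc hα (-lam) j)).mul_const _)
    (fun N j => by
      rw [norm_mul, norm_mul, norm_mul, norm_pow, norm_mul]
      gcongr
      · exact hEb' _ _
      · exact hEb _ _
      · have := toep_pos α n j; positivity
      · exact h.norm_inv_add_sub_le hc (by linarith) hd hr n j
      · exact hres k j)
  have h3 : ∑' j, lam ^ 2 * cauchyTProd μ lam k * cauchyTProd μ (-lam) j *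
      ((μ n + lam - μ j)⁻¹ * (μ k + lam - μ j)⁻¹) = if n = k then 1 else 0 := by
    refine tendsto_nhds_unique h2 (tendsto_const_nhds.congr' ?_)
    filter_upwards [eventually_gt_atTop n, eventually_gt_atTop k] with N hN hN'
    exact (sum_cauchyProd_mul_inv_mul_inv (h.injective hc) (nonresonant_of_le hd hr)
      (Finset.mem_range.2 hN) (Finset.mem_range.2 hN')).symm
  exact h3 ▸ h1.hasSum

/-- The feedback coefficients in product form: `k_n b_n = -lam ∏_{p ≠ n} (1 + lam / (μ n - μ p))`. -/
lemma gain_eq (h : Separated μ c α) (hc : 0 < c) (hα : 1 < α) {lam : ℝ}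
    (hd : 0 < d) (hr : ∀ p q, d ≤ ‖μ p - μ q - lam‖) (b : ℕ → ℂ) (n : ℕ) :
    gain μ b lam n = (b n)⁻¹ * (-lam * cauchyTProd μ lam n) := by
  rw [gain]
  congr 1
  have h1 := (hasSum_cauchyTProd_mul_inv h hc hα hd hr n).mul_left (-lam * cauchyTProd μ lam n)
  rw [mul_one] at h1
  rw [← h1.tsum_eq]
  refine tsum_congr fun j => ?_
  have e1 : ∏' q : {q : ℕ // q ≠ j}, (1 - (lam : ℂ) / (μ j - μ q)) = cauchyTProd μ (-lam) j := by
    simp only [cauchyTProd, neg_div, sub_eq_add_neg]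
  have e2 : (lam : ℂ) ^ 2 / (μ j - μ n - lam) = -(lam ^ 2 * (μ n + lam - μ j)⁻¹) := by
    rw [show μ j - μ n - lam = -(μ n + lam - μ j) by ring, div_neg, div_eq_mul_inv]
  rw [invCauchy, e1, e2, ← cauchyTProd]
  ring

/-- The characteristic equation of the closed loop: `μ j - lam` is an eigenvalue. -/
lemma hasSum_cauchyTProd_characteristic (h : Separated μ c α) (hc : 0 < c) (hα : 1 < α)
    (hd : 0 < d) (hr : ∀ p q, d ≤ ‖μ p - μ q - lam‖) (j : ℕ) :
    HasSum (fun n => -lam * cauchyTProd μ lam n * (μ j - lam - μ n)⁻¹) 1 := by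
  have h1 := hasSum_cauchyTProd_mul_inv (lam := -lam) h hc hα hd (fun p q => by
    have := hr q p
    rwa [norm_sub_rev, show lam - _ = -(μ q - μ p) + lam by ring, neg_sub, ← sub_neg_eq_add]
      at this) j
  simpa only [neg_neg, ← sub_eq_add_neg] using h1

end InfiniteCauchy

/-! ### Matrices with respect to a Hilbert basis -/

section Hilbert

variable {H : Type*} [NormedAddCommGroup H] [InnerProductSpace ℂ H]

lemma hasSum_norm_inner_sq {ι : Type*} (φ : HilbertBasis ι ℂ H) (f : H) :
    HasSum (fun p => ‖⟪φ p, f⟫_ℂ‖ ^ 2) (‖f‖ ^ 2) := by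
  have h := (φ.hasSum_inner_mul_inner f f).mapL Complex.reCLM
  simp only [Complex.reCLM_apply] at h
  convert h using 1
  · ext p
    rw [← inner_conj_symm f (φ p), ← Complex.normSq_eq_conj_mul_self, Complex.ofReal_re,
      Complex.normSq_eq_norm_sq]
  · rw [inner_self_eq_norm_sq_to_K]; norm_cast

lemma exists_inner_eq_of_summable {ι : Type*} (φ : HilbertBasis ι ℂ H) {c : ι → ℂ}
    (hc : Summable fun p => ‖c p‖ ^ 2) : ∃ f : H, ∀ p, ⟪φ p, f⟫_ℂ = c p := by
  have hm : Memℓp c 2 := memℓp_gen (by simpa using hc)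
  refine ⟨φ.repr.symm ⟨c, hm⟩, fun p => ?_⟩
  rw [← φ.repr_apply_apply, LinearIsometryEquiv.apply_symm_apply]

lemma eq_of_inner_eq {ι : Type*} (φ : HilbertBasis ι ℂ H) {f g : H}
    (h : ∀ p, ⟪φ p, f⟫_ℂ = ⟪φ p, g⟫_ℂ) : f = g := by
  apply φ.repr.injective
  ext p
  rw [φ.repr_apply_apply, φ.repr_apply_apply, h]

variable {m : ℕ} (φ : HilbertBasis (Fin m × ℕ) ℂ H)

/-- A matrix that is dominated by the block Toeplitz kernel is a bounded operator. -/
lemma exists_clm_of_kernel {α : ℝ} (hα : 1 < α) {K : Fin m × ℕ → Fin m × ℕ → ℂ} {Q : ℝ}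
    (hK : ∀ p q, ‖K p q‖ ≤ Q * blockToep α p q) :
    ∃ T : H →L[ℂ] H, ∀ f p, HasSum (fun q => K p q * ⟪φ q, f⟫_ℂ) ⟪φ p, T f⟫_ℂ := by
  obtain ⟨C, hC, h⟩ := exists_blockToep_summable (m := m) (a := 0) hα le_rfl (by linarith)
  simp only [mul_zero, Real.rpow_zero, one_mul] at h
  have hsq : ∀ f : H, Summable fun p => ‖⟪φ p, f⟫_ℂ‖ ^ 2 := fun f =>
    (hasSum_norm_inner_sq φ f).summable
  have hle : ∀ (f : H) p q, ‖K p q * ⟪φ q, f⟫_ℂ‖ ≤ Q * (blockToep α p q * ‖⟪φ q, f⟫_ℂ‖) :=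
    fun f p q => by
      rw [norm_mul, ← mul_assoc]; gcongr; exact hK p q
  have hrow : ∀ (f : H) p, Summable fun q => K p q * ⟪φ q, f⟫_ℂ := fun f p =>
    Summable.of_norm_bounded (((h _ (hsq f)).1 p).mul_left Q) (hle f p)
  have hbd : ∀ (f : H) p, ‖∑' q, K p q * ⟪φ q, f⟫_ℂ‖ ^ 2 ≤
      Q ^ 2 * (∑' q, blockToep α p q * ‖⟪φ q, f⟫_ℂ‖) ^ 2 := fun f p => by
    rw [← mul_pow, ← tsum_mul_left]
    gcongr
    exact tsum_of_norm_bounded (((h _ (hsq f)).1 p).mul_left Q).hasSum (hle f p)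
  have hsum : ∀ f : H, Summable fun p => ‖∑' q, K p q * ⟪φ q, f⟫_ℂ‖ ^ 2 := fun f =>
    Summable.of_nonneg_of_le (fun p => by positivity) (hbd f) ((h _ (hsq f)).2.1.mul_left _)
  choose T hT using fun f => exists_inner_eq_of_summable φ (hsum f)
  let L : H →ₗ[ℂ] H :=
    { toFun := T
      map_add' := fun f g => eq_of_inner_eq φ fun p => by
        rw [inner_add_right, hT, hT, hT, ← (hrow f p).tsum_add (hrow g p)]
        simp only [inner_add_right, mul_add]
      map_smul' := fun c f => eq_of_inner_eq φ fun p => by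
        rw [RingHom.id_apply, inner_smul_right, hT, hT, ← tsum_mul_left]
        simp only [inner_smul_right]
        exact tsum_congr fun q => by ring }
  refine ⟨L.mkContinuous (√(Q ^ 2 * C)) fun f => ?_, fun f p => ?_⟩
  · change ‖T f‖ ≤ _
    refine le_of_sq_le_sq ?_ (by positivity)
    rw [mul_pow, Real.sq_sqrt (by positivity), ← (hasSum_norm_inner_sq φ (T f)).tsum_eq,
      ← (hasSum_norm_inner_sq φ f).tsum_eq]
    simp only [hT]
    calc _ ≤ ∑' p, Q ^ 2 * (∑' q, blockToep α p q * ‖⟪φ q, f⟫_ℂ‖) ^ 2 :=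
          (hsum f).tsum_le_tsum (hbd f) ((h _ (hsq f)).2.1.mul_left _)
      _ ≤ _ := by
          rw [tsum_mul_left, mul_assoc]
          gcongr
          exact (h _ (hsq f)).2.2
  · change HasSum _ ⟪φ p, T f⟫_ℂ
    rw [hT]
    exact (hrow f p).hasSum

end Hilbert

/-! ### The norms of `D(A^s)` -/

section Weights

/-- The two-sided growth `|μ n| ~ n^α` of the eigenvalues of all blocks. -/
def GrowsLike {m : ℕ} (ev : Fin m → ℕ → ℂ) (α G : ℝ) : Prop :=
  ∀ i (n : ℕ), ((n : ℝ) + 1) ^ α ≤ G * (1 + ‖ev i n‖) ∧ 1 + ‖ev i n‖ ≤ G * ((n : ℝ) + 1) ^ α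

variable {H : Type*} [NormedAddCommGroup H] [InnerProductSpace ℂ H] {m : ℕ}
  {ev : Fin m → ℕ → ℂ} {α G s : ℝ}

lemma GrowsLike.exists_weight_le (h : GrowsLike ev α G) (hG : 0 ≤ G) (hs : 0 ≤ s) :
    ∃ G' : ℝ, 0 < G' ∧ ∀ p : Fin m × ℕ,
      ((p.2 : ℝ) + 1) ^ (2 * (α * s)) ≤ G' * (1 + ‖ev p.1 p.2‖ ^ (2 * s)) ∧
      1 + ‖ev p.1 p.2‖ ^ (2 * s) ≤ G' * ((p.2 : ℝ) + 1) ^ (2 * (α * s)) := by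
  refine ⟨G ^ (2 * s) * 2 ^ (2 * s) + 2 * G ^ (2 * s) + 1, by positivity, fun p => ?_⟩
  obtain ⟨h1, h2⟩ := h p.1 p.2
  have hp : (0 : ℝ) < p.2 + 1 := by positivity
  have hs2 : 0 ≤ 2 * s := by positivity
  have e1 : ((p.2 : ℝ) + 1) ^ (2 * (α * s)) = (((p.2 : ℝ) + 1) ^ α) ^ (2 * s) := by
    rw [← Real.rpow_mul hp.le]; ring_nf
  rw [e1]
  set x := ‖ev p.1 p.2‖ with hx
  have hx0 : 0 ≤ x := norm_nonneg _
  constructor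
  · calc (((p.2 : ℝ) + 1) ^ α) ^ (2 * s) ≤ (G * (1 + x)) ^ (2 * s) := by gcongr
      _ = G ^ (2 * s) * (1 + x) ^ (2 * s) := Real.mul_rpow hG (by positivity)
      _ ≤ G ^ (2 * s) * (2 ^ (2 * s) * (1 + x ^ (2 * s))) := by
          gcongr; exact one_add_rpow_le hx0 hs2
      _ = G ^ (2 * s) * 2 ^ (2 * s) * (1 + x ^ (2 * s)) := by ring
      _ ≤ _ := by
          gcongr
          have : 0 ≤ G ^ (2 * s) := by positivity
          linarith
  · calc 1 + x ^ (2 * s) ≤ 2 * (1 + x) ^ (2 * s) := by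
          have h3 : 1 ≤ (1 + x) ^ (2 * s) := Real.one_le_rpow (by linarith) hs2
          have h4 : x ^ (2 * s) ≤ (1 + x) ^ (2 * s) := by gcongr; linarith
          linarith
      _ ≤ 2 * (G * ((p.2 : ℝ) + 1) ^ α) ^ (2 * s) := by gcongr
      _ = 2 * G ^ (2 * s) * (((p.2 : ℝ) + 1) ^ α) ^ (2 * s) := by
          rw [Real.mul_rpow hG (by positivity)]; ring
      _ ≤ _ := by
          gcongr
          have : 0 ≤ G ^ (2 * s) * 2 ^ (2 * s) := by positivity
          linarith

lemma mem_powDomain_iff (φ : HilbertBasis (Fin m × ℕ) ℂ H) {f : H} : f ∈ powDomain φ ev s ↔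
    Summable fun p : Fin m × ℕ => (1 + ‖ev p.1 p.2‖ ^ (2 * s)) * ‖⟪φ p, f⟫_ℂ‖ ^ 2 := by
  have h := (hasSum_norm_inner_sq φ f).summable
  simp only [add_mul, one_mul]
  exact ⟨fun hf => h.add hf, fun hf => (hf.sub h).congr fun p => add_sub_cancel_left _ _⟩

lemma hasSum_powNorm_sq (φ : HilbertBasis (Fin m × ℕ) ℂ H) {f : H} (hf : f ∈ powDomain φ ev s) :
    HasSum (fun p : Fin m × ℕ => (1 + ‖ev p.1 p.2‖ ^ (2 * s)) * ‖⟪φ p, f⟫_ℂ‖ ^ 2)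
      (powNorm φ ev s f ^ 2) := by
  have h := (hasSum_norm_inner_sq φ f).add (Summable.hasSum hf)
  rw [powNorm, Real.sq_sqrt (by positivity)]
  simpa only [add_mul, one_mul] using h

lemma powNorm_nonneg (φ : HilbertBasis (Fin m × ℕ) ℂ H) (f : H) : 0 ≤ powNorm φ ev s f :=
  Real.sqrt_nonneg _

lemma norm_le_powNorm (φ : HilbertBasis (Fin m × ℕ) ℂ H) (f : H) : ‖f‖ ≤ powNorm φ ev s f := by
  rw [powNorm]
  exact Real.le_sqrt_of_sq_le (le_add_of_nonneg_right (tsum_nonneg fun p => by positivity))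

/-- In coordinates, `D(A^s)` is `ℓ²` with the weight `(n + 1)^(2 α s)`, up to equivalence of
norms. -/
lemma GrowsLike.exists_powNorm_equiv (h : GrowsLike ev α G) (hG : 0 ≤ G) (hs : 0 ≤ s)
    (φ : HilbertBasis (Fin m × ℕ) ℂ H) :
    ∃ G' : ℝ, 0 < G' ∧ ∀ f : H,
      (f ∈ powDomain φ ev s ↔ Summable fun p : Fin m × ℕ =>
        ((p.2 : ℝ) + 1) ^ (2 * (α * s)) * ‖⟪φ p, f⟫_ℂ‖ ^ 2) ∧
      (f ∈ powDomain φ ev s →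
        ∑' p : Fin m × ℕ, ((p.2 : ℝ) + 1) ^ (2 * (α * s)) * ‖⟪φ p, f⟫_ℂ‖ ^ 2 ≤
          G' * powNorm φ ev s f ^ 2 ∧
        powNorm φ ev s f ^ 2 ≤
          G' * ∑' p : Fin m × ℕ, ((p.2 : ℝ) + 1) ^ (2 * (α * s)) * ‖⟪φ p, f⟫_ℂ‖ ^ 2) := by
  obtain ⟨G', hG', hw⟩ := h.exists_weight_le hG hs
  refine ⟨G', hG', fun f => ?_⟩
  have h1 : ∀ p : Fin m × ℕ, ((p.2 : ℝ) + 1) ^ (2 * (α * s)) * ‖⟪φ p, f⟫_ℂ‖ ^ 2 ≤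
      G' * ((1 + ‖ev p.1 p.2‖ ^ (2 * s)) * ‖⟪φ p, f⟫_ℂ‖ ^ 2) := fun p =>
    (mul_le_mul_of_nonneg_right (hw p).1 (sq_nonneg _)).trans_eq (mul_assoc _ _ _)
  have h2 : ∀ p : Fin m × ℕ, (1 + ‖ev p.1 p.2‖ ^ (2 * s)) * ‖⟪φ p, f⟫_ℂ‖ ^ 2 ≤
      G' * (((p.2 : ℝ) + 1) ^ (2 * (α * s)) * ‖⟪φ p, f⟫_ℂ‖ ^ 2) := fun p =>
    (mul_le_mul_of_nonneg_right (hw p).2 (sq_nonneg _)).trans_eq (mul_assoc _ _ _)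
  have hiff : f ∈ powDomain φ ev s ↔ Summable fun p : Fin m × ℕ =>
      ((p.2 : ℝ) + 1) ^ (2 * (α * s)) * ‖⟪φ p, f⟫_ℂ‖ ^ 2 := by
    rw [mem_powDomain_iff]
    exact ⟨fun hf => Summable.of_nonneg_of_le (fun p => by positivity) h1 (hf.mul_left _),
      fun hf => Summable.of_nonneg_of_le (fun p => by positivity) h2 (hf.mul_left _)⟩
  refine ⟨hiff, fun hf => ?_⟩
  have hs1 := hasSum_powNorm_sq φ hf
  have hs2 := hiff.1 hf
  constructor
  · calc _ ≤ ∑' p : Fin m × ℕ, G' * ((1 + ‖ev p.1 p.2‖ ^ (2 * s)) * ‖⟪φ p, f⟫_ℂ‖ ^ 2) :=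
          hs2.tsum_le_tsum h1 (hs1.summable.mul_left _)
      _ = _ := by rw [tsum_mul_left, hs1.tsum_eq]
  · calc _ = ∑' p : Fin m × ℕ, (1 + ‖ev p.1 p.2‖ ^ (2 * s)) * ‖⟪φ p, f⟫_ℂ‖ ^ 2 := hs1.tsum_eq.symm
      _ ≤ _ := hs1.summable.tsum_le_tsum h2 (hs2.mul_left _)
      _ = _ := tsum_mul_left

/-- Matrices dominated by the block Toeplitz kernel act boundedly on `D(A^s)` for
`0 ≤ s < 1 - 1 / (2 α)`. -/
lemma GrowsLike.exists_powNorm_kernel_le (h : GrowsLike ev α G) (hG : 0 ≤ G) (hα : 1 < α)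
    (hs : 0 ≤ s) (hs' : s < 1 - 1 / (2 * α)) (φ : HilbertBasis (Fin m × ℕ) ℂ H) :
    ∃ C : ℝ, 0 ≤ C ∧ ∀ (K : Fin m × ℕ → Fin m × ℕ → ℂ) (Q : ℝ), 0 ≤ Q →
      (∀ p q, ‖K p q‖ ≤ Q * blockToep α p q) → ∀ f g : H,
      (∀ p, HasSum (fun q => K p q * ⟪φ q, f⟫_ℂ) ⟪φ p, g⟫_ℂ) → f ∈ powDomain φ ev s →
      g ∈ powDomain φ ev s ∧ powNorm φ ev s g ≤ C * Q * powNorm φ ev s f := by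
  have hα0 : 0 < α := by linarith
  have has : α * s < α - 1 / 2 := by
    have := mul_lt_mul_of_pos_left hs' hα0
    rwa [mul_sub, mul_one, show α * (1 / (2 * α)) = 1 / 2 by field_simp] at this
  obtain ⟨G', hG', he⟩ := h.exists_powNorm_equiv hG hs φ
  obtain ⟨C, hC, hT⟩ := exists_blockToep_summable (m := m) hα (by positivity) has
  refine ⟨√(G' * C * G'), by positivity, fun K Q hQ hK f g hfg hf => ?_⟩
  obtain ⟨hrow, hsum, hle⟩ := hT (fun q => ⟪φ q, f⟫_ℂ) ((he f).1.1 hf)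
  have hbd : ∀ p, ‖⟪φ p, g⟫_ℂ‖ ^ 2 ≤
      Q ^ 2 * (∑' q, blockToep α p q * ‖⟪φ q, f⟫_ℂ‖) ^ 2 := fun p => by
    rw [← mul_pow, ← tsum_mul_left, ← (hfg p).tsum_eq]
    gcongr
    refine tsum_of_norm_bounded ((hrow p).mul_left Q).hasSum fun q => ?_
    rw [norm_mul, ← mul_assoc]; gcongr; exact hK p q
  have hbd' : ∀ p : Fin m × ℕ, ((p.2 : ℝ) + 1) ^ (2 * (α * s)) * ‖⟪φ p, g⟫_ℂ‖ ^ 2 ≤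
      Q ^ 2 * (((p.2 : ℝ) + 1) ^ (2 * (α * s)) *
        (∑' q, blockToep α p q * ‖⟪φ q, f⟫_ℂ‖) ^ 2) := fun p =>
    (mul_le_mul_of_nonneg_left (hbd p) (by positivity)).trans_eq (mul_left_comm _ _ _)
  have hsg := Summable.of_nonneg_of_le (fun p => by positivity) hbd' (hsum.mul_left _)
  have hg := (he g).1.2 hsg
  refine ⟨hg, le_of_sq_le_sq ?_ (by have := powNorm_nonneg (ev := ev) (s := s) φ f; positivity)⟩
  calc powNorm φ ev s g ^ 2
      ≤ G' * ∑' p : Fin m × ℕ, ((p.2 : ℝ) + 1) ^ (2 * (α * s)) * ‖⟪φ p, g⟫_ℂ‖ ^ 2 :=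
        ((he g).2 hg).2
    _ ≤ G' * (Q ^ 2 * (C * (G' * powNorm φ ev s f ^ 2))) := by
        gcongr
        refine (hsg.tsum_le_tsum hbd' (hsum.mul_left _)).trans ?_
        rw [tsum_mul_left]
        gcongr
        refine hle.trans ?_
        gcongr
        exact ((he f).2 hf).1
    _ = _ := by rw [mul_pow, mul_pow, Real.sq_sqrt (by positivity)]; ring

end Weights

/-! ### The closed-loop operator in the eigenbasis -/

section Operators

variable {H : Type*} [NormedAddCommGroup H] [InnerProductSpace ℂ H] [CompleteSpace H] {m : ℕ}
  {A : H →ₗ.[ℂ] H} {B : EuclideanSpace ℂ (Fin m) →L[ℂ] DualAdj A}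
  {φ : HilbertBasis (Fin m × ℕ) ℂ H} {ev : Fin m → ℕ → ℂ} {α : ℝ}

lemma Framework.inner_adjoint (h : Framework A B φ ev α) (x : A.adjoint.domain)
    (p : Fin m × ℕ) : ⟪A.adjoint x, φ p⟫_ℂ = ev p.1 p.2 * ⟪(x : H), φ p⟫_ℂ := by
  obtain ⟨hp, he⟩ := h.eigen p.1 p.2
  have := A.adjoint_isFormalAdjoint h.dense x ⟨φ p, hp⟩
  rw [this, he, inner_smul_right]

lemma Framework.mem_adjoint_domain (h : Framework A B φ ev α) (p : Fin m × ℕ) :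
    φ p ∈ A.adjoint.domain := by
  obtain ⟨hp, -⟩ := h.eigen p.1 p.2
  rcases h.self_or_skew with h1 | h1 <;> rw [h1]
  · exact hp
  · exact hp

lemma Framework.adjoint_eigen (h : Framework A B φ ev α) (p : Fin m × ℕ) :
    A.adjoint ⟨φ p, h.mem_adjoint_domain p⟩ = conj (ev p.1 p.2) • φ p := by
  refine eq_of_inner_eq φ fun q => ?_
  rw [← inner_conj_symm, h.inner_adjoint, map_mul, inner_conj_symm, inner_smul_right]
  by_cases hpq : q = p
  · rw [hpq]
  · rw [φ.orthonormal.2 hpq, mul_zero, mul_zero]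

/-- The action of `B u` on an eigenvector: only the control of its own block is seen. -/
lemma Framework.bracket_eigen (h : Framework A B φ ev α) (u : EuclideanSpace ℂ (Fin m))
    (p : Fin m × ℕ) : bracket (B u) ⟨φ p, h.mem_adjoint_domain p⟩ =
      controlCoeff B p.1 (φ p) * u p.1 := by
  have hu : u = ∑ j, u j • EuclideanSpace.single j (1 : ℂ) := by
    ext i
    simp [Finset.sum_apply, Pi.single_apply]
  have h1 : bracket (B u) ⟨φ p, h.mem_adjoint_domain p⟩ = ∑ j, u j * controlCoeff B j (φ p) := by
    conv_lhs => rw [hu]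
    simp only [bracket, map_sum, map_smul, sum_apply,
      smul_apply, smul_eq_mul]
    refine Finset.sum_congr rfl fun j _ => ?_
    rw [controlCoeff, dif_pos (h.mem_adjoint_domain p)]
    rfl
  rw [h1, Finset.sum_eq_single p.1, mul_comm]
  · intro j _ hj
    rw [h.control_off p.1 j p.2 hj.symm, mul_zero]
  · simp

/-- The eigenvector expansion of `x ∈ D(A*)` converges in the graph norm. -/
lemma Framework.hasSum_bracket (h : Framework A B φ ev α) (l : DualAdj A) (x : A.adjoint.domain) :
    HasSum (fun p => ⟪(x : H), φ p⟫_ℂ * bracket l ⟨φ p, h.mem_adjoint_domain p⟩) (bracket l x) := by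
  have h0 : HasSum (fun p => (⟪φ p, (x : H)⟫_ℂ • φ p, ⟪φ p, A.adjoint x⟫_ℂ • φ p))
      ((x : H), A.adjoint x) := by
    have h1 := φ.hasSum_repr (x : H)
    have h2 := φ.hasSum_repr (A.adjoint x)
    simp only [φ.repr_apply_apply] at h1 h2
    exact h1.prodMk h2
  have h1 : HasSum (fun p => ⟪φ p, (x : H)⟫_ℂ •
      (⟨((⟨φ p, h.mem_adjoint_domain p⟩ : A.adjoint.domain), A.adjoint ⟨φ p, _⟩),
        A.adjoint.mem_graph ⟨φ p, h.mem_adjoint_domain p⟩⟩ : A.adjoint.graph))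
      ⟨((x : H), A.adjoint x), A.adjoint.mem_graph x⟩ := by
    refine (Topology.IsInducing.subtypeVal.hasSum_iff (g := A.adjoint.graph.subtype) _ _).1
      ?_
    change HasSum _ ((x : H), A.adjoint x)
    refine h0.congr_fun fun p => ?_
    rw [Function.comp_apply, Submodule.subtype_apply, Submodule.coe_smul, Prod.smul_mk,
      h.adjoint_eigen, ← inner_conj_symm (φ p) (A.adjoint x), h.inner_adjoint, map_mul,
      inner_conj_symm, smul_smul, mul_comm]
  have h2 := h1.mapL l
  simp only [map_smulₛₗ, inner_conj_symm, smul_eq_mul] at h2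
  exact h2

lemma ClosedLoopApply.add {K : H →ₗ.[ℂ] EuclideanSpace ℂ (Fin m)} {f₁ f₂ g₁ g₂ : H}
    (h₁ : ClosedLoopApply A B K f₁ g₁) (h₂ : ClosedLoopApply A B K f₂ g₂) :
    ClosedLoopApply A B K (f₁ + f₂) (g₁ + g₂) := by
  obtain ⟨hf₁, h₁⟩ := h₁
  obtain ⟨hf₂, h₂⟩ := h₂
  refine ⟨K.domain.add_mem hf₁ hf₂, fun x => ?_⟩
  have e : K ⟨f₁ + f₂, K.domain.add_mem hf₁ hf₂⟩ = K ⟨f₁, hf₁⟩ + K ⟨f₂, hf₂⟩ :=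
    K.map_add ⟨f₁, hf₁⟩ ⟨f₂, hf₂⟩
  have e' : bracket (B (K ⟨f₁, hf₁⟩ + K ⟨f₂, hf₂⟩)) x =
      bracket (B (K ⟨f₁, hf₁⟩)) x + bracket (B (K ⟨f₂, hf₂⟩)) x := by
    simp only [bracket, map_add]; rfl
  rw [e, e', inner_add_right, inner_add_right, h₁ x, h₂ x]
  ring

/-- The closed-loop operator in the coordinates of the eigenbasis. -/
lemma Framework.closedLoopApply_iff (h : Framework A B φ ev α)
    {K : H →ₗ.[ℂ] EuclideanSpace ℂ (Fin m)} {f g : H} : ClosedLoopApply A B K f g ↔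
      ∃ hf : f ∈ K.domain, ∀ p : Fin m × ℕ, ⟪φ p, g⟫_ℂ =
        ev p.1 p.2 * ⟪φ p, f⟫_ℂ + controlCoeff B p.1 (φ p) * K ⟨f, hf⟩ p.1 := by
  refine exists_congr fun hf => ⟨fun hx p => ?_, fun hp x => ?_⟩
  · have := hx ⟨φ p, h.mem_adjoint_domain p⟩
    rwa [h.bracket_eigen, h.adjoint_eigen, inner_smul_left, Complex.conj_conj] at this
  · have h1 := φ.hasSum_inner_mul_inner (x : H) g
    have h2 := φ.hasSum_inner_mul_inner (A.adjoint x) f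
    have h3 := h.hasSum_bracket (B (K ⟨f, hf⟩)) x
    refine h1.unique ((h2.add h3).congr_fun fun p => ?_)
    rw [hp, h.bracket_eigen, h.inner_adjoint]
    ring

end Operators

/-! ### Strongly continuous semigroups on eigenvectors -/

section Semigroup

variable {H : Type*} [NormedAddCommGroup H] [InnerProductSpace ℂ H]
  {S : ℝ → H →L[ℂ] H} {A : H →ₗ.[ℂ] H}

lemma IsC0Semigroup.tendsto_nhdsGE (h : IsC0Semigroup S) (x : H) :
    Tendsto (fun t : ℝ => S t x) (𝓝[≥] 0) (𝓝 x) := by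
  rw [← Ioi_insert, nhdsWithin_insert]
  refine tendsto_sup.2 ⟨?_, h.strong x⟩
  rw [tendsto_pure_left]
  intro s hs
  rw [h.zero]
  exact mem_of_mem_nhds hs

variable [CompleteSpace H]

/-- Otherwise the operators along some sequence of times tending to zero would be unbounded, against
the uniform boundedness principle. -/
lemma IsC0Semigroup.exists_norm_le_near_zero (h : IsC0Semigroup S) :
    ∃ δ M : ℝ, 0 < δ ∧ ∀ t, 0 ≤ t → t ≤ δ → ‖S t‖ ≤ M := by
  by_contra! hcon
  choose t ht0 ht1 htM using fun n : ℕ => hcon (1 / ((n : ℝ) + 1)) n (by positivity)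
  have hlim : Tendsto t atTop (𝓝 0) :=
    squeeze_zero ht0 ht1 tendsto_one_div_add_atTop_nhds_zero_nat
  have hpt : ∀ x : H, Tendsto (fun n => S (t n) x) atTop (𝓝 x) := fun x => by
    exact (h.tendsto_nhdsGE x).comp (tendsto_nhdsWithin_iff.2 ⟨hlim, Eventually.of_forall ht0⟩)
  obtain ⟨M, hM⟩ := banach_steinhaus (g := fun n => S (t n)) fun x => by
    obtain ⟨C, hC⟩ := (hpt x).norm.bddAbove_range
    exact ⟨C, fun n => hC ⟨n, rfl⟩⟩
  obtain ⟨n, hn⟩ := exists_nat_gt M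
  exact absurd (hM n) (not_le.2 (hn.trans (htM n)))

/-- A semigroup is bounded on bounded intervals. -/
lemma IsC0Semigroup.exists_norm_le (h : IsC0Semigroup S) (T : ℝ) :
    ∃ M : ℝ, 0 ≤ M ∧ ∀ t, 0 ≤ t → t ≤ T → ‖S t‖ ≤ M := by
  obtain ⟨δ, M, hδ, hM⟩ := h.exists_norm_le_near_zero
  have hM0 : 0 ≤ M := (norm_nonneg _).trans (hM 0 le_rfl hδ.le)
  have key : ∀ n : ℕ, ∃ M' : ℝ, 0 ≤ M' ∧ ∀ t, 0 ≤ t → t ≤ n * δ → ‖S t‖ ≤ M' := by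
    intro n
    induction n with
    | zero => exact ⟨M, hM0, fun t h0 h1 => hM t h0 (h1.trans (by simpa using hδ.le))⟩
    | succ n ih =>
      obtain ⟨M', hM'0, hM'⟩ := ih
      refine ⟨max M (M * M'), le_max_of_le_left hM0, fun t h0 h1 => ?_⟩
      rcases le_total t δ with h2 | h2
      · exact (hM t h0 h2).trans (le_max_left _ _)
      · have e := h.add δ (t - δ) hδ.le (by linarith)
        rw [add_sub_cancel] at e
        rw [e]
        refine (ContinuousLinearMap.opNorm_comp_le _ _).trans (le_max_of_le_right ?_)
        push_cast at h1
        exact mul_le_mul (hM δ hδ.le le_rfl) (hM' _ (by linarith) (by linarith))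
          (norm_nonneg _) hM0
  obtain ⟨n, hn⟩ := exists_nat_gt (T / δ)
  obtain ⟨M', hM'0, hM'⟩ := key n
  refine ⟨M', hM'0, fun t h0 h1 => hM' t h0 (h1.trans ?_)⟩
  rw [div_lt_iff₀ hδ] at hn
  exact hn.le

lemma IsC0Semigroup.continuousOn (h : IsC0Semigroup S) (x : H) (T : ℝ) :
    ContinuousOn (fun t => S t x) (Icc 0 T) := by
  obtain ⟨M, hM0, hM⟩ := h.exists_norm_le T
  intro t ht
  have h1 : Tendsto (fun r : ℝ => ‖S |r - t| x - x‖) (𝓝 t) (𝓝 0) := by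
    have h3 : Tendsto (fun r : ℝ => |r - t|) (𝓝 t) (𝓝[≥] 0) := by
      refine tendsto_nhdsWithin_iff.2 ⟨?_, Eventually.of_forall fun r => mem_Ici.2 (abs_nonneg _)⟩
      have : Continuous fun r : ℝ => |r - t| := by fun_prop
      simpa using this.tendsto t
    exact tendsto_iff_norm_sub_tendsto_zero.1 ((h.tendsto_nhdsGE x).comp h3)
  refine tendsto_iff_norm_sub_tendsto_zero.2 (squeeze_zero' (Eventually.of_forall fun _ =>
    norm_nonneg _) ?_ (g := fun r => M * ‖S |r - t| x - x‖)
    (by simpa using (h1.const_mul M).mono_left nhdsWithin_le_nhds))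
  filter_upwards [self_mem_nhdsWithin] with r hr
  rcases le_total t r with htr | htr
  · have e := h.add t (r - t) ht.1 (by linarith)
    rw [add_sub_cancel] at e
    rw [abs_of_nonneg (by linarith : 0 ≤ r - t), e, ContinuousLinearMap.comp_apply, ← map_sub]
    exact (S t).le_of_opNorm_le (hM t ht.1 ht.2) _
  · have e := h.add r (t - r) hr.1 (by linarith)
    rw [add_sub_cancel] at e
    rw [abs_of_nonpos (by linarith : r - t ≤ 0), e, ContinuousLinearMap.comp_apply, ← map_sub,
      neg_sub, ← norm_neg, ← map_neg, neg_sub]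
    exact (S r).le_of_opNorm_le (hM r hr.1 hr.2) _

/-- A semigroup acts on the eigenvectors of its generator by exponentials. -/
lemma IsC0Semigroup.apply_eigenvector (h : IsC0Semigroup S) (hA : IsGenerator S A) {x : H} {z : ℂ}
    (hx : ∃ h : x ∈ A.domain, A ⟨x, h⟩ = z • x) : S 1 x = Complex.exp z • x := by
  have hd := (hA x (z • x)).1 hx
  have hcont : ContinuousOn (fun t : ℝ => Complex.exp (-(z * t)) • S t x) (Icc 0 1) :=
    ContinuousOn.smul (by fun_prop) (h.continuousOn x 1)
  have hder : ∀ t ∈ Ico (0 : ℝ) 1,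
      HasDerivWithinAt (fun t : ℝ => Complex.exp (-(z * t)) • S t x) 0 (Ici t) t := fun t ht => by
    have h1 : HasDerivWithinAt (fun t : ℝ => S t x) (S t (z • x)) (Ici t) t := by
      rw [hasDerivWithinAt_iff_tendsto_slope, Ici_sdiff_left]
      have h2 : Tendsto (fun r : ℝ => r - t) (𝓝[>] t) (𝓝[>] 0) := by
        refine tendsto_nhdsWithin_iff.2 ⟨?_, ?_⟩
        · have : Continuous fun r : ℝ => r - t := by fun_prop
          simpa using (this.tendsto t).mono_left nhdsWithin_le_nhds
        · filter_upwards [self_mem_nhdsWithin] with r hr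
          exact sub_pos.2 (mem_Ioi.1 hr)
      refine (((S t).continuous.tendsto _).comp (hd.comp h2)).congr' ?_
      filter_upwards [self_mem_nhdsWithin] with r hr
      have e := h.add t (r - t) ht.1 (sub_nonneg.2 (le_of_lt hr))
      rw [add_sub_cancel] at e
      simp only [Function.comp_apply, slope, vsub_eq_sub, e, ContinuousLinearMap.comp_apply,
        ← map_sub]
      rw [map_smul, ← Complex.ofReal_inv, Complex.coe_smul]
    have h2 : HasDerivAt (fun t : ℝ => Complex.exp (-(z * t))) (Complex.exp (-(z * t)) * -z) t := by
      have h3 : HasDerivAt (fun t : ℝ => -(z * (t : ℂ))) (-z) t := by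
        have := ((Complex.ofRealCLM.hasDerivAt (x := t)).const_mul z).neg
        simp only [Complex.ofRealCLM_apply, Complex.ofReal_one, mul_one] at this
        exact this
      exact h3.cexp
    refine (h2.hasDerivWithinAt.smul h1).congr_deriv ?_
    rw [map_smul, smul_smul, ← add_smul]
    simp
  have hc := constant_of_has_deriv_right_zero hcont hder 1 ⟨zero_le_one, le_rfl⟩
  simp only [Complex.ofReal_one, mul_one, Complex.ofReal_zero, mul_zero, neg_zero, Complex.exp_zero,
    one_smul, h.zero, ContinuousLinearMap.id_apply] at hc
  calc S 1 x = Complex.exp z • Complex.exp (-z) • S 1 x := by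
        rw [smul_smul, ← Complex.exp_add, add_neg_cancel, Complex.exp_zero, one_smul]
    _ = _ := by rw [hc]

end Semigroup

/-! ### Size of the eigenvalues -/

section Spectrum

variable {H : Type*} [NormedAddCommGroup H] [InnerProductSpace ℂ H] [CompleteSpace H] {m : ℕ}
  {A : H →ₗ.[ℂ] H} {B : EuclideanSpace ℂ (Fin m) →L[ℂ] DualAdj A}
  {φ : HilbertBasis (Fin m × ℕ) ℂ H} {ev : Fin m → ℕ → ℂ} {α : ℝ}

lemma Framework.exists_gap_le (h : Framework A B φ ev α) : ∃ c : ℝ, 0 < c ∧ ∀ i (k n : ℕ),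
    c * ((k : ℝ) + 1) ^ (α - 1) * |(k : ℝ) - n| ≤ ‖ev i k - ev i n‖ ∧
    c * ((n : ℝ) + 1) ^ (α - 1) * |(k : ℝ) - n| ≤ ‖ev i k - ev i n‖ := by
  obtain ⟨c, hc, hg⟩ := h.gap_all
  refine ⟨c, hc, fun i k n => ⟨hg i k n, ?_⟩⟩
  rw [abs_sub_comm, norm_sub_rev]
  exact hg i n k

/-- The gap condition with the weight of the larger index gives the separation
`c |n - j|^α ≤ |μ n - μ j|`. -/
lemma Framework.exists_separated (h : Framework A B φ ev α) :
    ∃ c : ℝ, 0 < c ∧ ∀ i, Separated (ev i) c α := by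
  obtain ⟨c, hc, hg⟩ := h.exists_gap_le
  have hα := h.one_lt
  have key : ∀ i (n j : ℕ), j ≤ n → c * |(n : ℝ) - j| ^ α ≤ ‖ev i n - ev i j‖ := by
    intro i n j hjn
    refine le_trans ?_ (hg i n j).1
    have hjn' : (j : ℝ) ≤ n := by exact_mod_cast hjn
    rcases hjn.eq_or_lt with rfl | hlt
    · simp [Real.zero_rpow (by linarith : α ≠ 0)]
    · have hpos : 0 < (n : ℝ) - j := sub_pos.2 (by exact_mod_cast hlt)
      rw [abs_of_pos hpos, mul_assoc]
      calc c * ((n : ℝ) - j) ^ α = c * (((n : ℝ) - j) ^ (α - 1) * ((n : ℝ) - j)) := by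
            rw [← Real.rpow_add_one hpos.ne']; ring_nf
        _ ≤ _ := by
            have : (0 : ℝ) ≤ j := Nat.cast_nonneg j
            gcongr
            linarith
  refine ⟨c, hc, fun i n j => ?_⟩
  rcases le_total j n with hjn | hjn
  · exact key i n j hjn
  · rw [abs_sub_comm, norm_sub_rev]
    exact key i j n hjn

lemma Framework.exists_growsLike (h : Framework A B φ ev α) :
    ∃ G : ℝ, 0 ≤ G ∧ GrowsLike ev α G := by
  obtain ⟨c, hc, hsep⟩ := h.exists_separated
  obtain ⟨c', C, hc', hg⟩ := h.gap
  have hα := h.one_lt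
  set M := ∑ i, ‖ev i 0‖ with hM
  have hM0 : 0 ≤ M := Finset.sum_nonneg fun _ _ => norm_nonneg _
  have hMi : ∀ i, ‖ev i 0‖ ≤ M := fun i =>
    Finset.single_le_sum (f := fun i => ‖ev i 0‖) (fun _ _ => norm_nonneg _) (Finset.mem_univ i)
  have hup : ∀ i (n : ℕ), ‖ev i n - ev i 0‖ ≤ |C| * n * ((n : ℝ) + 1) ^ (α - 1) := by
    intro i n
    induction n with
    | zero => simp
    | succ n ih =>
      calc ‖ev i (n + 1) - ev i 0‖ ≤ ‖ev i (n + 1) - ev i n‖ + ‖ev i n - ev i 0‖ := by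
            simpa using norm_add_le (ev i (n + 1) - ev i n) (ev i n - ev i 0)
        _ ≤ |C| * ((n : ℝ) + 1) ^ (α - 1) + |C| * n * ((n : ℝ) + 1) ^ (α - 1) := by
            refine add_le_add ((hg i n).2.trans ?_) ih
            gcongr
            exact le_abs_self C
        _ = |C| * ((n : ℝ) + 1) * ((n : ℝ) + 1) ^ (α - 1) := by ring
        _ ≤ _ := by
            push_cast
            gcongr
            linarith
  refine ⟨2 ^ α * (1 + (1 + M) / c) + (1 + M + |C|), by positivity, fun i n => ⟨?_, ?_⟩⟩
  · have h1 : c * (n : ℝ) ^ α ≤ ‖ev i n‖ + M := by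
      have h2 := hsep i n 0
      simp only [Nat.cast_zero, sub_zero, Nat.abs_cast] at h2
      exact h2.trans ((norm_sub_le _ _).trans (add_le_add_right (hMi i) _))
    calc ((n : ℝ) + 1) ^ α ≤ 2 ^ α * (1 + (n : ℝ) ^ α) := by
          rw [add_comm]; exact one_add_rpow_le (Nat.cast_nonneg n) (by linarith)
      _ ≤ 2 ^ α * ((1 + (1 + M) / c) * (1 + ‖ev i n‖)) := by
          gcongr
          have h2 : (n : ℝ) ^ α ≤ (‖ev i n‖ + M) / c := by rw [le_div_iff₀ hc]; linarith
          have h3 : (‖ev i n‖ + M) / c ≤ (1 + M) / c * (1 + ‖ev i n‖) := by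
            rw [div_mul_eq_mul_div]
            gcongr
            nlinarith [norm_nonneg (ev i n)]
          nlinarith [norm_nonneg (ev i n)]
      _ ≤ _ := by
          rw [← mul_assoc]
          gcongr
          exact le_add_of_nonneg_right (by positivity)
  · have hn : (0 : ℝ) < n + 1 := by positivity
    have h1 : (1 : ℝ) ≤ ((n : ℝ) + 1) ^ α :=
      Real.one_le_rpow (by linarith [(Nat.cast_nonneg n : (0 : ℝ) ≤ n)]) (by linarith)
    have h2 : ‖ev i n‖ ≤ ‖ev i n - ev i 0‖ + ‖ev i 0‖ := by
      simpa using norm_add_le (ev i n - ev i 0) (ev i 0)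
    have h3 : |C| * n * ((n : ℝ) + 1) ^ (α - 1) ≤ |C| * ((n : ℝ) + 1) ^ α := by
      calc |C| * n * ((n : ℝ) + 1) ^ (α - 1) ≤ |C| * ((n : ℝ) + 1) * ((n : ℝ) + 1) ^ (α - 1) := by
            gcongr; linarith
        _ = |C| * ((n : ℝ) + 1) ^ α := by
            rw [mul_assoc, mul_comm ((n : ℝ) + 1), ← Real.rpow_add_one hn.ne']; ring_nf
    calc 1 + ‖ev i n‖ ≤ (1 + M) * 1 + |C| * ((n : ℝ) + 1) ^ α := by
          linarith [hMi i, hup i n]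
      _ ≤ (1 + M) * ((n : ℝ) + 1) ^ α + |C| * ((n : ℝ) + 1) ^ α := by gcongr
      _ = (1 + M + |C|) * ((n : ℝ) + 1) ^ α := by ring
      _ ≤ _ := by
          refine mul_le_mul_of_nonneg_right (le_add_of_nonneg_left ?_) (by positivity)
          positivity

/-- The eigenvalues of a generator lie in a left half-plane. -/
lemma Framework.exists_re_le (h : Framework A B φ ev α) :
    ∃ w : ℝ, 0 ≤ w ∧ ∀ p : Fin m × ℕ, (ev p.1 p.2).re ≤ w := by
  obtain ⟨S, hS, hA⟩ := h.generates
  refine ⟨‖S 1‖, norm_nonneg _, fun p => ?_⟩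
  have h1 := hS.apply_eigenvector hA (h.eigen p.1 p.2)
  have h2 := (S 1).le_opNorm (φ p)
  rw [h1, norm_smul, φ.orthonormal.1, mul_one, mul_one, Complex.norm_exp] at h2
  linarith [Real.add_one_le_exp (ev p.1 p.2).re]

end Spectrum

/-! ### Diagonal flows -/

section Flow

variable {H : Type*} [NormedAddCommGroup H] [InnerProductSpace ℂ H] {ι : Type*}

/-- The diagonal flow `a ↦ ∑ exp(ν_p t) ⟨φ_p, a⟩ φ_p`. -/
noncomputable def expFlow (φ : HilbertBasis ι ℂ H) (ν : ι → ℂ) (t : ℝ) (a : H) : H :=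
  ∑' p, (Complex.exp (ν p * t) * ⟪φ p, a⟫_ℂ) • φ p

variable (φ : HilbertBasis ι ℂ H) {ν : ι → ℂ} {w : ℝ}

lemma norm_exp_mul_le {z : ℂ} (hz : z.re ≤ w) {t : ℝ} (ht : 0 ≤ t) :
    ‖Complex.exp (z * t)‖ ≤ Real.exp (w * t) := by
  rw [Complex.norm_exp]
  simp only [Complex.mul_re, Complex.ofReal_re, Complex.ofReal_im, mul_zero, sub_zero]
  gcongr

lemma inner_expFlow (hν : ∀ p, (ν p).re ≤ w) {t : ℝ} (ht : 0 ≤ t) (a : H) (p : ι) :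
    ⟪φ p, expFlow φ ν t a⟫_ℂ = Complex.exp (ν p * t) * ⟪φ p, a⟫_ℂ := by
  obtain ⟨f, hf⟩ := exists_inner_eq_of_summable φ
    (c := fun p => Complex.exp (ν p * t) * ⟪φ p, a⟫_ℂ) (by
      refine Summable.of_nonneg_of_le (fun p => by positivity) (fun p => ?_)
        ((hasSum_norm_inner_sq φ a).summable.mul_left (Real.exp (w * t) ^ 2))
      rw [norm_mul, mul_pow]
      gcongr
      exact norm_exp_mul_le (hν p) ht)
  have h : expFlow φ ν t a = f := by
    rw [expFlow, ← (φ.hasSum_repr f).tsum_eq]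
    simp only [φ.repr_apply_apply, hf]
  rw [h, hf]

lemma expFlow_zero (a : H) : expFlow φ ν 0 a = a := by
  have h := (φ.hasSum_repr a).tsum_eq
  simp only [φ.repr_apply_apply] at h
  simpa [expFlow] using h

end Flow

/-! ### Diagonal flows on `D(A^s)` -/

section FlowPow

variable {H : Type*} [NormedAddCommGroup H] [InnerProductSpace ℂ H] {m : ℕ}
  (φ : HilbertBasis (Fin m × ℕ) ℂ H) {ν : Fin m × ℕ → ℂ} {w : ℝ} {ev : Fin m → ℕ → ℂ} {s : ℝ}

lemma powNorm_expFlow_le (hν : ∀ p, (ν p).re ≤ w) {t : ℝ} (ht : 0 ≤ t) {a : H}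
    (ha : a ∈ powDomain φ ev s) : expFlow φ ν t a ∈ powDomain φ ev s ∧
      powNorm φ ev s (expFlow φ ν t a) ≤ Real.exp (w * t) * powNorm φ ev s a := by
  have hs := hasSum_powNorm_sq φ ha
  have hle : ∀ p : Fin m × ℕ, (1 + ‖ev p.1 p.2‖ ^ (2 * s)) * ‖⟪φ p, expFlow φ ν t a⟫_ℂ‖ ^ 2 ≤
      Real.exp (w * t) ^ 2 * ((1 + ‖ev p.1 p.2‖ ^ (2 * s)) * ‖⟪φ p, a⟫_ℂ‖ ^ 2) := fun p => by
    rw [inner_expFlow φ hν ht, norm_mul, mul_pow, mul_left_comm]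
    gcongr
    exact norm_exp_mul_le (hν p) ht
  have hmem : expFlow φ ν t a ∈ powDomain φ ev s := (mem_powDomain_iff φ).2
    (Summable.of_nonneg_of_le (fun p => by positivity) hle (hs.summable.mul_left _))
  refine ⟨hmem, le_of_sq_le_sq ?_
    (mul_nonneg (Real.exp_pos _).le (powNorm_nonneg φ a))⟩
  rw [mul_pow]
  exact hasSum_le hle (hasSum_powNorm_sq φ hmem) (hs.mul_left _)

lemma sub_mem_powDomain {f g : H} (hf : f ∈ powDomain φ ev s) (hg : g ∈ powDomain φ ev s) :
    f - g ∈ powDomain φ ev s := by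
  refine Summable.of_nonneg_of_le (fun p => by positivity) (fun p => ?_)
    ((Summable.add hf hg).mul_left 2)
  rw [inner_sub_right, ← mul_add, mul_left_comm]
  gcongr
  have h1 := norm_sub_le ⟪φ p, f⟫_ℂ ⟪φ p, g⟫_ℂ
  nlinarith [sq_nonneg (‖⟪φ p, f⟫_ℂ‖ - ‖⟪φ p, g⟫_ℂ‖), norm_nonneg (⟪φ p, f⟫_ℂ - ⟪φ p, g⟫_ℂ),
    norm_nonneg ⟪φ p, f⟫_ℂ, norm_nonneg ⟪φ p, g⟫_ℂ]

/-- The diagonal flow is strongly continuous on `D(A^s)`, by dominated convergence. -/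
lemma continuousOnPow_expFlow (hν : ∀ p, (ν p).re ≤ w) {a : H} (ha : a ∈ powDomain φ ev s) :
    ContinuousOnPow φ ev s (fun t => expFlow φ ν t a) (Ici 0) := by
  intro t ht
  have hmem : ∀ τ ∈ Ici (0 : ℝ), expFlow φ ν τ a ∈ powDomain φ ev s := fun τ hτ =>
    (powNorm_expFlow_le φ hν hτ ha).1
  refine ⟨hmem t ht, ?_⟩
  set E := Real.exp (|w| * (t + 1)) with hE
  have hexp : ∀ τ ∈ Icc 0 (t + 1), ∀ p, ‖Complex.exp (ν p * τ)‖ ≤ E := fun τ hτ p => by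
    refine (norm_exp_mul_le (hν p) hτ.1).trans ?_
    rw [hE]
    have h1 : w * τ ≤ |w| * τ := mul_le_mul_of_nonneg_right (le_abs_self w) hτ.1
    have h2 : |w| * τ ≤ |w| * (t + 1) := mul_le_mul_of_nonneg_left hτ.2 (abs_nonneg w)
    exact Real.exp_le_exp.2 (h1.trans h2)
  have ht0 : (0 : ℝ) ≤ t := ht
  have ht1 : t ∈ Icc 0 (t + 1) := ⟨ht0, by linarith⟩
  have hnear : ∀ᶠ τ in 𝓝[Ici 0] t, τ ∈ Icc 0 (t + 1) := by
    filter_upwards [self_mem_nhdsWithin,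
      nhdsWithin_le_nhds (Iio_mem_nhds (lt_add_one t))] with τ h1 h2
    exact ⟨h1, le_of_lt h2⟩
  have key : Tendsto (fun τ : ℝ => ∑' p : Fin m × ℕ, (1 + ‖ev p.1 p.2‖ ^ (2 * s)) *
      ‖(Complex.exp (ν p * τ) - Complex.exp (ν p * t)) * ⟪φ p, a⟫_ℂ‖ ^ 2) (𝓝[Ici 0] t)
      (𝓝 (∑' _ : Fin m × ℕ, 0)) := by
    refine tendsto_tsum_of_dominated_convergence
      (bound := fun p => (E + E) ^ 2 * ((1 + ‖ev p.1 p.2‖ ^ (2 * s)) * ‖⟪φ p, a⟫_ℂ‖ ^ 2))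
      ((hasSum_powNorm_sq φ ha).summable.mul_left _) (fun p => ?_) ?_
    · have hc : Continuous fun τ : ℝ => (1 + ‖ev p.1 p.2‖ ^ (2 * s)) *
        ‖(Complex.exp (ν p * τ) - Complex.exp (ν p * t)) * ⟪φ p, a⟫_ℂ‖ ^ 2 := by fun_prop
      simpa using (hc.tendsto t).mono_left nhdsWithin_le_nhds
    · filter_upwards [hnear] with τ hτ p
      rw [Real.norm_of_nonneg (by positivity), norm_mul, mul_pow, mul_left_comm]
      gcongr
      exact (norm_sub_le _ _).trans (add_le_add (hexp τ hτ p) (hexp t ht1 p))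
  rw [tsum_zero] at key
  have key2 := (Real.continuous_sqrt.tendsto 0).comp key
  rw [Real.sqrt_zero] at key2
  refine key2.congr' ?_
  filter_upwards [hnear] with τ hτ
  have h1 := hasSum_powNorm_sq φ (sub_mem_powDomain φ (hmem τ hτ.1) (hmem t ht))
  simp only [inner_sub_right, inner_expFlow φ hν hτ.1, inner_expFlow φ hν ht0, ← sub_mul] at h1
  rw [Function.comp_apply, h1.tsum_eq, Real.sqrt_sq (powNorm_nonneg φ _)]

lemma mem_powDomain_zero (f : H) : f ∈ powDomain φ ev 0 := by
  have := (hasSum_norm_inner_sq φ f).summable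
  simpa [powDomain] using this

lemma ContinuousOnPow.continuousOn {y : ℝ → H} {I : Set ℝ} (h : ContinuousOnPow φ ev s y I) :
    ContinuousOn y I := fun t ht =>
  tendsto_iff_norm_sub_tendsto_zero.2 (squeeze_zero (fun _ => norm_nonneg _)
    (fun τ => norm_le_powNorm φ (y τ - y t)) (h t ht).2)

lemma ContinuousOnPow.mono {y : ℝ → H} {I J : Set ℝ} (h : ContinuousOnPow φ ev s y I)
    (hJ : J ⊆ I) : ContinuousOnPow φ ev s y J := fun t ht =>
  ⟨(h t (hJ ht)).1, (h t (hJ ht)).2.mono_left (nhdsWithin_mono t hJ)⟩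

lemma ContinuousOnPow.congr {y z : ℝ → H} {I : Set ℝ} (h : ContinuousOnPow φ ev s y I)
    (hz : EqOn z y I) : ContinuousOnPow φ ev s z I := fun t ht => by
  rw [hz ht]
  refine ⟨(h t ht).1, (h t ht).2.congr' ?_⟩
  filter_upwards [self_mem_nhdsWithin] with τ hτ
  rw [hz hτ]

lemma ContinuousOnPow.union {y : ℝ → H} {I J : Set ℝ} (hI : ContinuousOnPow φ ev s y I)
    (hJ : ContinuousOnPow φ ev s y J) (hIc : IsClosed I) (hJc : IsClosed J) :
    ContinuousOnPow φ ev s y (I ∪ J) := by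
  have key : ∀ {I : Set ℝ}, ContinuousOnPow φ ev s y I → IsClosed I → ∀ t,
      Tendsto (fun τ => powNorm φ ev s (y τ - y t)) (𝓝[I] t) (𝓝 0) := fun {I} h hc t => by
    by_cases ht : t ∈ I
    · exact (h t ht).2
    · have : 𝓝[I] t = ⊥ := by
        rwa [← notMem_closure_iff_nhdsWithin_eq_bot, hc.closure_eq]
      rw [this]
      exact tendsto_bot
  intro t ht
  refine ⟨ht.elim (fun h => (hI t h).1) (fun h => (hJ t h).1), ?_⟩
  rw [nhdsWithin_union]
  exact tendsto_sup.2 ⟨key hI hIc t, key hJ hJc t⟩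

end FlowPow

/-! ### The scalar integral equation -/

section ScalarEquation

/-- The continuous solutions of `u(t) - u(a) = z ∫_a^t u` are exponentials. -/
lemma eq_exp_mul_of_sub_eq_integral {u : ℝ → ℂ} {a b : ℝ} {z : ℂ} (hab : a ≤ b)
    (hu : ContinuousOn u (Icc a b))
    (h : ∀ t ∈ Icc a b, u t - u a = z * ∫ τ in a..t, u τ) :
    ∀ t ∈ Icc a b, u t = Complex.exp (z * ↑(t - a)) * u a := by
  set v : ℝ → ℂ := IccExtend hab ((Icc a b).domRestrict u) with hv
  have hvc : Continuous v := (continuousOn_iff_continuous_domRestrict.1 hu).Icc_extend'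
  have hvu : EqOn v u (Icc a b) := fun t ht => by
    rw [hv, IccExtend_of_mem _ _ ht, domRestrict_apply]
  set F : ℝ → ℂ := fun t => u a + z * ∫ τ in a..t, v τ with hF
  have hFu : EqOn F u (Icc a b) := fun t ht => by
    have e : ∫ τ in a..t, v τ = ∫ τ in a..t, u τ := intervalIntegral.integral_congr fun τ hτ => by
      rw [uIcc_of_le ht.1] at hτ
      exact hvu ⟨hτ.1, hτ.2.trans ht.2⟩
    rw [hF]
    dsimp only
    rw [e, ← h t ht, add_sub_cancel]
  have hFd : ∀ t, HasDerivAt F (z * v t) t := fun t =>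
    ((hvc.integral_hasStrictDerivAt a t).hasDerivAt.const_mul z).const_add (u a)
  have hed : ∀ t : ℝ, HasDerivAt (fun t : ℝ => Complex.exp (-(z * t)))
      (Complex.exp (-(z * t)) * -z) t := fun t => by
    have h3 : HasDerivAt (fun t : ℝ => -(z * (t : ℂ))) (-z) t := by
      have := ((Complex.ofRealCLM.hasDerivAt (x := t)).const_mul z).neg
      simp only [Complex.ofRealCLM_apply, Complex.ofReal_one, mul_one] at this
      exact this
    exact h3.cexp
  have hd : ∀ t : ℝ, HasDerivAt (fun t : ℝ => Complex.exp (-(z * t)) * F t)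
      (Complex.exp (-(z * t)) * -z * F t + Complex.exp (-(z * t)) * (z * v t)) t := fun t =>
    (hed t).mul (hFd t)
  have hconst := constant_of_has_deriv_right_zero (a := a) (b := b)
    (f := fun t : ℝ => Complex.exp (-(z * t)) * F t)
    (fun t _ => (hd t).continuousAt.continuousWithinAt) (fun t ht => by
      have h1 : v t = F t := by
        have ht' : t ∈ Icc a b := ⟨ht.1, ht.2.le⟩
        rw [hvu ht', hFu ht']
      refine ((hd t).congr_deriv ?_).hasDerivWithinAt
      rw [h1]; ring)
  intro t ht
  have h1 := hconst t ht
  rw [hFu ht, hFu (left_mem_Icc.2 hab)] at h1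
  calc u t = Complex.exp (z * t) * (Complex.exp (-(z * t)) * u t) := by
        rw [← mul_assoc, ← Complex.exp_add, add_neg_cancel, Complex.exp_zero, one_mul]
    _ = _ := by
        rw [h1, ← mul_assoc, ← Complex.exp_add]
        push_cast
        ring_nf

end ScalarEquation

/-! ### Diagonalization of the closed loop -/

section Diagonalization

variable {H : Type*} [NormedAddCommGroup H] [InnerProductSpace ℂ H] {m : ℕ}

/-- The block-diagonal resolvent kernel `1 / (μ_q - lam - μ_p)`. -/
noncomputable def resKernel (ev : Fin m → ℕ → ℂ) (lam : ℝ) (p q : Fin m × ℕ) : ℂ :=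
  if p.1 = q.1 then (ev q.1 q.2 - lam - ev p.1 p.2)⁻¹ else 0

/-- `Ψ` and `R` diagonalize the closed loop `A + B K`: the columns of `Ψ` are the eigenvectors
`b_p / (μ_q - lam - μ_p)`, with eigenvalue `μ_q - lam`, the rows of `R` are the dual eigenvectors
scaled by `ρ`, and `Ψ R = 1`. -/
structure IsDiagonalization (φ : HilbertBasis (Fin m × ℕ) ℂ H) (ev : Fin m → ℕ → ℂ) (α : ℝ)
    (b : Fin m × ℕ → ℂ) (k : Fin m → ℕ → ℂ) (ρ : Fin m × ℕ → ℂ) (lam : ℝ)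
    (Ψ R : H →L[ℂ] H) : Prop where
  synthesis : ∀ f p, HasSum (fun q => b p * resKernel ev lam p q * ⟪φ q, f⟫_ℂ) ⟪φ p, Ψ f⟫_ℂ
  analysis : ∀ f p, HasSum (fun q => ρ p * resKernel ev lam q p * k q.1 q.2 * ⟪φ q, f⟫_ℂ)
    ⟪φ p, R f⟫_ℂ
  right_inverse : ∀ f, Ψ (R f) = f
  nonresonant : ∀ i p q, ev i q - lam - ev i p ≠ 0
  characteristic : ∀ i j, HasSum (fun n => k i n * b (i, n) * (ev i j - lam - ev i n)⁻¹) 1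
  kernel_le : ∃ Q : ℝ, 0 ≤ Q ∧ ∀ p q : Fin m × ℕ,
    ‖k p.1 p.2‖ * ‖b p * resKernel ev lam p q‖ ≤ Q * blockToep α p q

lemma hasSum_block_iff {f : Fin m × ℕ → ℂ} {a : ℂ} {i : Fin m} (h : ∀ q, i ≠ q.1 → f q = 0) :
    HasSum f a ↔ HasSum (fun n => f (i, n)) a := by
  have hinj : Function.Injective fun n : ℕ => (i, n) := fun a b h => (Prod.ext_iff.1 h).2
  refine (hinj.hasSum_iff fun q hq => h q fun hi => hq ⟨q.2, ?_⟩).symm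
  rw [hi]

lemma summable_snd {g : ℕ → ℝ} (hg : Summable g) (hg0 : ∀ n, 0 ≤ g n) :
    Summable fun p : Fin m × ℕ => g p.2 := by
  have h1 : Summable fun _ : Fin m => (1 : ℝ) := (hasSum_fintype _).summable
  simpa using h1.mul_of_nonneg hg (fun _ => zero_le_one) hg0

variable {φ : HilbertBasis (Fin m × ℕ) ℂ H} {ev : Fin m → ℕ → ℂ} {α c d : ℝ}
  {b : Fin m × ℕ → ℂ} {k : Fin m → ℕ → ℂ} {ρ : Fin m × ℕ → ℂ} {lam : ℝ} {Ψ R : H →L[ℂ] H}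

lemma norm_resKernel_le (hc : 0 < c) (hα : 0 < α) (hsep : ∀ i, Separated (ev i) c α)
    (hd : 0 < d) (hr : ∀ i p q, d ≤ ‖ev i p - ev i q - lam‖) (p q : Fin m × ℕ) :
    ‖resKernel ev lam p q‖ ≤
      2 ^ α * (1 + 1 / c) * (1 + (1 + |lam|) / d) * blockToep α p q := by
  unfold resKernel blockToep
  split_ifs with h
  · have := (hsep q.1).norm_resolvent_le hc hα hd (hr q.1) p.2 q.2
    rw [Complex.norm_real, Real.norm_eq_abs] at this
    rwa [h]
  · simp

/-- For a nonresonant shift the feedback gains diagonalize the closed loop. -/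
lemma exists_isDiagonalization [CompleteSpace H] (φ : HilbertBasis (Fin m × ℕ) ℂ H) (hα : 1 < α)
    (hc : 0 < c) (hsep : ∀ i, Separated (ev i) c α) (hd : 0 < d)
    (hr : ∀ i p q, d ≤ ‖ev i p - ev i q - lam‖) {cb Cb : ℝ} (hcb : 0 < cb)
    (hb : ∀ p, cb ≤ ‖b p‖ ∧ ‖b p‖ ≤ Cb) :
    ∃ Ψ R : H →L[ℂ] H, IsDiagonalization φ ev α b
      (fun i => gain (ev i) (fun n => b (i, n)) lam)
      (fun p => -lam * cauchyTProd (ev p.1) (-lam) p.2) lam Ψ R := by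
  have hα0 : 0 < α := by linarith
  set Q := 2 ^ α * (1 + 1 / c) * (1 + (1 + |lam|) / d) with hQ
  have hQ0 : 0 ≤ Q := by positivity
  have hres := norm_resKernel_le hc hα0 hsep hd hr
  set k : Fin m → ℕ → ℂ := fun i => gain (ev i) (fun n => b (i, n)) lam with hk
  set ρ : Fin m × ℕ → ℂ := fun p => -lam * cauchyTProd (ev p.1) (-lam) p.2 with hρ
  have hkb : ∀ i n, k i n = (b (i, n))⁻¹ * (-lam * cauchyTProd (ev i) lam n) := fun i n =>
    gain_eq (hsep i) hc hα hd (hr i) _ n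
  have hb0 : ∀ p, b p ≠ 0 := fun p => norm_pos_iff.1 (hcb.trans_le (hb p).1)
  obtain ⟨K, hK, hKb⟩ := exists_norm_cauchyProd_le (β := 1) hc hα
    (by rw [div_lt_one hα0]; exact hα) le_rfl
  set E := Real.exp (K * |lam| ^ (1 : ℝ)) with hE
  have hP : ∀ i n, ‖cauchyTProd (ev i) lam n‖ ≤ E := fun i n =>
    norm_cauchyTProd_le (hsep i) hc hα fun s => by
      simpa [hE] using hKb (ev i) (hsep i) lam s n
  have hP' : ∀ i n, ‖cauchyTProd (ev i) (-lam) n‖ ≤ E := fun i n =>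
    norm_cauchyTProd_le (hsep i) hc hα fun s => by
      simpa [hE] using hKb (ev i) (hsep i) (-lam) s n
  have hkn : ∀ i n, ‖k i n‖ ≤ cb⁻¹ * (|lam| * E) := fun i n => by
    rw [hkb, norm_mul, norm_mul, norm_neg, norm_inv, Complex.norm_real, Real.norm_eq_abs]
    gcongr
    · exact (hb _).1
    · exact hP i n
  have hρn : ∀ p, ‖ρ p‖ ≤ |lam| * E := fun p => by
    rw [hρ, norm_mul, norm_neg, Complex.norm_real, Real.norm_eq_abs]
    gcongr
    exact hP' _ _
  have hCb : ∀ p : Fin m × ℕ, 0 ≤ Cb := fun p => (norm_nonneg _).trans (hb p).2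
  obtain ⟨Ψ, hΨ⟩ := exists_clm_of_kernel φ hα (K := fun p q => b p * resKernel ev lam p q)
    (Q := Cb * Q) fun p q => by
      have := hCb p
      rw [norm_mul, mul_assoc]
      exact mul_le_mul (hb p).2 (hres p q) (norm_nonneg _) this
  obtain ⟨R, hR⟩ := exists_clm_of_kernel φ hα
    (K := fun p q => ρ p * resKernel ev lam q p * k q.1 q.2)
    (Q := |lam| * E * Q * (cb⁻¹ * (|lam| * E))) fun p q => by
      rw [norm_mul, norm_mul]
      calc _ ≤ |lam| * E * (Q * blockToep α q p) * (cb⁻¹ * (|lam| * E)) := by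
            have := blockToep_nonneg α q p
            gcongr
            · exact hρn p
            · exact hres q p
            · exact hkn _ _
        _ = _ := by rw [blockToep_comm]; ring
  refine ⟨Ψ, R, hΨ, hR, fun f => ?_, fun i p q h => ?_, fun i j => ?_,
    cb⁻¹ * (|lam| * E) * (Cb * Q) ⊔ 0, le_max_right _ _, fun p q => ?_⟩
  · have hRφ : ∀ l q, ⟪φ q, R (φ l)⟫_ℂ = ρ q * resKernel ev lam l q * k l.1 l.2 := fun l q => by
      refine (hR (φ l) q).unique ?_
      convert hasSum_single l ?_ using 1
      · rw [inner_self_eq_norm_sq_to_K, φ.orthonormal.1]; simp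
      · intro q' hq'
        rw [φ.orthonormal.2 hq', mul_zero]
    -- On the basis, `Ψ R = 1` is the inversion of the Cauchy matrix.
    have hbasis : ∀ l, Ψ (R (φ l)) = φ l := fun l => eq_of_inner_eq φ fun p => by
      refine (hΨ (R (φ l)) p).unique ?_
      by_cases hpl : p.1 = l.1
      · rw [hasSum_block_iff (i := l.1) fun q hq => by
          rw [hRφ, resKernel, resKernel, if_neg hq]; simp]
        have h1 := (hasSum_cauchyTProd_mul_inv_mul_inv (hsep l.1) hc hα hd (hr l.1) p.2 l.2).mul_left
          (b p * (b l)⁻¹)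
        have h2 : b p * (b l)⁻¹ * (if p.2 = l.2 then 1 else 0) = ⟪φ p, φ l⟫_ℂ := by
          by_cases h3 : p = l
          · rw [h3, inner_self_eq_norm_sq_to_K, φ.orthonormal.1]
            simp [hb0 l]
          · rw [φ.orthonormal.2 h3, if_neg fun h4 => h3 (Prod.ext hpl h4), mul_zero]
        rw [h2] at h1
        refine h1.congr_fun fun j => ?_
        have e1 : ∀ n, (ev l.1 j - lam - ev l.1 n)⁻¹ = -(ev l.1 n + lam - ev l.1 j)⁻¹ := fun n => by
          rw [← inv_neg]; ring_nf
        rw [hRφ, hkb]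
        simp only [resKernel, hpl, if_true, hρ, e1]
        ring
      · rw [φ.orthonormal.2 fun h => hpl (congrArg Prod.fst h)]
        refine hasSum_zero.congr_fun fun q => ?_
        rw [hRφ]
        by_cases hq : p.1 = q.1
        · rw [resKernel, resKernel, if_neg fun h : l.1 = q.1 => hpl (hq.trans h.symm)]
          simp
        · rw [resKernel, if_neg hq]
          simp
    have h1 := ((φ.hasSum_repr f).mapL (Ψ.comp R))
    have h2 := φ.hasSum_repr f
    simp only [map_smul, ContinuousLinearMap.comp_apply, hbasis] at h1
    exact h1.unique h2
  · have := hr i q p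
    rw [show ev i q - ev i p - lam = ev i q - lam - ev i p by ring, h, norm_zero] at this
    linarith
  · refine (hasSum_cauchyTProd_characteristic (hsep i) hc hα hd (hr i) j).congr_fun fun n => ?_
    rw [hkb]
    field_simp [hb0 (i, n)]
  · have hT := blockToep_nonneg α p q
    calc ‖k p.1 p.2‖ * ‖b p * resKernel ev lam p q‖
        ≤ cb⁻¹ * (|lam| * E) * (Cb * (Q * blockToep α p q)) := by
          rw [norm_mul]
          have := hCb p
          gcongr
          · exact hkn _ _
          · exact (hb p).2
          · exact hres p q
      _ = cb⁻¹ * (|lam| * E) * (Cb * Q) * blockToep α p q := by ring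
      _ ≤ _ := by gcongr; exact le_max_left _ _

end Diagonalization

/-! ### Similarity of the closed loop to a diagonal operator -/

section ClosedLoop

variable {H : Type*} [NormedAddCommGroup H] [InnerProductSpace ℂ H] {m : ℕ}
  {φ : HilbertBasis (Fin m × ℕ) ℂ H} {ev : Fin m → ℕ → ℂ} {α G : ℝ}
  {b : Fin m × ℕ → ℂ} {k : Fin m → ℕ → ℂ} {ρ : Fin m × ℕ → ℂ} {lam : ℝ} {Ψ R : H →L[ℂ] H}

/-- Vectors in the domain of the shifted diagonal operator have absolutely summable coordinates,
because `∑ n^(-2α) < ∞`. -/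
lemma GrowsLike.summable_norm_inner (hG : 0 ≤ G) (h : GrowsLike ev α G) (hα : 1 < α) (lam : ℝ)
    {f g : H} (hfg : ∀ p : Fin m × ℕ, ⟪φ p, g⟫_ℂ = (ev p.1 p.2 - lam) * ⟪φ p, f⟫_ℂ) :
    Summable fun p => ‖⟪φ p, f⟫_ℂ‖ := by
  set c := G * (1 + |lam|) with hc
  have hs : Summable fun p : Fin m × ℕ => c ^ 2 * ((p.2 : ℝ) + 1) ^ (-(2 * α)) :=
    (summable_snd (summable_one_add_rpow (by linarith)) fun n => by positivity).mul_left _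
  refine Summable.of_nonneg_of_le (fun p => norm_nonneg _) (fun p => ?_)
    (hs.add (((hasSum_norm_inner_sq φ f).summable.mul_left 2).add
      ((hasSum_norm_inner_sq φ g).summable.mul_left 2)))
  set x := ‖⟪φ p, f⟫_ℂ‖ with hx
  set y := ‖ev p.1 p.2 - lam‖ with hy
  have hx0 : 0 ≤ x := norm_nonneg _
  have hy0 : 0 ≤ y := norm_nonneg _
  have e1 : ‖⟪φ p, g⟫_ℂ‖ = y * x := by rw [hfg, norm_mul]
  rw [e1]
  have hp : (0 : ℝ) < p.2 + 1 := by positivity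
  set r := ((p.2 : ℝ) + 1) ^ (-α) with hr
  have hr0 : 0 < r := by positivity
  have e2 : ((p.2 : ℝ) + 1) ^ (-(2 * α)) = r ^ 2 := by
    rw [hr, ← Real.rpow_natCast, ← Real.rpow_mul hp.le]; ring_nf
  have h1 : 1 ≤ c * (1 + y) * r := by
    have h2 : ‖ev p.1 p.2‖ ≤ y + |lam| := by
      have := norm_add_le (ev p.1 p.2 - lam) lam
      rwa [sub_add_cancel, Complex.norm_real, Real.norm_eq_abs] at this
    have h3 : ((p.2 : ℝ) + 1) ^ α ≤ c * (1 + y) := by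
      refine (h p.1 p.2).1.trans ?_
      rw [hc, mul_assoc]
      gcongr
      nlinarith [abs_nonneg lam]
    calc (1 : ℝ) = ((p.2 : ℝ) + 1) ^ α * r := by rw [hr, ← Real.rpow_add hp]; simp
      _ ≤ _ := by gcongr
  have h2 : x ≤ (c * r) * ((1 + y) * x) := by
    calc x = 1 * x := (one_mul x).symm
      _ ≤ (c * (1 + y) * r) * x := by gcongr
      _ = _ := by ring
  rw [e2]
  nlinarith [sq_nonneg (c * r - (1 + y) * x), sq_nonneg (x - y * x)]

lemma summable_toep_mul (hα : 1 < α) {g : ℕ → ℝ} (hg : Summable g) (hg0 : ∀ n, 0 ≤ g n) :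
    Summable fun x : ℕ × ℕ => toep α x.1 x.2 * g x.2 := by
  obtain ⟨C, hC, hCs⟩ := exists_tsum_toep_le hα
  rw [← (Equiv.prodComm ℕ ℕ).summable_iff]
  refine (summable_prod_of_nonneg fun x => mul_nonneg (toep_pos _ _ _).le (hg0 _)).2
    ⟨fun j => ?_, ?_⟩
  · refine ((summable_toep hα j).mul_right (g j)).congr fun n => ?_
    simp [toep_comm]
  · refine Summable.of_nonneg_of_le (fun j => tsum_nonneg fun n =>
      mul_nonneg (toep_pos _ _ _).le (hg0 _)) (fun j => ?_) (hg.mul_left C)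
    have : ∑' n, toep α n j * g j = (∑' n, toep α j n) * g j := by
      rw [tsum_mul_right]; simp only [toep_comm]
    refine le_trans (le_of_eq this) ?_
    exact mul_le_mul_of_nonneg_right (hCs j) (hg0 j)

/-- `A + B K` acts on `Ψ f` as the diagonal operator with entries `μ_p - lam` acts on `f`. -/
lemma IsDiagonalization.closedLoop_synthesis (D : IsDiagonalization φ ev α b k ρ lam Ψ R)
    (hG : 0 ≤ G) (h : GrowsLike ev α G) (hα : 1 < α) {f g : H}
    (hfg : ∀ p : Fin m × ℕ, ⟪φ p, g⟫_ℂ = (ev p.1 p.2 - lam) * ⟪φ p, f⟫_ℂ) :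
    ∃ hf : Ψ f ∈ (diagFunctional φ k).domain, ∀ p : Fin m × ℕ, ⟪φ p, Ψ g⟫_ℂ =
      ev p.1 p.2 * ⟪φ p, Ψ f⟫_ℂ + b p * diagFunctional φ k ⟨Ψ f, hf⟩ p.1 := by
  obtain ⟨Q, hQ, hker⟩ := D.kernel_le
  have hl1 := h.summable_norm_inner hG hα lam hfg
  have hrow : ∀ (f : H) i n, HasSum (fun j => b (i, n) * (ev i j - lam - ev i n)⁻¹ *
      ⟪φ (i, j), f⟫_ℂ) ⟪φ (i, n), Ψ f⟫_ℂ := fun f i n => by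
    have h1 := D.synthesis f (i, n)
    rw [hasSum_block_iff (i := i) fun q hq => by rw [resKernel, if_neg hq]; simp] at h1
    simpa [resKernel] using h1
  have hdouble : ∀ i, Summable fun x : ℕ × ℕ => k i x.1 * (b (i, x.1) *
      (ev i x.2 - lam - ev i x.1)⁻¹ * ⟪φ (i, x.2), f⟫_ℂ) := fun i => by
    have hinj : Function.Injective fun n : ℕ => (i, n) := fun a b h => (Prod.ext_iff.1 h).2
    have h2 := (summable_toep_mul hα (g := fun j => ‖⟪φ (i, j), f⟫_ℂ‖)
      (hl1.comp_injective hinj) fun n => norm_nonneg _).mul_left Q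
    refine Summable.of_norm_bounded h2 fun x => ?_
    have h3 := hker (i, x.1) (i, x.2)
    simp only [resKernel, blockToep, if_true] at h3
    rw [norm_mul, norm_mul (_ * _), ← mul_assoc, ← mul_assoc]
    exact mul_le_mul_of_nonneg_right h3 (norm_nonneg ⟪φ (i, x.2), f⟫_ℂ)
  -- Interchanging the two summations, the characteristic equation shows that the control of `Ψ f` in
  -- block `i` is the sum of the coordinates of `f` in that block.
  have hK : ∀ i, HasSum (fun n => k i n * ⟪φ (i, n), Ψ f⟫_ℂ) (∑' j, ⟪φ (i, j), f⟫_ℂ) := fun i => by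
    have h1 := (hdouble i).hasSum.prod_fiberwise fun n => (hrow f i n).mul_left (k i n)
    have h2 := ((Equiv.prodComm ℕ ℕ).hasSum_iff.2 (hdouble i).hasSum).prod_fiberwise
      (g := fun j => ⟪φ (i, j), f⟫_ℂ) fun j => by
        have h3 := (D.characteristic i j).mul_right ⟪φ (i, j), f⟫_ℂ
        rw [one_mul] at h3
        refine h3.congr_fun fun n => ?_
        simp only [Function.comp_apply, Equiv.prodComm_apply, Prod.swap_prod_mk]
        ring
    rwa [← h2.tsum_eq] at h1
  refine ⟨fun i => (hK i).summable, fun ⟨i, n⟩ => ?_⟩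
  have e1 : diagFunctional φ k ⟨Ψ f, fun i => (hK i).summable⟩ i = ∑' j, ⟪φ (i, j), f⟫_ℂ :=
    (hK i).tsum_eq
  have hs : HasSum (fun j => ⟪φ (i, j), f⟫_ℂ) (∑' j, ⟪φ (i, j), f⟫_ℂ) := by
    have hinj : Function.Injective fun n : ℕ => (i, n) := fun a b h => (Prod.ext_iff.1 h).2
    exact (hl1.of_norm.comp_injective hinj).hasSum
  dsimp only
  rw [e1]
  refine (hrow g i n).unique ((((hrow f i n).mul_left (ev i n)).add
    (hs.mul_left (b (i, n)))).congr_fun fun j => ?_)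
  have h0 := D.nonresonant i n j
  rw [hfg]
  field_simp
  ring

/-- The rows of `R` are left eigenvectors of the closed loop. -/
lemma IsDiagonalization.analysis_closedLoop (D : IsDiagonalization φ ev α b k ρ lam Ψ R)
    {f g : H} (hf : f ∈ (diagFunctional φ k).domain)
    (hfg : ∀ p : Fin m × ℕ, ⟪φ p, g⟫_ℂ =
      ev p.1 p.2 * ⟪φ p, f⟫_ℂ + b p * diagFunctional φ k ⟨f, hf⟩ p.1) (p : Fin m × ℕ) :
    ⟪φ p, R g⟫_ℂ = (ev p.1 p.2 - lam) * ⟪φ p, R f⟫_ℂ := by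
  obtain ⟨i, j⟩ := p
  have hrow : ∀ f : H, HasSum (fun n => ρ (i, j) * (ev i j - lam - ev i n)⁻¹ * k i n *
      ⟪φ (i, n), f⟫_ℂ) ⟪φ (i, j), R f⟫_ℂ := fun f => by
    have h1 := D.analysis f (i, j)
    rw [hasSum_block_iff (i := i) fun q hq => by rw [resKernel, if_neg fun h => hq h.symm]; simp]
      at h1
    simpa [resKernel] using h1
  set u := diagFunctional φ k ⟨f, hf⟩ i with hu
  have hus : HasSum (fun n => k i n * ⟪φ (i, n), f⟫_ℂ) u := (hf i).hasSum
  have h2 := (((hrow f).mul_left (ev i j - lam)).sub (hus.mul_left (ρ (i, j)))).add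
    ((D.characteristic i j).mul_left (ρ (i, j) * u))
  have e : (ev i j - lam) * ⟪φ (i, j), R f⟫_ℂ - ρ (i, j) * u + ρ (i, j) * u * 1 =
      (ev i j - lam) * ⟪φ (i, j), R f⟫_ℂ := by ring
  rw [e] at h2
  refine (hrow g).unique (h2.congr_fun fun n => ?_)
  have h0 := D.nonresonant i n j
  rw [hfg]
  field_simp
  ring

end ClosedLoop

/-! ### The closed-loop semigroup -/

section Evolution

variable {H : Type*} [NormedAddCommGroup H] [InnerProductSpace ℂ H] {m : ℕ}
  {φ : HilbertBasis (Fin m × ℕ) ℂ H} {ev : Fin m → ℕ → ℂ} {α G w s : ℝ}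
  {b : Fin m × ℕ → ℂ} {k : Fin m → ℕ → ℂ} {ρ : Fin m × ℕ → ℂ} {lam : ℝ} {Ψ R : H →L[ℂ] H}

/-- The closed-loop semigroup `Ψ exp(t (μ - lam)) R`. -/
noncomputable def loopFlow (φ : HilbertBasis (Fin m × ℕ) ℂ H) (ev : Fin m → ℕ → ℂ) (lam : ℝ)
    (Ψ R : H →L[ℂ] H) (t : ℝ) (f : H) : H :=
  Ψ (expFlow φ (fun p => ev p.1 p.2 - lam) t (R f))

lemma IsDiagonalization.loopFlow_zero (D : IsDiagonalization φ ev α b k ρ lam Ψ R) (f : H) :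
    loopFlow φ ev lam Ψ R 0 f = f := by
  rw [loopFlow, expFlow_zero, D.right_inverse]

lemma re_sub_le (hw : ∀ p : Fin m × ℕ, (ev p.1 p.2).re ≤ w) (lam : ℝ) (p : Fin m × ℕ) :
    (ev p.1 p.2 - lam).re ≤ w - lam := by
  simpa using hw p

lemma integral_expFlow_eq [CompleteSpace H] {ν : Fin m × ℕ → ℂ} (hν : ∀ p, (ν p).re ≤ w) (a : H)
    {t₀ t₁ : ℝ} (h0 : 0 ≤ t₀) (h1 : t₀ ≤ t₁) (p : Fin m × ℕ) :
    ⟪φ p, expFlow φ ν t₁ a - expFlow φ ν t₀ a⟫_ℂ =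
      ν p * ⟪φ p, ∫ τ in t₀..t₁, expFlow φ ν τ a⟫_ℂ := by
  have hc : ContinuousOn (fun t => expFlow φ ν t a) (Ici 0) :=
    (continuousOnPow_expFlow φ (ev := fun _ _ => 0) hν (mem_powDomain_zero φ a)).continuousOn φ
  have hsub : uIcc t₀ t₁ ⊆ Ici 0 := by
    rw [uIcc_of_le h1]
    exact fun t ht => h0.trans ht.1
  have hint : IntervalIntegrable (fun t => expFlow φ ν t a) MeasureTheory.volume t₀ t₁ :=
    (hc.mono hsub).intervalIntegrable
  have e1 := (innerSL ℂ (φ p)).intervalIntegral_comp_comm hint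
  simp only [innerSL_apply_apply] at e1
  rw [← e1, ← intervalIntegral.integral_const_mul, inner_sub_right, inner_expFlow φ hν h0,
    inner_expFlow φ hν (h0.trans h1)]
  have hd : ∀ t : ℝ, HasDerivAt (fun t : ℝ => Complex.exp (ν p * t) * ⟪φ p, a⟫_ℂ)
      (ν p * (Complex.exp (ν p * t) * ⟪φ p, a⟫_ℂ)) t := fun t => by
    have h3 : HasDerivAt (fun t : ℝ => ν p * (t : ℂ)) (ν p) t := by
      have := (Complex.ofRealCLM.hasDerivAt (x := t)).const_mul (ν p)
      simpa only [Complex.ofRealCLM_apply, Complex.ofReal_one, mul_one] using this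
    exact (h3.cexp.mul_const _).congr_deriv (by ring)
  rw [← intervalIntegral.integral_eq_sub_of_hasDerivAt (fun t _ => hd t)
    (Continuous.intervalIntegrable (by fun_prop) _ _)]
  refine intervalIntegral.integral_congr fun t ht => ?_
  rw [inner_expFlow φ hν (hsub ht)]

variable [CompleteSpace H] {A : H →ₗ.[ℂ] H} {B : EuclideanSpace ℂ (Fin m) →L[ℂ] DualAdj A}

/-- The orbits of the closed-loop semigroup are mild solutions. -/
lemma IsDiagonalization.closedLoopApply_loopFlow (hF : Framework A B φ ev α)
    (D : IsDiagonalization φ ev α (fun p => controlCoeff B p.1 (φ p)) k ρ lam Ψ R)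
    (hG : 0 ≤ G) (h : GrowsLike ev α G) (hw : ∀ p : Fin m × ℕ, (ev p.1 p.2).re ≤ w) (f : H)
    {t₀ t₁ : ℝ} (h0 : 0 ≤ t₀) (h1 : t₀ ≤ t₁) :
    ClosedLoopApply A B (diagFunctional φ k) (∫ τ in t₀..t₁, loopFlow φ ev lam Ψ R τ f)
      (loopFlow φ ev lam Ψ R t₁ f - loopFlow φ ev lam Ψ R t₀ f) := by
  have hν := re_sub_le hw lam
  have hc : ContinuousOn (fun t => expFlow φ (fun p => ev p.1 p.2 - lam) t (R f)) (uIcc t₀ t₁) :=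
    ((continuousOnPow_expFlow φ (ev := ev) hν
      (mem_powDomain_zero φ (R f))).continuousOn φ).mono (by
        rw [uIcc_of_le h1]
        exact fun t ht => h0.trans ht.1)
  have e1 := Ψ.intervalIntegral_comp_comm (hc.intervalIntegrable (μ := MeasureTheory.volume))
  simp only [loopFlow]
  rw [e1, ← map_sub, hF.closedLoopApply_iff]
  exact D.closedLoop_synthesis hG h hF.one_lt fun p => integral_expFlow_eq hν (R f) h0 h1 p

/-- A mild solution on an interval where the feedback is constant is an orbit of the closed-loop
semigroup. -/
lemma IsDiagonalization.eq_loopFlow (hF : Framework A B φ ev α)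
    (D : IsDiagonalization φ ev α (fun p => controlCoeff B p.1 (φ p)) k ρ lam Ψ R)
    (hw : ∀ p : Fin m × ℕ, (ev p.1 p.2).re ≤ w) {z : ℝ → H} {t₀ t₁ : ℝ} (h01 : t₀ ≤ t₁)
    (hz : ContinuousOn z (Icc t₀ t₁))
    (heq : ∀ t ∈ Icc t₀ t₁,
      ClosedLoopApply A B (diagFunctional φ k) (∫ τ in t₀..t, z τ) (z t - z t₀)) :
    ∀ t ∈ Icc t₀ t₁, z t = loopFlow φ ev lam Ψ R (t - t₀) (z t₀) := by
  intro t ht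
  -- In the coordinates `R z` the equation decouples into scalar ones.
  rw [← D.right_inverse (z t), loopFlow]
  congr 1
  refine eq_of_inner_eq φ fun p => ?_
  rw [inner_expFlow φ (re_sub_le hw lam) (sub_nonneg.2 ht.1)]
  refine eq_exp_mul_of_sub_eq_integral (u := fun t => ⟪φ p, R (z t)⟫_ℂ) h01 ?_ (fun r hr => ?_) t ht
  · exact (innerSL ℂ (φ p)).continuous.comp_continuousOn (R.continuous.comp_continuousOn hz)
  · obtain ⟨hf, hp⟩ := hF.closedLoopApply_iff.1 (heq r hr)
    have h1 := D.analysis_closedLoop hf hp p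
    have hint : IntervalIntegrable z MeasureTheory.volume t₀ r := by
      refine (hz.mono ?_).intervalIntegrable
      rw [uIcc_of_le hr.1]
      exact Icc_subset_Icc_right hr.2
    have e1 := ((innerSL ℂ (φ p)).comp R).intervalIntegral_comp_comm hint
    simp only [ContinuousLinearMap.comp_apply, innerSL_apply_apply] at e1
    rw [e1, ← h1, map_sub, inner_sub_right]

end Evolution

/-! ### Shifts far from the resonant set -/

section Nonresonant

/-- Pigeonhole: an interval of length one contains a point far from all points of a finite set. -/
lemma exists_far_from_finset (F : Finset ℝ) (x : ℝ) :
    ∃ y ∈ Icc x (x + 1), ∀ z ∈ F, 1 / (2 * ((F.card : ℝ) + 1)) ≤ |y - z| := by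
  by_contra! hcon
  set M : ℝ := (F.card : ℝ) + 1 with hM
  have hM0 : 0 < M := by positivity
  have hy : ∀ k ∈ Finset.range (F.card + 1), x + (2 * (k : ℝ) + 1) / (2 * M) ∈ Icc x (x + 1) := by
    intro k hk
    have hk' : (k : ℝ) + 1 ≤ M := by
      rw [hM]; exact_mod_cast Finset.mem_range.1 hk
    refine ⟨le_add_of_nonneg_right (by positivity), ?_⟩
    have : (2 * (k : ℝ) + 1) / (2 * M) ≤ 1 := by
      rw [div_le_one (by positivity)]; linarith
    linarith
  -- Two of the `card F + 1` midpoints of a subdivision into equal parts would be close to the same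
  -- point of `F`.
  choose! z hzF hz using hcon
  obtain ⟨k, hk, l, hl, hkl, he⟩ := Finset.exists_ne_map_eq_of_card_lt_of_maps_to
    (s := Finset.range (F.card + 1)) (t := F)
    (f := fun k : ℕ => z (x + (2 * (k : ℝ) + 1) / (2 * M))) (by simp)
    (fun k hk => hzF _ (hy k hk))
  have h1 := hz _ (hy k hk)
  have h2 := hz _ (hy l hl)
  rw [he] at h1
  have h3 := abs_sub_le (x + (2 * (k : ℝ) + 1) / (2 * M)) (z (x + (2 * (l : ℝ) + 1) / (2 * M)))
    (x + (2 * (l : ℝ) + 1) / (2 * M))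
  rw [abs_sub_comm (z _)] at h3
  have h4 : |x + (2 * (k : ℝ) + 1) / (2 * M) - (x + (2 * (l : ℝ) + 1) / (2 * M))| =
      |(k : ℝ) - l| / M := by
    rw [← abs_of_pos hM0, ← abs_div, abs_of_pos hM0]
    congr 1
    field_simp
    ring
  have h5 := one_le_abs_sub hkl
  have h6 : 1 / M ≤ |(k : ℝ) - l| / M := by gcongr
  have h7 : 1 / (2 * M) + 1 / (2 * M) = 1 / M := by field_simp; norm_num
  linarith

variable {m : ℕ} {ev : Fin m → ℕ → ℂ} {α c : ℝ}

/-- The shift `lam` is at distance at least `(Cd lam^κ)⁻¹` from the resonant set. -/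
def FarFromResonance (ev : Fin m → ℕ → ℂ) (Cd κ lam : ℝ) : Prop :=
  ∀ i p q, 1 ≤ Cd * lam ^ κ * ‖ev i p - ev i q - lam‖

/-- Every interval `[x, x + 1]`, `x ≥ 1`, contains a shift whose distance to the resonant set is at
least polynomially small: only polynomially many differences of eigenvalues are of size `x`. -/
lemma exists_farFromResonance (hα : 1 < α) (hc : 0 < c)
    (hg : ∀ i (k n : ℕ),
      c * ((k : ℝ) + 1) ^ (α - 1) * |(k : ℝ) - n| ≤ ‖ev i k - ev i n‖ ∧
      c * ((n : ℝ) + 1) ^ (α - 1) * |(k : ℝ) - n| ≤ ‖ev i k - ev i n‖) :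
    ∃ Cd κ : ℝ, 0 < Cd ∧ 0 ≤ κ ∧ ∀ x : ℝ, 1 ≤ x →
      ∃ lam ∈ Icc x (x + 1), FarFromResonance ev Cd κ lam := by
  set e := 1 / (α - 1) with he
  have hα1 : 0 < α - 1 := by linarith
  have he0 : 0 < e := by positivity
  set C₃ := (3 / c) ^ e + 1 with hC₃
  refine ⟨2 * (m * C₃ ^ 2 + 1), 2 * e, by positivity, by positivity, fun x hx => ?_⟩
  -- Nonzero differences of modulus at most `x + 2` only involve indices below `N`; the others are at
  -- distance at least `1` from `[x, x + 1]`.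
  set N := ⌈((x + 2) / c) ^ e⌉₊ with hN
  set F : Finset ℝ := ((Finset.univ : Finset (Fin m)) ×ˢ (Finset.range N ×ˢ Finset.range N)).image
    fun t => (ev t.1 t.2.1 - ev t.1 t.2.2).re with hF
  obtain ⟨y, hy, hyF⟩ := exists_far_from_finset F x
  have hx0 : 0 < x := by linarith
  have hcard : (F.card : ℝ) ≤ m * N ^ 2 := by
    have h1 : F.card ≤ m * (N * N) := by
      refine Finset.card_image_le.trans ?_
      simp [Finset.card_product]
    calc (F.card : ℝ) ≤ ((m * (N * N) : ℕ) : ℝ) := by exact_mod_cast h1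
      _ = _ := by push_cast; ring
  have hNle : (N : ℝ) ≤ C₃ * y ^ e := by
    have h1 : ((x + 2) / c) ^ e ≤ (3 / c) ^ e * x ^ e := by
      rw [← Real.mul_rpow (by positivity) hx0.le]
      gcongr
      rw [div_mul_eq_mul_div]
      gcongr
      linarith
    have h2 : (N : ℝ) ≤ ((x + 2) / c) ^ e + 1 := (Nat.ceil_lt_add_one (by positivity)).le
    have h3 : 1 ≤ x ^ e := Real.one_le_rpow hx he0.le
    have h4 : (N : ℝ) ≤ C₃ * x ^ e := by rw [hC₃]; nlinarith
    exact h4.trans (by gcongr; exact hy.1)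
  have hfac : 2 * ((F.card : ℝ) + 1) ≤ 2 * (m * C₃ ^ 2 + 1) * y ^ (2 * e) := by
    have hy1 : 1 ≤ y := hx.trans hy.1
    have h1 : 1 ≤ y ^ (2 * e) := Real.one_le_rpow hy1 (by positivity)
    have h2 : (C₃ * y ^ e) ^ 2 = C₃ ^ 2 * y ^ (2 * e) := by
      rw [mul_pow, ← Real.rpow_natCast (y ^ e), ← Real.rpow_mul (by linarith)]
      ring_nf
    calc 2 * ((F.card : ℝ) + 1) ≤ 2 * (m * (C₃ * y ^ e) ^ 2 + 1 * 1) := by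
          rw [one_mul]
          gcongr
          exact hcard.trans (by gcongr)
      _ ≤ 2 * (m * (C₃ ^ 2 * y ^ (2 * e)) + 1 * y ^ (2 * e)) := by rw [h2]; gcongr
      _ = _ := by ring
  refine ⟨y, hy, fun i p q => ?_⟩
  have hge1 : 1 ≤ ‖ev i p - ev i q - y‖ → 1 ≤ 2 * (m * C₃ ^ 2 + 1) * y ^ (2 * e) *
      ‖ev i p - ev i q - y‖ := fun h => by
    have h1 : (1 : ℝ) ≤ 2 * (m * C₃ ^ 2 + 1) * y ^ (2 * e) := by
      refine le_trans ?_ hfac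
      have : (0 : ℝ) ≤ F.card := Nat.cast_nonneg _
      linarith
    nlinarith
  by_cases hpq : p = q
  · refine hge1 ?_
    rw [hpq, sub_self, zero_sub, norm_neg, Complex.norm_real]
    exact (hx.trans hy.1).trans (le_abs_self y)
  by_cases hbig : x + 2 < ‖ev i p - ev i q‖
  · refine hge1 ?_
    have h1 := norm_sub_norm_le (ev i p - ev i q) y
    rw [Complex.norm_real, Real.norm_of_nonneg (by linarith [hy.1])] at h1
    linarith [hy.2]
  · have hidx : ∀ r : ℕ, c * ((r : ℝ) + 1) ^ (α - 1) * |(p : ℝ) - q| ≤ ‖ev i p - ev i q‖ →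
        r < N := fun r hr => by
      have h1 : ((r : ℝ) + 1) ^ (α - 1) ≤ (x + 2) / c := by
        rw [le_div_iff₀ hc]
        have h2 := one_le_abs_sub hpq
        have h3 : 0 ≤ c * ((r : ℝ) + 1) ^ (α - 1) := by positivity
        nlinarith
      have h2 : (r : ℝ) + 1 ≤ ((x + 2) / c) ^ e := by
        calc (r : ℝ) + 1 = (((r : ℝ) + 1) ^ (α - 1)) ^ e := by
              rw [← Real.rpow_mul (by positivity), he, mul_one_div_cancel hα1.ne', Real.rpow_one]
          _ ≤ _ := by gcongr
      have h3 : ((r : ℝ) + 1) ≤ N := h2.trans (Nat.le_ceil _)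
      exact_mod_cast h3
    have hmem : (ev i p - ev i q).re ∈ F := Finset.mem_image.2 ⟨(i, p, q), by
      simp [hidx p (hg i p q).1, hidx q (hg i p q).2], rfl⟩
    have h1 := hyF _ hmem
    have h2 : |y - (ev i p - ev i q).re| ≤ ‖ev i p - ev i q - y‖ := by
      have := Complex.abs_re_le_norm (ev i p - ev i q - y)
      rwa [Complex.sub_re _ (y : ℂ), Complex.ofReal_re, abs_sub_comm] at this
    rw [div_le_iff₀ (by positivity)] at h1
    calc (1 : ℝ) ≤ |y - (ev i p - ev i q).re| * (2 * ((F.card : ℝ) + 1)) := h1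
      _ ≤ ‖ev i p - ev i q - y‖ * (2 * (m * C₃ ^ 2 + 1) * y ^ (2 * e)) := by gcongr
      _ = _ := by ring

end Nonresonant

/-! ### Bounds uniform in the shift -/

section Uniform

/-- Polynomial factors are absorbed by `exp (K x^β)`. -/
lemma exists_mul_rpow_le_exp {M r β : ℝ} (hM : 0 ≤ M) (hr : 0 ≤ r) (hβ : 0 < β) :
    ∃ K : ℝ, 0 ≤ K ∧ ∀ x : ℝ, 1 ≤ x → M * x ^ r ≤ Real.exp (K * x ^ β) := by
  refine ⟨M + r / β, by positivity, fun x hx => ?_⟩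
  have hx0 : 0 < x := by linarith
  have h1 : 1 ≤ x ^ β := Real.one_le_rpow hx hβ.le
  have h2 : M ≤ Real.exp (M * x ^ β) := by
    have h3 : M ≤ M * x ^ β := le_mul_of_one_le_right hM h1
    linarith [Real.add_one_le_exp (M * x ^ β)]
  have h3 : x ^ r ≤ Real.exp (r / β * x ^ β) := by
    rw [Real.rpow_def_of_pos hx0]
    refine Real.exp_le_exp.2 ?_
    have h4 := Real.log_le_rpow_div hx0.le hβ
    calc Real.log x * r ≤ x ^ β / β * r := by gcongr
      _ = _ := by ring
  calc M * x ^ r ≤ Real.exp (M * x ^ β) * Real.exp (r / β * x ^ β) := by gcongr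
    _ = _ := by rw [← Real.exp_add]; ring_nf

variable {H : Type*} [NormedAddCommGroup H] [InnerProductSpace ℂ H] {m : ℕ}
  {ev : Fin m → ℕ → ℂ} {α : ℝ}

/-- For `s > 1 / (2 α)` a feedback with bounded coefficients is defined and bounded on `D(A^s)`. -/
lemma GrowsLike.exists_diagFunctional_le {G s : ℝ} (h : GrowsLike ev α G) (hG : 0 ≤ G)
    (hα : 1 < α) (hs : 1 / (2 * α) < s) (φ : HilbertBasis (Fin m × ℕ) ℂ H) :
    ∃ C : ℝ, 0 ≤ C ∧ ∀ (k : Fin m → ℕ → ℂ) (E : ℝ), (∀ i n, ‖k i n‖ ≤ E) →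
      ∀ f ∈ powDomain φ ev s, ∃ hf : f ∈ (diagFunctional φ k).domain,
        ‖diagFunctional φ k ⟨f, hf⟩‖ ≤ C * E * powNorm φ ev s f := by
  have hα0 : 0 < α := by linarith
  have hs0 : 0 ≤ s := le_trans (by positivity) hs.le
  have has : 1 < 2 * (α * s) := by
    rw [div_lt_iff₀ (by positivity)] at hs
    linarith
  obtain ⟨G', hG', he⟩ := h.exists_powNorm_equiv hG hs0 φ
  set Z := ∑' n : ℕ, ((n : ℝ) + 1) ^ (-(2 * (α * s))) with hZ
  have hZ0 : 0 ≤ Z := tsum_nonneg fun n => by positivity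
  refine ⟨m * (√Z * √G'), by positivity, fun k E hk f hf => ?_⟩
  have hsum := (he f).1.1 hf
  have hle := ((he f).2 hf).1
  have hP := powNorm_nonneg (ev := ev) (s := s) φ f
  have hblock : ∀ i, (Summable fun n => ‖k i n * ⟪φ (i, n), f⟫_ℂ‖) ∧
      ∑' n, ‖k i n * ⟪φ (i, n), f⟫_ℂ‖ ≤ E * (√Z * √G') * powNorm φ ev s f := fun i => by
    have hE : 0 ≤ E := (norm_nonneg _).trans (hk i 0)
    have hinj : Function.Injective fun n : ℕ => (i, n) := fun a b h => (Prod.ext_iff.1 h).2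
    have hsi := hsum.comp_injective hinj
    have hsi' : ∑' n : ℕ, ((n : ℝ) + 1) ^ (2 * (α * s)) * ‖⟪φ (i, n), f⟫_ℂ‖ ^ 2 ≤
        G' * powNorm φ ev s f ^ 2 :=
      (hsi.tsum_le_tsum_of_inj (fun n : ℕ => (i, n)) hinj (fun _ _ => by positivity)
        (fun n => le_rfl) hsum).trans hle
    have e1 : ∀ n : ℕ, ((n : ℝ) + 1) ^ (-(α * s)) * (((n : ℝ) + 1) ^ (α * s) * ‖⟪φ (i, n), f⟫_ℂ‖) =
        ‖⟪φ (i, n), f⟫_ℂ‖ := fun n => by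
      rw [← mul_assoc, ← Real.rpow_add (by positivity), neg_add_cancel, Real.rpow_zero, one_mul]
    have e2 : ∀ n : ℕ, (((n : ℝ) + 1) ^ (-(α * s))) ^ (2 : ℝ) = ((n : ℝ) + 1) ^ (-(2 * (α * s))) :=
      fun n => by rw [← Real.rpow_mul (by positivity)]; ring_nf
    have e3 : ∀ n : ℕ, (((n : ℝ) + 1) ^ (α * s) * ‖⟪φ (i, n), f⟫_ℂ‖) ^ (2 : ℝ) =
        ((n : ℝ) + 1) ^ (2 * (α * s)) * ‖⟪φ (i, n), f⟫_ℂ‖ ^ 2 := fun n => by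
      rw [Real.mul_rpow (by positivity) (by positivity), ← Real.rpow_mul (by positivity),
        Real.rpow_two]
      ring_nf
    have hZs := summable_one_add_rpow has
    obtain ⟨h1, h2⟩ := Real.summable_and_inner_le_Lp_mul_Lq_tsum_of_nonneg
      Real.HolderConjugate.two_two
      (f := fun n : ℕ => ((n : ℝ) + 1) ^ (-(α * s)))
      (g := fun n : ℕ => ((n : ℝ) + 1) ^ (α * s) * ‖⟪φ (i, n), f⟫_ℂ‖)
      (fun n => by positivity) (fun n => by positivity) (by simpa only [e2] using hZs)
      (by simp only [e3]; exact hsi)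
    simp only [e1, e2, e3, ← Real.sqrt_eq_rpow] at h1 h2
    have h3 : ∀ n, ‖k i n * ⟪φ (i, n), f⟫_ℂ‖ ≤ E * ‖⟪φ (i, n), f⟫_ℂ‖ := fun n => by
      rw [norm_mul]; gcongr; exact hk i n
    have h4 := Summable.of_nonneg_of_le (fun n => norm_nonneg _) h3 (h1.mul_left E)
    refine ⟨h4, (h4.tsum_le_tsum h3 (h1.mul_left E)).trans ?_⟩
    rw [tsum_mul_left, mul_assoc, mul_assoc]
    gcongr
    refine h2.trans ?_
    gcongr
    calc _ ≤ √(G' * powNorm φ ev s f ^ 2) := Real.sqrt_le_sqrt hsi'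
      _ = _ := by rw [Real.sqrt_mul hG'.le, Real.sqrt_sq hP]
  refine ⟨fun i => (hblock i).1.of_norm, ?_⟩
  set u := diagFunctional φ k ⟨f, fun i => (hblock i).1.of_norm⟩ with hu
  have hui : ∀ i, ‖u i‖ ≤ E * (√Z * √G') * powNorm φ ev s f := fun i =>
    (norm_tsum_le_tsum_norm (hblock i).1).trans (hblock i).2
  have hsumu : u = ∑ j, u j • EuclideanSpace.single j (1 : ℂ) := by
    ext i
    simp [Finset.sum_apply, Pi.single_apply]
  calc ‖u‖ ≤ ∑ j, ‖u j • EuclideanSpace.single j (1 : ℂ)‖ := by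
        conv_lhs => rw [hsumu]
        exact norm_sum_le _ _
    _ ≤ ∑ _j : Fin m, E * (√Z * √G') * powNorm φ ev s f := by
        refine Finset.sum_le_sum fun j _ => ?_
        rw [norm_smul, PiLp.norm_single, norm_one, mul_one]
        exact hui j
    _ = _ := by simp; ring

variable [CompleteSpace H] {A : H →ₗ.[ℂ] H} {B : EuclideanSpace ℂ (Fin m) →L[ℂ] DualAdj A}
  {φ : HilbertBasis (Fin m × ℕ) ℂ H}

/-- `S` is the evolution of the closed loop with the feedback `K_lam` on `D(A^s)`: it is strongly
continuous, it decays like `E exp((w - lam) t)`, and its orbits are exactly the mild solutions. -/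
structure IsClosedLoopFlow (A : H →ₗ.[ℂ] H) (B : EuclideanSpace ℂ (Fin m) →L[ℂ] DualAdj A)
    (φ : HilbertBasis (Fin m × ℕ) ℂ H) (ev : Fin m → ℕ → ℂ) (s w lam E : ℝ)
    (S : ℝ → H → H) : Prop where
  zero : ∀ f, S 0 f = f
  continuous : ∀ f ∈ powDomain φ ev s, ContinuousOnPow φ ev s (fun t => S t f) (Ici 0)
  bound : ∀ f ∈ powDomain φ ev s, ∀ t, 0 ≤ t →
    powNorm φ ev s (S t f) ≤ E * Real.exp ((w - lam) * t) * powNorm φ ev s f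
  equation : ∀ f t₀ t₁, 0 ≤ t₀ → t₀ ≤ t₁ → ClosedLoopApply A B (feedback B φ ev lam)
    (∫ τ in t₀..t₁, S τ f) (S t₁ f - S t₀ f)
  unique : ∀ (z : ℝ → H) (t₀ t₁ : ℝ), t₀ ≤ t₁ → ContinuousOn z (Icc t₀ t₁) →
    (∀ t ∈ Icc t₀ t₁, ClosedLoopApply A B (feedback B φ ev lam)
      (∫ τ in t₀..t, z τ) (z t - z t₀)) → ∀ t ∈ Icc t₀ t₁, z t = S (t - t₀) (z t₀)

lemma FarFromResonance.le_norm {Cd κ lam : ℝ} (h : FarFromResonance ev Cd κ lam) (hCd : 0 < Cd)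
    (hlam : 0 < lam) (i : Fin m) (p q : ℕ) : (Cd * lam ^ κ)⁻¹ ≤ ‖ev i p - ev i q - lam‖ := by
  have h1 : 0 < Cd * lam ^ κ := by positivity
  rw [inv_le_iff_one_le_mul₀ h1, mul_comm]
  exact h i p q

/-- The growth of the feedback gains and of the closed-loop semigroup is subexponential,
`exp (K lam^β)` for any `β > 1/α`, uniformly in the admissible shifts `lam`. -/
lemma Framework.exists_closedLoopFlow (hF : Framework A B φ ev α) {Cd κ β w s : ℝ} (hCd : 0 < Cd)
    (hκ : 0 ≤ κ) (hβ : 1 / α < β) (hβ1 : β ≤ 1) (hw : ∀ p : Fin m × ℕ, (ev p.1 p.2).re ≤ w)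
    (hs : 0 ≤ s) (hs' : s < 1 - 1 / (2 * α)) :
    ∃ K : ℝ, 0 ≤ K ∧ ∀ lam : ℝ, 1 ≤ lam → FarFromResonance ev Cd κ lam →
      (∀ i n, ‖gain (ev i) (fun n => controlCoeff B i (φ (i, n))) lam n‖ ≤
        Real.exp (K * lam ^ β)) ∧
      ∃ S : ℝ → H → H, IsClosedLoopFlow A B φ ev s w lam (Real.exp (K * lam ^ β)) S := by
  have hα := hF.one_lt
  have hα0 : 0 < α := by linarith
  have hβ0 : 0 < β := lt_trans (by positivity) hβ
  obtain ⟨c, hc, hsep⟩ := hF.exists_separated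
  obtain ⟨G, hG, hgrow⟩ := hF.exists_growsLike
  obtain ⟨cb, Cb₀, hcb, hb₀⟩ := hF.control_diag
  obtain ⟨K₀, hK₀, hP⟩ := exists_norm_cauchyProd_le hc hα hβ hβ1
  obtain ⟨Cs, hCs, hker⟩ := hgrow.exists_powNorm_kernel_le hG hα hs hs' φ
  set Cb := max Cb₀ 0 with hCb
  set b : Fin m × ℕ → ℂ := fun p => controlCoeff B p.1 (φ p) with hbdef
  have hb : ∀ p, cb ≤ ‖b p‖ ∧ ‖b p‖ ≤ Cb := fun p =>
    ⟨(hb₀ p.1 p.2).1, (hb₀ p.1 p.2).2.trans (le_max_left _ _)⟩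
  have hCb0 : 0 ≤ Cb := le_max_right _ _
  set CQ := 2 ^ α * (1 + 1 / c) * (1 + 2 * Cd) with hCQ
  obtain ⟨K₁, hK₁, hK₁'⟩ := exists_mul_rpow_le_exp (M := cb⁻¹) (r := 1) (by positivity) zero_le_one
    hβ0
  obtain ⟨K₂, hK₂, hK₂'⟩ := exists_mul_rpow_le_exp
    (M := Cs * (Cb * CQ) * (Cs * (CQ * cb⁻¹))) (r := (κ + 1) + (κ + 1) + 2) (by positivity)
    (by positivity) hβ0
  -- `K₁` absorbs the factor `cb⁻¹ * lam` of the gains, `K₂` the polynomial factors of `Ψ` and `R`,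
  -- and `2 * K₀` accounts for the two products occurring in `R`.
  refine ⟨K₁ + K₂ + 2 * K₀, by positivity, fun lam hlam hfar => ?_⟩
  have hlam0 : 0 < lam := by linarith
  have hd : 0 < (Cd * lam ^ κ)⁻¹ := by positivity
  have hr := hfar.le_norm hCd hlam0
  set E := Real.exp (K₀ * lam ^ β) with hE
  set k : Fin m → ℕ → ℂ := fun i => gain (ev i) (fun n => controlCoeff B i (φ (i, n))) lam with hk
  set ρ : Fin m × ℕ → ℂ := fun p => -lam * cauchyTProd (ev p.1) (-lam) p.2 with hρ
  have hTP : ∀ i n, ‖cauchyTProd (ev i) lam n‖ ≤ E := fun i n =>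
    norm_cauchyTProd_le (hsep i) hc hα fun s => by
      simpa [hE, abs_of_pos hlam0] using hP (ev i) (hsep i) lam s n
  have hTP' : ∀ i n, ‖cauchyTProd (ev i) (-lam) n‖ ≤ E := fun i n =>
    norm_cauchyTProd_le (hsep i) hc hα fun s => by
      simpa [hE, abs_of_pos hlam0] using hP (ev i) (hsep i) (-lam) s n
  have hkn : ∀ i n, ‖k i n‖ ≤ cb⁻¹ * (lam * E) := fun i n => by
    simp only [hk]
    rw [gain_eq (hsep i) hc hα hd (hr i), norm_mul, norm_mul, norm_neg, norm_inv,
      Complex.norm_real, Real.norm_of_nonneg hlam0.le]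
    gcongr
    · exact (hb (i, n)).1
    · exact hTP i n
  have hρn : ∀ p, ‖ρ p‖ ≤ lam * E := fun p => by
    rw [hρ, norm_mul, norm_neg, Complex.norm_real, Real.norm_of_nonneg hlam0.le]
    gcongr
    exact hTP' _ _
  set Q := CQ * lam ^ (κ + 1) with hQ
  have hQ0 : 0 ≤ Q := by positivity
  have hres : ∀ p q, ‖resKernel ev lam p q‖ ≤ Q * blockToep α p q := fun p q => by
    refine (norm_resKernel_le hc hα0 hsep hd hr p q).trans ?_
    refine mul_le_mul_of_nonneg_right ?_ (blockToep_nonneg α p q)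
    rw [hQ, hCQ, mul_assoc (2 ^ α * (1 + 1 / c))]
    refine mul_le_mul_of_nonneg_left ?_ (by positivity)
    rw [abs_of_pos hlam0, div_inv_eq_mul, Real.rpow_add_one hlam0.ne']
    have h1 : 1 ≤ lam ^ κ := Real.one_le_rpow hlam hκ
    have h2 : 1 ≤ lam ^ κ * lam := by nlinarith
    have h3 : (1 + lam) * (Cd * lam ^ κ) ≤ 2 * lam * (Cd * lam ^ κ) := by gcongr; linarith
    nlinarith
  obtain ⟨Ψ, R, D⟩ := exists_isDiagonalization φ hα hc hsep hd hr hcb hb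
  have hΨ : ∀ f ∈ powDomain φ ev s, Ψ f ∈ powDomain φ ev s ∧
      powNorm φ ev s (Ψ f) ≤ Cs * (Cb * Q) * powNorm φ ev s f := fun f hf =>
    hker (fun p q => b p * resKernel ev lam p q) (Cb * Q) (by positivity) (fun p q => by
      rw [norm_mul, mul_assoc]
      exact mul_le_mul (hb p).2 (hres p q) (norm_nonneg _) hCb0) f (Ψ f) (D.synthesis f) hf
  have hR : ∀ f ∈ powDomain φ ev s, R f ∈ powDomain φ ev s ∧
      powNorm φ ev s (R f) ≤ Cs * (lam * E * Q * (cb⁻¹ * (lam * E))) * powNorm φ ev s f :=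
    fun f hf => hker (fun p q => ρ p * resKernel ev lam q p * k q.1 q.2) _ (by positivity)
      (fun p q => by
        rw [norm_mul, norm_mul]
        calc _ ≤ lam * E * (Q * blockToep α q p) * (cb⁻¹ * (lam * E)) := by
              have := blockToep_nonneg α q p
              gcongr
              · exact hρn p
              · exact hres q p
              · exact hkn _ _
          _ = _ := by rw [blockToep_comm]; ring) f (R f) (D.analysis f) hf
  have hprod : Cs * (Cb * Q) * (Cs * (lam * E * Q * (cb⁻¹ * (lam * E)))) ≤
      Real.exp ((K₁ + K₂ + 2 * K₀) * lam ^ β) := by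
    have e1 : Cs * (Cb * Q) * (Cs * (lam * E * Q * (cb⁻¹ * (lam * E)))) =
        Cs * (Cb * CQ) * (Cs * (CQ * cb⁻¹)) * lam ^ ((κ + 1) + (κ + 1) + 2) * (E * E) := by
      rw [hQ, Real.rpow_add hlam0 _ 2, Real.rpow_add hlam0 (κ + 1), Real.rpow_two]
      ring
    rw [e1]
    calc _ ≤ Real.exp (K₂ * lam ^ β) * (E * E) := by gcongr; exact hK₂' lam hlam
      _ = Real.exp ((K₂ + 2 * K₀) * lam ^ β) := by
          rw [hE, ← Real.exp_add, ← Real.exp_add]; ring_nf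
      _ ≤ _ := by gcongr; linarith
  have hν := re_sub_le hw lam
  refine ⟨fun i n => (hkn i n).trans ?_, loopFlow φ ev lam Ψ R, D.loopFlow_zero, fun f hf t ht => ?_,
    fun f hf t ht => ?_, fun f t₀ t₁ h0 h1 => ?_, fun z t₀ t₁ h01 hz heq => ?_⟩
  · have h1 := hK₁' lam hlam
    rw [Real.rpow_one] at h1
    calc cb⁻¹ * (lam * E) = cb⁻¹ * lam * E := by ring
      _ ≤ Real.exp (K₁ * lam ^ β) * E := by gcongr
      _ = Real.exp ((K₁ + K₀) * lam ^ β) := by rw [hE, ← Real.exp_add]; ring_nf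
      _ ≤ _ := Real.exp_le_exp.2 (mul_le_mul_of_nonneg_right (by linarith) (by positivity))
  · have hc := continuousOnPow_expFlow φ hν (hR f hf).1
    refine ⟨(hΨ _ (hc t ht).1).1, ?_⟩
    have h1 := (hc t ht).2.const_mul (Cs * (Cb * Q))
    rw [mul_zero] at h1
    refine squeeze_zero' (Eventually.of_forall fun _ => powNorm_nonneg φ _) ?_ h1
    filter_upwards [self_mem_nhdsWithin] with τ hτ
    simp only [loopFlow]
    rw [← map_sub]
    exact (hΨ _ (sub_mem_powDomain φ (hc τ hτ).1 (hc t ht).1)).2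
  · have h1 := powNorm_expFlow_le φ hν ht (hR f hf).1
    have h2 := powNorm_nonneg (ev := ev) (s := s) φ f
    calc powNorm φ ev s (loopFlow φ ev lam Ψ R t f)
        ≤ Cs * (Cb * Q) * (Real.exp ((w - lam) * t) *
            (Cs * (lam * E * Q * (cb⁻¹ * (lam * E))) * powNorm φ ev s f)) := by
          refine (hΨ _ h1.1).2.trans ?_
          gcongr
          refine h1.2.trans ?_
          gcongr
          exact (hR f hf).2
      _ = Cs * (Cb * Q) * (Cs * (lam * E * Q * (cb⁻¹ * (lam * E)))) *
            Real.exp ((w - lam) * t) * powNorm φ ev s f := by ring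
      _ ≤ _ := by gcongr
  · exact D.closedLoopApply_loopFlow hF hG hgrow hw f h0 h1
  · exact D.eq_loopFlow hF hw h01 hz heq

end Uniform

/-! ### Decay against growth -/

section Growth

lemma exists_sum_range_le_of_eventually_nonpos {a : ℕ → ℝ} (h : ∀ᶠ k in atTop, a k ≤ 0) :
    ∃ C : ℝ, ∀ N, ∑ k ∈ Finset.range N, a k ≤ C := by
  obtain ⟨N₀, hN₀⟩ := eventually_atTop.1 h
  have hs : Summable fun k => max (a k) 0 :=
    summable_of_ne_finset_zero (s := Finset.range N₀) fun k hk =>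
      max_eq_right (hN₀ k (not_lt.1 fun hlt => hk (Finset.mem_range.2 hlt)))
  exact ⟨∑' k, max (a k) 0, fun N => (Finset.sum_le_sum fun k _ => le_max_left _ _).trans
    (hs.sum_le_tsum _ fun k _ => le_max_right _ _)⟩

lemma tendsto_mul_rpow_sub_rpow_atBot {β η c κ : ℝ} (hβ : 0 < β) (hη : β < η) (hκ : 0 < κ) :
    Tendsto (fun x : ℝ => c * x ^ β - κ * x ^ η) atTop atBot := by
  have h1 : Tendsto (fun x : ℝ => κ * x ^ (η - β)) atTop atTop :=
    (tendsto_rpow_atTop (sub_pos.2 hη)).const_mul_atTop hκ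
  have h2 : Tendsto (fun x : ℝ => c - κ * x ^ (η - β)) atTop atBot := by
    simpa only [sub_eq_add_neg, Function.comp_def] using
      tendsto_atBot_add_const_left _ c (tendsto_neg_atTop_atBot.comp h1)
  refine ((tendsto_rpow_atTop hβ).atTop_mul_atBot₀ h2).congr' ?_
  filter_upwards [eventually_gt_atTop 0] with x hx
  rw [show η = β + (η - β) by ring, Real.rpow_add hx]
  ring_nf

/-- The decay `exp (-κ x^η)` accumulated over all previous steps beats the growth `exp (K x^β)` of
the current step, `β < η`, as long as `x` grows at most geometrically from one step to the next. -/
lemma tendsto_growth_atBot {x : ℕ → ℝ} {β η K κ q : ℝ} (hβ : 0 < β) (hη : β < η) (hκ : 0 < κ)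
    (hK : 0 ≤ K) (hq : 0 ≤ q) (hx0 : ∀ k, 0 ≤ x k) (hx : Tendsto x atTop atTop)
    (hxq : ∀ k, x (k + 1) ≤ q * x k) :
    Tendsto (fun N => 2 * K * x N ^ β + ∑ k ∈ Finset.range N, (K * x k ^ β - κ * x k ^ η))
      atTop atBot := by
  have h1 := (tendsto_mul_rpow_sub_rpow_atBot (c := K) hβ hη hκ).comp hx
  obtain ⟨C, hC⟩ := exists_sum_range_le_of_eventually_nonpos (h1.eventually_le_atBot 0)
  have h2 := (tendsto_mul_rpow_sub_rpow_atBot (c := 2 * K * q ^ β + K) hβ hη hκ).comp hx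
  refine (tendsto_add_atTop_iff_nat 1).1 (tendsto_atBot_mono (fun N => ?_)
    (tendsto_atBot_add_const_right _ C h2))
  rw [Finset.sum_range_succ]
  have h3 : x (N + 1) ^ β ≤ q ^ β * x N ^ β := by
    rw [← Real.mul_rpow hq (hx0 N)]
    exact Real.rpow_le_rpow (hx0 _) (hxq N) hβ.le
  have h4 := hC N
  have h5 := mul_le_mul_of_nonneg_left h3 (by positivity : 0 ≤ 2 * K)
  simp only [Function.comp_apply] at h4 ⊢
  linarith

end Growth

/-! ### Switched closed loops -/

section Switching

/-- The least index `n` with `t < τ n` is `N + 1` on `[τ N, τ (N + 1))`. -/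
lemma sInf_switch_eq {τ : ℕ → ℝ} (hτ : StrictMono τ) {N : ℕ} {t : ℝ}
    (ht : t ∈ Ico (τ N) (τ (N + 1))) : sInf {n : ℕ | t < τ n} = N + 1 := by
  refine le_antisymm (Nat.sInf_le ht.2) (le_csInf ⟨N + 1, ht.2⟩ fun n hn => ?_)
  exact hτ.lt_iff_lt.1 (ht.1.trans_lt hn)

lemma exists_mem_Ico_switch {τ : ℕ → ℝ} {T : ℝ} (h0 : τ 0 = 0) (hlim : Tendsto τ atTop (𝓝 T))
    {t : ℝ} (ht : t ∈ Ico 0 T) : ∃ N, t ∈ Ico (τ N) (τ (N + 1)) := by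
  classical
  have hex : ∃ n, t < τ n := (hlim.eventually_const_lt ht.2).exists
  obtain ⟨N, hN⟩ : ∃ N, Nat.find hex = N + 1 :=
    Nat.exists_eq_succ_of_ne_zero fun h => by
      have := Nat.find_spec hex
      rw [h, h0] at this
      exact absurd ht.1 (not_le.2 this)
  refine ⟨N, not_lt.1 (Nat.find_min hex (by rw [hN]; exact Nat.lt_succ_self N)), ?_⟩
  rw [← hN]
  exact Nat.find_spec hex

/-- A function bounded by `F N` on the `N`-th switching interval tends to zero at the accumulation
point `T` of the switching times if `F` tends to zero. -/
lemma tendsto_zero_of_le_switch {τ : ℕ → ℝ} {T : ℝ} (hτ : StrictMono τ) (h0 : τ 0 = 0)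
    (hlim : Tendsto τ atTop (𝓝 T)) (hT : ∀ N, τ N < T) {g : ℝ → ℝ} {F : ℕ → ℝ} (hg : ∀ t, 0 ≤ g t)
    (hF : Tendsto F atTop (𝓝 0)) (hgF : ∀ N, ∀ t ∈ Ico (τ N) (τ (N + 1)), g t ≤ F N) :
    Tendsto g (𝓝[<] T) (𝓝 0) := by
  refine tendsto_order.2 ⟨fun a ha => Eventually.of_forall fun t => ha.trans_le (hg t),
    fun a ha => ?_⟩
  obtain ⟨N₀, hN₀⟩ := eventually_atTop.1 (hF.eventually_lt_const ha)
  filter_upwards [self_mem_nhdsWithin, nhdsWithin_le_nhds (Ioi_mem_nhds (hT N₀))] with t ht1 ht2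
  have ht0 : 0 ≤ t := by
    have := hτ.monotone (Nat.zero_le N₀)
    rw [h0] at this
    exact this.trans (le_of_lt ht2)
  obtain ⟨N, hN⟩ := exists_mem_Ico_switch h0 hlim ⟨ht0, ht1⟩
  have hNN : N₀ ≤ N := Nat.lt_succ_iff.1 (hτ.lt_iff_lt.1 (lt_trans ht2 hN.2))
  exact (hgF N t hN).trans_lt (hN₀ N hNN)

variable {H : Type*} [NormedAddCommGroup H] [InnerProductSpace ℂ H] {m : ℕ}
  {φ : HilbertBasis (Fin m × ℕ) ℂ H} {ev : Fin m → ℕ → ℂ} {s w : ℝ}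

lemma ContinuousOnPow.comp_sub {g : ℝ → H} (hg : ContinuousOnPow φ ev s g (Ici 0)) (c : ℝ) :
    ContinuousOnPow φ ev s (fun t => g (t - c)) (Ici c) := by
  intro t ht
  have ht' : t - c ∈ Ici (0 : ℝ) := mem_Ici.2 (sub_nonneg.2 (mem_Ici.1 ht))
  refine ⟨(hg _ ht').1, (hg _ ht').2.comp (tendsto_nhdsWithin_iff.2 ⟨?_, ?_⟩)⟩
  · have : Continuous fun r : ℝ => r - c := by fun_prop
    exact (this.tendsto t).mono_left nhdsWithin_le_nhds
  · filter_upwards [self_mem_nhdsWithin] with r hr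
    exact mem_Ici.2 (sub_nonneg.2 (mem_Ici.1 hr))

lemma zero_mem_powDomain : (0 : H) ∈ powDomain φ ev s := by
  simp [powDomain, summable_zero]

lemma powNorm_zero : powNorm φ ev s (0 : H) = 0 := by
  simp [powNorm]

variable [CompleteSpace H] {A : H →ₗ.[ℂ] H} {B : EuclideanSpace ℂ (Fin m) →L[ℂ] DualAdj A}

lemma closedLoopApply_zero (K : H →ₗ.[ℂ] EuclideanSpace ℂ (Fin m)) :
    ClosedLoopApply A B K 0 0 := by
  refine ⟨K.domain.zero_mem, fun x => ?_⟩
  have e : K ⟨0, K.domain.zero_mem⟩ = 0 := K.map_zero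
  rw [e]
  simp [bracket]

/-- The state at the switching times. -/
def switchState (S : ℕ → ℝ → H → H) (τ : ℕ → ℝ) (y₀ : H) : ℕ → H
  | 0 => y₀
  | N + 1 => S (N + 1) (τ (N + 1) - τ N) (switchState S τ y₀ N)

open Classical in
/-- The trajectory of the switched system: on `[τ N, τ (N + 1))` it follows the flow `S (N + 1)`;
it is continued by `0` from the limit `T` of the switching times on. -/
noncomputable def switchFlow (S : ℕ → ℝ → H → H) (τ : ℕ → ℝ) (T : ℝ) (y₀ : H) (t : ℝ) : H :=
  if t < T then S (sInf {n : ℕ | t < τ n}) (t - τ (sInf {n : ℕ | t < τ n} - 1))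
    (switchState S τ y₀ (sInf {n : ℕ | t < τ n} - 1)) else 0

/-- The bound on the growth of the switched trajectory up to the switching time `τ N`. -/
noncomputable def switchGrowth (E lam : ℕ → ℝ) (w : ℝ) (τ : ℕ → ℝ) (N : ℕ) : ℝ :=
  ∏ k ∈ Finset.range N, E (k + 1) * Real.exp ((w - lam (k + 1)) * (τ (k + 1) - τ k))

/-- Well-posedness of a switched closed loop whose switching times accumulate at `T`, and vanishing
of its trajectories at `T`, when the accumulated growth tends to zero. -/
lemma exists_switched_solution {τ lam E : ℕ → ℝ} {T : ℝ} {S : ℕ → ℝ → H → H} {M : ℝ}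
    {Kt : ℝ → H →ₗ.[ℂ] EuclideanSpace ℂ (Fin m)}
    (hτ : StrictMono τ) (hτ0 : τ 0 = 0) (hlim : Tendsto τ atTop (𝓝 T)) (hw : 0 ≤ w)
    (hlam : ∀ N, 0 ≤ lam (N + 1)) (hE : ∀ N, 0 ≤ E (N + 1))
    (hS : ∀ N, IsClosedLoopFlow A B φ ev s w (lam (N + 1)) (E (N + 1)) (S (N + 1)))
    (hKt : ∀ N, ∀ t ∈ Ico (τ N) (τ (N + 1)), Kt t = feedback B φ ev (lam (N + 1)))
    (hM : ∀ N, E (N + 1) * Real.exp (w * T) * switchGrowth E lam w τ N ≤ M)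
    (hF : Tendsto (fun N => E (N + 1) * Real.exp (w * T) * switchGrowth E lam w τ N) atTop (𝓝 0))
    {y₀ : H} (hy₀ : y₀ ∈ powDomain φ ev s) :
    ∃ y : ℝ → H, IsSolution A B φ ev s T Kt y₀ y ∧
      (∀ z : ℝ → H, IsSolution A B φ ev s T Kt y₀ z → EqOn z y (Ico 0 T)) ∧
      (∀ t ∈ Ico 0 T, powNorm φ ev s (y t) ≤ M * powNorm φ ev s y₀) ∧
      ContinuousOnPow φ ev s y (Icc 0 T) ∧ y T = 0 ∧
      ∀ N, ∀ t ∈ Ico (τ N) (τ (N + 1)), powNorm φ ev s (y t) ≤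
        E (N + 1) * Real.exp (w * T) * switchGrowth E lam w τ N * powNorm φ ev s y₀ := by
  have hT : ∀ N, τ N < T := fun N =>
    (hτ (Nat.lt_succ_self N)).trans_le (hτ.monotone.ge_of_tendsto hlim (N + 1))
  have hτnn : ∀ N, 0 ≤ τ N := fun N => hτ0 ▸ hτ.monotone (Nat.zero_le N)
  have hstep : ∀ N, 0 ≤ τ (N + 1) - τ N := fun N => (sub_pos.2 (hτ (Nat.lt_succ_self N))).le
  set Y := switchState S τ y₀ with hY
  set y := switchFlow S τ T y₀ with hydef
  have hP0 := powNorm_nonneg (ev := ev) (s := s) φ y₀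
  have hg0 : ∀ N, 0 ≤ switchGrowth E lam w τ N := fun N =>
    Finset.prod_nonneg fun k _ => mul_nonneg (hE k) (Real.exp_pos _).le
  have hYmem : ∀ N, Y N ∈ powDomain φ ev s ∧
      powNorm φ ev s (Y N) ≤ switchGrowth E lam w τ N * powNorm φ ev s y₀ := by
    intro N
    induction N with
    | zero => exact ⟨hy₀, by simp [switchGrowth, hY, switchState]⟩
    | succ N ih =>
      refine ⟨((hS N).continuous _ ih.1 _ (hstep N)).1, ?_⟩
      refine ((hS N).bound _ ih.1 _ (hstep N)).trans ?_
      rw [switchGrowth, Finset.prod_range_succ, ← switchGrowth]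
      have := hE N
      calc _ ≤ E (N + 1) * Real.exp ((w - lam (N + 1)) * (τ (N + 1) - τ N)) *
            (switchGrowth E lam w τ N * powNorm φ ev s y₀) := by gcongr; exact ih.2
        _ = _ := by ring
  have hyIco : ∀ N, ∀ t ∈ Ico (τ N) (τ (N + 1)), y t = S (N + 1) (t - τ N) (Y N) := by
    intro N t ht
    rw [hydef, switchFlow, if_pos (ht.2.trans (hT _)), sInf_switch_eq hτ ht]
    rfl
  have hyτ : ∀ N, y (τ N) = Y N := fun N => by
    rw [hyIco N _ ⟨le_rfl, hτ (Nat.lt_succ_self N)⟩, sub_self, (hS N).zero]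
  have hyIcc : ∀ N, ∀ t ∈ Icc (τ N) (τ (N + 1)), y t = S (N + 1) (t - τ N) (Y N) := by
    intro N t ht
    rcases ht.2.eq_or_lt with h | h
    · rw [h, hyτ]; rfl
    · exact hyIco N t ⟨ht.1, h⟩
  have hyT : y T = 0 := by rw [hydef, switchFlow, if_neg (lt_irrefl T)]
  have hbound : ∀ N, ∀ t ∈ Ico (τ N) (τ (N + 1)), powNorm φ ev s (y t) ≤
      E (N + 1) * Real.exp (w * T) * switchGrowth E lam w τ N * powNorm φ ev s y₀ := by
    intro N t ht
    rw [hyIco N t ht]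
    have h1 := hE N
    have h2 : (w - lam (N + 1)) * (t - τ N) ≤ w * T := by
      have h3 : 0 ≤ t - τ N := sub_nonneg.2 ht.1
      have h4 : t - τ N ≤ T := by linarith [hτnn N, hT (N + 1), ht.2]
      nlinarith [hlam N, mul_nonneg (hlam N) h3, mul_le_mul_of_nonneg_left h4 hw]
    calc _ ≤ E (N + 1) * Real.exp ((w - lam (N + 1)) * (t - τ N)) * powNorm φ ev s (Y N) :=
          (hS N).bound _ (hYmem N).1 _ (sub_nonneg.2 ht.1)
      _ ≤ E (N + 1) * Real.exp (w * T) * (switchGrowth E lam w τ N * powNorm φ ev s y₀) := by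
          gcongr
          · exact powNorm_nonneg φ _
          · exact (hYmem N).2
      _ = _ := by ring
  have hpiece : ∀ N, ContinuousOnPow φ ev s y (Icc (τ N) (τ (N + 1))) := fun N =>
    ((((hS N).continuous _ (hYmem N).1).comp_sub (τ N)).mono φ Icc_subset_Ici_self).congr φ
      (hyIcc N)
  have hcont : ∀ N, ContinuousOnPow φ ev s y (Icc 0 (τ N)) := by
    intro N
    induction N with
    | zero =>
      refine (hpiece 0).mono φ ?_
      rw [hτ0]
      exact Icc_subset_Icc_right (by have := hstep 0; rw [hτ0, sub_zero] at this; exact this)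
    | succ N ih =>
      rw [← Icc_union_Icc_eq_Icc (hτnn N) (hτ (Nat.lt_succ_self N)).le]
      exact ih.union φ (hpiece N) isClosed_Icc isClosed_Icc
  have hcontT : ContinuousOnPow φ ev s y (Icc 0 T) := by
    intro t ht
    rcases ht.2.eq_or_lt with h | h
    · subst h
      refine ⟨by rw [hyT]; exact zero_mem_powDomain, ?_⟩
      have h1 : Icc 0 t ⊆ Iio t ∪ {t} := fun r hr => hr.2.lt_or_eq
      refine Tendsto.mono_left ?_ (nhdsWithin_mono t h1)
      rw [nhdsWithin_union, nhdsWithin_singleton]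
      simp only [hyT, sub_zero]
      refine tendsto_sup.2 ⟨?_, ?_⟩
      · have h2 := hF.mul_const (powNorm φ ev s y₀)
        rw [zero_mul] at h2
        exact tendsto_zero_of_le_switch hτ hτ0 hlim hT (fun r => powNorm_nonneg φ (y r)) h2 hbound
      · rw [tendsto_pure_left]
        intro U hU
        rw [hyT, powNorm_zero]
        exact mem_of_mem_nhds hU
    · obtain ⟨N, hN⟩ := exists_mem_Ico_switch hτ0 hlim ⟨ht.1, h⟩
      obtain ⟨h1, h2⟩ := hcont (N + 1) t ⟨ht.1, hN.2.le⟩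
      refine ⟨h1, h2.mono_left (nhdsWithin_le_of_mem ?_)⟩
      filter_upwards [self_mem_nhdsWithin, nhdsWithin_le_nhds (Iio_mem_nhds hN.2)] with r hr1 hr2
      exact ⟨hr1.1, le_of_lt hr2⟩
  have heqpiece : ∀ N a b, τ N ≤ a → a ≤ b → b ≤ τ (N + 1) →
      ClosedLoopApply A B (Kt a) (∫ r in a..b, y r) (y b - y a) := by
    intro N a b ha hab hb
    rcases hab.eq_or_lt with rfl | hlt
    · rw [intervalIntegral.integral_same, sub_self]
      exact closedLoopApply_zero _
    · have e1 : ∫ r in a..b, y r = ∫ r in (a - τ N)..(b - τ N), S (N + 1) r (Y N) := by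
        rw [← intervalIntegral.integral_comp_sub_right (fun r => S (N + 1) r (Y N)) (τ N)]
        refine intervalIntegral.integral_congr fun r hr => ?_
        rw [uIcc_of_le hab] at hr
        exact hyIcc N r ⟨ha.trans hr.1, hr.2.trans hb⟩
      rw [hKt N a ⟨ha, hlt.trans_le hb⟩, e1, hyIcc N b ⟨ha.trans hab, hb⟩,
        hyIcc N a ⟨ha, hab.trans hb⟩]
      exact (hS N).equation _ _ _ (sub_nonneg.2 ha) (sub_le_sub_right hab _)
  -- A feedback may take the same value on both sides of a switching time; the mild equation is then
  -- obtained by adding up the pieces.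
  have heq : ∀ N a b, 0 ≤ a → a ≤ b → b ≤ τ N → (∀ t ∈ Ico a b, Kt t = Kt a) →
      ClosedLoopApply A B (Kt a) (∫ r in a..b, y r) (y b - y a) := by
    intro N
    induction N with
    | zero =>
      intro a b ha hab hb _
      refine heqpiece 0 a b (by rwa [hτ0]) hab (hb.trans (hτ (Nat.lt_succ_self 0)).le)
    | succ N ih =>
      intro a b ha hab hb hconst
      rcases le_total (τ N) a with h1 | h1
      · exact heqpiece N a b h1 hab hb
      rcases le_or_gt b (τ N) with h2 | h2
      · exact ih a b ha hab h2 hconst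
      · have hc1 := ih a (τ N) ha h1 le_rfl fun t ht => hconst t ⟨ht.1, ht.2.trans h2⟩
        have hc2 := heqpiece N (τ N) b le_rfl h2.le hb
        rw [hconst (τ N) ⟨h1, h2⟩] at hc2
        have hi : ∀ c d, 0 ≤ c → c ≤ d → d ≤ τ (N + 1) →
            IntervalIntegrable y MeasureTheory.volume c d := fun c d hc hcd hd => by
          refine (((hcont (N + 1)).continuousOn φ).mono ?_).intervalIntegrable
          rw [uIcc_of_le hcd]
          exact Icc_subset_Icc hc hd
        have h3 := hc1.add hc2
        rwa [intervalIntegral.integral_add_adjacent_intervals (hi a _ ha h1 (h2.le.trans hb))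
          (hi _ b (hτnn N) h2.le hb), add_comm (y (τ N) - y a), sub_add_sub_cancel] at h3
  refine ⟨y, ⟨?_, hcontT.mono φ Ico_subset_Icc_self, fun a b ha hab hb hconst => ?_⟩,
    fun z hz => ?_, fun t ht => ?_, hcontT, hyT, hbound⟩
  · have := hyτ 0
    rwa [hτ0] at this
  · obtain ⟨N, hN⟩ := exists_mem_Ico_switch hτ0 hlim ⟨ha.trans hab, hb⟩
    exact heq (N + 1) a b ha hab hN.2.le hconst
  · have hzc := hz.continuous.continuousOn φ
    have hzpiece : ∀ N, ∀ t ∈ Icc (τ N) (τ (N + 1)), z t = S (N + 1) (t - τ N) (z (τ N)) := by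
      intro N
      refine (hS N).unique z _ _ (hτ (Nat.lt_succ_self N)).le
        (hzc.mono fun r hr => ⟨(hτnn N).trans hr.1, hr.2.trans_lt (hT _)⟩) fun t ht => ?_
      have hN : Kt (τ N) = feedback B φ ev (lam (N + 1)) :=
        hKt N _ ⟨le_rfl, hτ (Nat.lt_succ_self N)⟩
      rw [← hN]
      refine hz.equation (τ N) t (hτnn N) ht.1 (ht.2.trans_lt (hT _)) fun r hr => ?_
      rw [hN]
      exact hKt N r ⟨hr.1, hr.2.trans_le ht.2⟩
    have hzY : ∀ N, z (τ N) = Y N := by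
      intro N
      induction N with
      | zero => rw [hτ0]; exact hz.initial
      | succ N ih =>
        rw [hzpiece N _ ⟨(hτ (Nat.lt_succ_self N)).le, le_rfl⟩, ih]
        rfl
    intro t ht
    obtain ⟨N, hN⟩ := exists_mem_Ico_switch hτ0 hlim ht
    rw [hzpiece N t (Ico_subset_Icc_self hN), hzY, hyIco N t hN]
  · obtain ⟨N, hN⟩ := exists_mem_Ico_switch hτ0 hlim ht
    exact (hbound N t hN).trans (mul_le_mul_of_nonneg_right (hM N) hP0)

end Switching

/-! ### The switching times -/

section SwitchTimes

variable {lam : ℕ → ℝ} {σ T γ : ℝ}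

lemma switchTime_zero : switchTime lam σ T 0 = 0 := by
  simp [switchTime]

lemma switchTime_succ (N : ℕ) : switchTime lam σ T (N + 1) = switchTime lam σ T N +
    T / (∑' q : ℕ, lam (q + 1) ^ (-(1 / σ))) * lam (N + 1) ^ (-(1 / σ)) := by
  rw [switchTime, Finset.sum_Icc_succ_top (by omega), ← switchTime]

lemma switchTime_eq_sum_range (N : ℕ) : switchTime lam σ T N =
    T / (∑' q : ℕ, lam (q + 1) ^ (-(1 / σ))) *
      ∑ q ∈ Finset.range N, lam (q + 1) ^ (-(1 / σ)) := by
  induction N with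
  | zero => simp [switchTime_zero]
  | succ N ih => rw [switchTime_succ, ih, Finset.sum_range_succ, mul_add]

lemma summable_rpow_of_rpow_le (hσ : 0 < σ) (hσγ : σ < γ)
    (h : ∀ q : ℕ, ((q : ℝ) + 1) ^ γ ≤ lam (q + 1)) :
    Summable fun q : ℕ => lam (q + 1) ^ (-(1 / σ)) := by
  refine Summable.of_nonneg_of_le (fun q => ?_) (fun q => ?_)
    (summable_one_add_rpow ((one_lt_div hσ).2 hσγ))
  · exact Real.rpow_nonneg ((Real.rpow_nonneg (by positivity) _).trans (h q)) _
  · have hq : (0 : ℝ) < (q : ℝ) + 1 := by positivity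
    calc lam (q + 1) ^ (-(1 / σ)) ≤ (((q : ℝ) + 1) ^ γ) ^ (-(1 / σ)) :=
          Real.rpow_le_rpow_of_nonpos (Real.rpow_pos_of_pos hq _) (h q)
            (neg_nonpos.2 (one_div_nonneg.2 hσ.le))
      _ = ((q : ℝ) + 1) ^ (-(γ / σ)) := by
          rw [← Real.rpow_mul hq.le]
          congr 1
          ring

lemma tsum_rpow_pos (hlam : ∀ q : ℕ, 0 < lam (q + 1))
    (h : Summable fun q : ℕ => lam (q + 1) ^ (-(1 / σ))) :
    0 < ∑' q : ℕ, lam (q + 1) ^ (-(1 / σ)) :=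
  h.tsum_pos (fun q => (Real.rpow_pos_of_pos (hlam q) _).le) 0 (Real.rpow_pos_of_pos (hlam 0) _)

lemma tendsto_switchTime (hlam : ∀ q : ℕ, 0 < lam (q + 1))
    (h : Summable fun q : ℕ => lam (q + 1) ^ (-(1 / σ))) :
    Tendsto (switchTime lam σ T) atTop (𝓝 T) := by
  have h1 := h.hasSum.tendsto_sum_nat.const_mul (T / ∑' q : ℕ, lam (q + 1) ^ (-(1 / σ)))
  rw [div_mul_cancel₀ _ (tsum_rpow_pos hlam h).ne'] at h1
  exact h1.congr fun N => (switchTime_eq_sum_range N).symm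

lemma strictMono_switchTime (hT : 0 < T) (hlam : ∀ q : ℕ, 0 < lam (q + 1))
    (h : Summable fun q : ℕ => lam (q + 1) ^ (-(1 / σ))) :
    StrictMono (switchTime lam σ T) := by
  refine strictMono_nat_of_lt_succ fun N => ?_
  rw [switchTime_succ]
  exact lt_add_of_pos_right _
    (mul_pos (div_pos hT (tsum_rpow_pos hlam h)) (Real.rpow_pos_of_pos (hlam N) _))

lemma piecewiseFeedback_eq {H : Type*} [NormedAddCommGroup H] [InnerProductSpace ℂ H]
    [CompleteSpace H] {m : ℕ} {A : H →ₗ.[ℂ] H} {B : EuclideanSpace ℂ (Fin m) →L[ℂ] DualAdj A}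
    {φ : HilbertBasis (Fin m × ℕ) ℂ H} {ev : Fin m → ℕ → ℂ}
    (hτ : StrictMono (switchTime lam σ T)) {N : ℕ} {t : ℝ}
    (ht : t ∈ Ico (switchTime lam σ T N) (switchTime lam σ T (N + 1))) :
    piecewiseFeedback B φ ev lam σ T t = feedback B φ ev (lam (N + 1)) := by
  rw [piecewiseFeedback, sInf_switch_eq hτ ht]

/-- Over an interval of length `κ λ^(-1/σ)`, the decay rate `λ` yields the factor
`exp (-κ λ^(1 - 1/σ))`, which absorbs the bounds `exp (K λ^β)` of the flows when `β < 1 - 1/σ`. -/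
lemma tendsto_exp_mul_switchGrowth {K β w q : ℝ} (hT : 0 < T) (hβ : 0 < β) (hη : β < 1 - 1 / σ)
    (hK : 0 ≤ K) (hw : 0 ≤ w) (hq : 0 ≤ q) (hlam : ∀ q : ℕ, 0 < lam (q + 1))
    (hx : Tendsto (fun k => lam (k + 1)) atTop atTop)
    (hxq : ∀ k, lam (k + 1 + 1) ≤ q * lam (k + 1))
    (h : Summable fun q : ℕ => lam (q + 1) ^ (-(1 / σ))) :
    Tendsto (fun N => Real.exp (K * lam (N + 1) ^ β) * (Real.exp (K * lam (N + 1) ^ β) *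
      Real.exp (w * T) * switchGrowth (fun n => Real.exp (K * lam n ^ β)) lam w
        (switchTime lam σ T) N)) atTop (𝓝 0) := by
  set κ := T / ∑' q : ℕ, lam (q + 1) ^ (-(1 / σ)) with hκdef
  have hκ : 0 < κ := div_pos hT (tsum_rpow_pos hlam h)
  have hτ := strictMono_switchTime hT hlam h
  have hlim := tendsto_switchTime (T := T) hlam h
  have h1 := tendsto_growth_atBot hβ hη hκ hK hq (fun k => (hlam k).le) hx hxq
  have h2 := Real.tendsto_exp_atBot.comp
    (tendsto_atBot_add_const_left atTop (w * T + w * T) h1)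
  refine squeeze_zero (fun N => ?_) (fun N => ?_) h2
  · exact mul_nonneg (Real.exp_pos _).le (mul_nonneg (by positivity)
      (Finset.prod_nonneg fun k _ => by positivity))
  · have h3 : ∀ k, (w - lam (k + 1)) * (switchTime lam σ T (k + 1) - switchTime lam σ T k) =
        w * (switchTime lam σ T (k + 1) - switchTime lam σ T k) -
          κ * lam (k + 1) ^ (1 - 1 / σ) := fun k => by
      have e : lam (k + 1) ^ (1 - 1 / σ) = lam (k + 1) * lam (k + 1) ^ (-(1 / σ)) := by
        rw [sub_eq_add_neg, Real.rpow_add (hlam k), Real.rpow_one]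
      rw [e, switchTime_succ, ← hκdef]
      ring
    have h4 : switchTime lam σ T N ≤ T := hτ.monotone.ge_of_tendsto hlim N
    simp only [switchGrowth, ← Real.exp_add, ← Real.exp_sum, Function.comp_apply, h3]
    refine Real.exp_le_exp.2 ?_
    have h5 : ∑ k ∈ Finset.range N, (K * lam (k + 1) ^ β +
        (w * (switchTime lam σ T (k + 1) - switchTime lam σ T k) -
          κ * lam (k + 1) ^ (1 - 1 / σ))) = w * switchTime lam σ T N +
        ∑ k ∈ Finset.range N, (K * lam (k + 1) ^ β - κ * lam (k + 1) ^ (1 - 1 / σ)) := by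
      have h6 := Finset.sum_range_sub (switchTime lam σ T) N
      rw [switchTime_zero, sub_zero] at h6
      rw [← h6, Finset.mul_sum, ← Finset.sum_add_distrib]
      exact Finset.sum_congr rfl fun k _ => by ring
    rw [h5]
    linarith [mul_le_mul_of_nonneg_left h4 hw]

end SwitchTimes

/-! ### Solutions under the switched feedback -/

section Parameters

variable {H : Type*} [NormedAddCommGroup H] [InnerProductSpace ℂ H]
    [CompleteSpace H] {m : ℕ} {A : H →ₗ.[ℂ] H}
    {B : EuclideanSpace ℂ (Fin m) →L[ℂ] DualAdj A}
    {φ : HilbertBasis (Fin m × ℕ) ℂ H} {ev : Fin m → ℕ → ℂ} {α γ σ T s w : ℝ} {lam : ℕ → ℝ}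

lemma FarFromResonance.notMem_resonantSet {Cd κ l : ℝ} (h : FarFromResonance ev Cd κ l) :
    (l : ℂ) ∉ resonantSet ev := by
  rintro ⟨i, p, q, e⟩
  have := h i p q
  rw [← e, sub_self, norm_zero, mul_zero] at this
  linarith

lemma Framework.exists_parameters (hF : Framework A B φ ev α) (hγ : 0 ≤ γ) :
    ∃ Cd κ : ℝ, 0 < Cd ∧ 0 ≤ κ ∧ ∃ lam : ℕ → ℝ, ∀ N : ℕ, 1 ≤ N →
      lam N ∈ Icc ((N : ℝ) ^ γ) ((N : ℝ) ^ γ + 1) ∧ FarFromResonance ev Cd κ (lam N) := by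
  obtain ⟨c, hc, hg⟩ := hF.exists_gap_le
  obtain ⟨Cd, κ, hCd, hκ, h⟩ := exists_farFromResonance hF.one_lt hc hg
  have h' : ∀ N : ℕ, ∃ l : ℝ, 1 ≤ N →
      l ∈ Icc ((N : ℝ) ^ γ) ((N : ℝ) ^ γ + 1) ∧ FarFromResonance ev Cd κ l := fun N => by
    by_cases hN : 1 ≤ N
    · obtain ⟨l, h1, h2⟩ := h _ (Real.one_le_rpow (Nat.one_le_cast.2 hN) hγ)
      exact ⟨l, fun _ => ⟨h1, h2⟩⟩
    -- The value at `N = 0` is never used.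
    · exact ⟨0, fun h => absurd h hN⟩
  choose lam hlam using h'
  exact ⟨Cd, κ, hCd, hκ, lam, hlam⟩

lemma le_mul_of_mem_Icc_rpow (hγ : 0 ≤ γ) (hlam : ∀ N : ℕ, 1 ≤ N →
    lam N ∈ Icc ((N : ℝ) ^ γ) ((N : ℝ) ^ γ + 1)) (k : ℕ) :
    lam (k + 1 + 1) ≤ 2 * 2 ^ γ * lam (k + 1) := by
  have h1 := (hlam (k + 1 + 1) (by omega)).2
  have h2 := (hlam (k + 1) (by omega)).1
  have h3 : (1 : ℝ) ≤ (((k + 1 + 1 : ℕ) : ℝ)) ^ γ :=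
    Real.one_le_rpow (Nat.one_le_cast.2 (by omega)) hγ
  have h4 : (((k + 1 + 1 : ℕ) : ℝ)) ^ γ ≤ 2 ^ γ * ((k + 1 : ℕ) : ℝ) ^ γ := by
    rw [← Real.mul_rpow (by positivity) (by positivity)]
    refine Real.rpow_le_rpow (by positivity) ?_ hγ
    push_cast
    linarith [(Nat.cast_nonneg k : (0 : ℝ) ≤ k)]
  have h5 := mul_le_mul_of_nonneg_left h2 (by positivity : (0 : ℝ) ≤ 2 ^ γ)
  linarith

/-- Well-posedness and steering to zero for fixed `σ`, `T` and `s`. The shifts enter only through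
their polynomial growth and their distance to the resonant set. -/
lemma Framework.exists_null_controlled_solution (hF : Framework A B φ ev α) {Cd κ : ℝ}
    (hCd : 0 < Cd) (hκ : 0 ≤ κ) (hγ : 0 < γ)
    (hlam : ∀ N : ℕ, 1 ≤ N → lam N ∈ Icc ((N : ℝ) ^ γ) ((N : ℝ) ^ γ + 1) ∧
      FarFromResonance ev Cd κ (lam N))
    (hσ : α / (α - 1) < σ) (hT : 0 < T) (hs : 0 ≤ s) (hs' : s < 1 - 1 / (2 * α))
    (hsum : Summable fun q : ℕ => lam (q + 1) ^ (-(1 / σ))) :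
    ∃ M : ℝ, ∀ y₀ ∈ powDomain φ ev s, ∃ y : ℝ → H,
      IsSolution A B φ ev s T (piecewiseFeedback B φ ev lam σ T) y₀ y ∧
      (∀ z : ℝ → H, IsSolution A B φ ev s T (piecewiseFeedback B φ ev lam σ T) y₀ z →
        EqOn z y (Ico 0 T)) ∧
      (∀ t ∈ Ico 0 T, powNorm φ ev s (y t) ≤ M * powNorm φ ev s y₀) ∧
      ContinuousOnPow φ ev s y (Icc 0 T) ∧ y T = 0 ∧
      (1 / (2 * α) < s → ∃ u : ℝ → EuclideanSpace ℂ (Fin m),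
        (∀ t ∈ Ico 0 T, ∃ h : y t ∈ (piecewiseFeedback B φ ev lam σ T t).domain,
          piecewiseFeedback B φ ev lam σ T t ⟨y t, h⟩ = u t) ∧
        Tendsto u (𝓝[<] T) (𝓝 0)) := by
  classical
  have hα := hF.one_lt
  have hα0 : 0 < α := by linarith
  have hα1 : 0 < α - 1 := by linarith
  have hσ0 : 0 < σ := (div_pos hα0 hα1).trans hσ
  have hη : 1 / α < 1 - 1 / σ := by
    have h1 : 1 / σ < 1 / (α / (α - 1)) := one_div_lt_one_div_of_lt (div_pos hα0 hα1) hσ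
    rw [one_div_div, sub_div, div_self hα0.ne'] at h1
    linarith
  have hη1 : 1 - 1 / σ ≤ 1 := by linarith [one_div_pos.2 hσ0]
  -- Growth `exp (K lam^β)` needs `β > 1 / α`; the decay dominates it if `β < 1 - 1 / σ`.
  obtain ⟨β, hβ, hβη⟩ := exists_between hη
  have hβ0 : 0 < β := (one_div_pos.2 hα0).trans hβ
  have hlam1 : ∀ N : ℕ, 1 ≤ lam (N + 1) := fun N =>
    (Real.one_le_rpow (Nat.one_le_cast.2 (by omega)) hγ.le).trans (hlam (N + 1) (by omega)).1.1
  have hlam0 : ∀ N : ℕ, 0 < lam (N + 1) := fun N => one_pos.trans_le (hlam1 N)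
  obtain ⟨w, hw, hw'⟩ := hF.exists_re_le
  obtain ⟨G, hG, hGr⟩ := hF.exists_growsLike
  obtain ⟨K, hK, hflow⟩ := hF.exists_closedLoopFlow hCd hκ hβ (hβη.le.trans hη1) hw' hs hs'
  have hS' : ∀ N : ℕ, ∃ S : ℝ → H → H, 1 ≤ N →
      IsClosedLoopFlow A B φ ev s w (lam N) (Real.exp (K * lam N ^ β)) S := fun N => by
    by_cases hN : 1 ≤ N
    · obtain ⟨k, rfl⟩ := Nat.exists_eq_add_of_le' hN
      obtain ⟨S, h⟩ := (hflow _ (hlam1 k) (hlam (k + 1) hN).2).2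
      exact ⟨S, fun _ => h⟩
    · exact ⟨fun _ x => x, fun h => absurd h hN⟩
  choose S hS using hS'
  have hτ := strictMono_switchTime hT hlam0 hsum
  have hlim := tendsto_switchTime (T := T) hlam0 hsum
  have hτT : ∀ N, switchTime lam σ T N < T := fun N =>
    (hτ (Nat.lt_succ_self N)).trans_le (hτ.monotone.ge_of_tendsto hlim (N + 1))
  have hx : Tendsto (fun k => lam (k + 1)) atTop atTop :=
    tendsto_atTop_mono (fun k => (hlam (k + 1) (by omega)).1.1)
      ((tendsto_rpow_atTop hγ).comp
        (tendsto_natCast_atTop_atTop.comp (tendsto_add_atTop_nat 1)))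
  set E : ℕ → ℝ := fun n => Real.exp (K * lam n ^ β) with hE
  set F : ℕ → ℝ := fun N => E (N + 1) * Real.exp (w * T) *
    switchGrowth E lam w (switchTime lam σ T) N with hFdef
  have hEF : Tendsto (fun N => E (N + 1) * F N) atTop (𝓝 0) :=
    tendsto_exp_mul_switchGrowth hT hβ0 hβη hK hw (by positivity) hlam0 hx
      (le_mul_of_mem_Icc_rpow hγ.le fun N hN => (hlam N hN).1) hsum
  have hF0 : ∀ N, 0 ≤ F N := fun N => mul_nonneg (by positivity)
    (Finset.prod_nonneg fun k _ => by positivity)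
  have hFlim : Tendsto F atTop (𝓝 0) :=
    squeeze_zero hF0 (fun N => le_mul_of_one_le_left (hF0 N) (Real.one_le_exp
      (mul_nonneg hK (Real.rpow_nonneg (hlam0 N).le _)))) hEF
  obtain ⟨M, hM⟩ := hFlim.bddAbove_range
  refine ⟨M, fun y₀ hy₀ => ?_⟩
  obtain ⟨y, hy, huniq, hbd, hcont, hyT, hpiece⟩ := exists_switched_solution hτ switchTime_zero
    hlim hw (fun N => (hlam0 N).le) (fun N => (Real.exp_pos _).le)
    (fun N => hS (N + 1) (by omega)) (fun N t ht => piecewiseFeedback_eq hτ ht)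
    (fun N => hM ⟨N, rfl⟩) hFlim hy₀
  refine ⟨y, hy, huniq, hbd, hcont, hyT, fun hs2 => ?_⟩
  obtain ⟨C, hC, hfun⟩ := hGr.exists_diagFunctional_le hG hα hs2 φ
  have hval : ∀ N, ∀ t ∈ Ico (switchTime lam σ T N) (switchTime lam σ T (N + 1)),
      ∃ h : y t ∈ (piecewiseFeedback B φ ev lam σ T t).domain,
        ‖piecewiseFeedback B φ ev lam σ T t ⟨y t, h⟩‖ ≤
          C * (E (N + 1) * F N) * powNorm φ ev s y₀ := by
    intro N t ht
    have ht0 : t ∈ Ico 0 T := ⟨(switchTime_zero (lam := lam) (σ := σ) (T := T) ▸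
      hτ.monotone (Nat.zero_le N)).trans ht.1, ht.2.trans (hτT _)⟩
    rw [piecewiseFeedback_eq hτ ht]
    obtain ⟨h, hle⟩ := hfun _ _ (hflow _ (hlam1 N) (hlam (N + 1) (by omega)).2).1 (y t)
      (hy.continuous t ht0).1
    refine ⟨h, hle.trans ?_⟩
    calc _ ≤ C * E (N + 1) * (F N * powNorm φ ev s y₀) :=
          mul_le_mul_of_nonneg_left (hpiece N t ht) (mul_nonneg hC (Real.exp_pos _).le)
      _ = _ := by ring
  set u : ℝ → EuclideanSpace ℂ (Fin m) := fun t =>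
    if h : y t ∈ (piecewiseFeedback B φ ev lam σ T t).domain then
      piecewiseFeedback B φ ev lam σ T t ⟨y t, h⟩ else 0 with hu
  refine ⟨u, fun t ht => ?_, ?_⟩
  · obtain ⟨N, hN⟩ := exists_mem_Ico_switch switchTime_zero hlim ht
    obtain ⟨h, -⟩ := hval N t hN
    exact ⟨h, by simp only [hu, dif_pos h]⟩
  · have h0 : Tendsto (fun N => C * (E (N + 1) * F N) * powNorm φ ev s y₀) atTop (𝓝 0) := by
      simpa only [mul_zero, zero_mul] using (hEF.const_mul C).mul_const (powNorm φ ev s y₀)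
    refine tendsto_zero_iff_norm_tendsto_zero.2 (tendsto_zero_of_le_switch hτ switchTime_zero
      hlim hτT (fun t => norm_nonneg _) h0 fun N t ht => ?_)
    obtain ⟨h, hle⟩ := hval N t ht
    simpa only [hu, dif_pos h] using hle

end Parameters

end Backstepping

theorem mainTheorem3 {H : Type*} [NormedAddCommGroup H] [InnerProductSpace ℂ H]
    [CompleteSpace H] {m : ℕ} (A : H →ₗ.[ℂ] H)
    (B : EuclideanSpace ℂ (Fin m) →L[ℂ] Backstepping.DualAdj A)
    (φ : HilbertBasis (Fin m × ℕ) ℂ H) (ev : Fin m → ℕ → ℂ) (α : ℝ)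
    (hAB : Backstepping.Framework A B φ ev α) (γ : ℝ) (hγ : α / (α - 1) < γ) :
    ∃ (C : ℝ) (lam : ℕ → ℝ),
      (∀ N : ℕ, 1 ≤ N → lam N ∈ Icc ((N : ℝ) ^ γ) ((N : ℝ) ^ γ + C) ∧
        (lam N : ℂ) ∉ Backstepping.resonantSet ev) ∧
      ∀ σ : ℝ, α / (α - 1) < σ → σ < γ → ∀ T : ℝ, 0 < T →
        (Summable fun q : ℕ => lam (q + 1) ^ (-(1 / σ))) ∧
        Tendsto (Backstepping.switchTime lam σ T) atTop (𝓝 T) ∧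
        ∀ s : ℝ, 0 ≤ s → s < 1 - 1 / (2 * α) →
          ∃ M : ℝ, ∀ y₀ ∈ Backstepping.powDomain φ ev s, ∃ y : ℝ → H,
            -- existence, uniqueness, continuous dependence
            Backstepping.IsSolution A B φ ev s T
              (Backstepping.piecewiseFeedback B φ ev lam σ T) y₀ y ∧
            (∀ z : ℝ → H, Backstepping.IsSolution A B φ ev s T
              (Backstepping.piecewiseFeedback B φ ev lam σ T) y₀ z → EqOn z y (Ico 0 T)) ∧
            (∀ t ∈ Ico 0 T,
              Backstepping.powNorm φ ev s (y t) ≤ M * Backstepping.powNorm φ ev s y₀) ∧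
            -- the solution is continuous up to time `T` and vanishes there
            Backstepping.ContinuousOnPow φ ev s y (Icc 0 T) ∧ y T = 0 ∧
            -- the control is well defined and tends to zero
            (1 / (2 * α) < s → ∃ u : ℝ → EuclideanSpace ℂ (Fin m),
              (∀ t ∈ Ico 0 T,
                ∃ h : y t ∈ (Backstepping.piecewiseFeedback B φ ev lam σ T t).domain,
                  Backstepping.piecewiseFeedback B φ ev lam σ T t ⟨y t, h⟩ = u t) ∧
              Tendsto u (𝓝[<] T) (𝓝 0)) := by
  have hα := hAB.one_lt
  have hγ' : 0 < γ := (div_pos (by linarith) (by linarith)).trans hγ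
  obtain ⟨Cd, κ, hCd, hκ, lam, hlam⟩ := hAB.exists_parameters hγ'.le
  refine ⟨1, lam, fun N hN => ⟨(hlam N hN).1, (hlam N hN).2.notMem_resonantSet⟩,
    fun σ hσ hσγ T hT => ?_⟩
  have hσ0 : 0 < σ := (div_pos (by linarith) (by linarith)).trans hσ
  have hle : ∀ q : ℕ, ((q : ℝ) + 1) ^ γ ≤ lam (q + 1) := fun q => by
    simpa only [Nat.cast_add, Nat.cast_one] using (hlam (q + 1) (by omega)).1.1
  have hsum := Backstepping.summable_rpow_of_rpow_le hσ0 hσγ hle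
  have hlam0 : ∀ q : ℕ, 0 < lam (q + 1) := fun q =>
    (Real.rpow_pos_of_pos (by positivity) γ).trans_le (hle q)
  exact ⟨hsum, Backstepping.tendsto_switchTime hlam0 hsum, fun s hs hs' =>
    hAB.exists_null_controlled_solution hCd hκ hγ' hlam hσ hT hs hs' hsum⟩
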